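/- Let $G$ be a compact Lie group and let $\pi: P \to \Sigma$ be a smooth principal $G$-bundle (with $G$ acting on $P$ from the right) over a smooth surface $\Sigma$ of genus $1$, i.e. a smooth manifold diffeomorphic to the torus. Let $\mathrm{Aut}(P)$ be the group of $G$-equivariant diffeomorphisms of $P$ covering a diffeomorphism of $\Sigma$, with the compact-open topology. A \emph{frame} in $P$ is a continuous group homomorphism $\gamma: \mathbb{C} \to \mathrm{Aut}(P)$ such that the induced action of $\mathbb{C}$ on $\Sigma$, written $z \mapsto \tilde\gamma(z) \in \mathrm{Diff}(\Sigma)$, is transitive. There is a bijection $\gamma \mapsto (\Lambda, [\eta], \nu)$ from the set of frames in $P$ to the set of triples in which $\Lambda \subset \mathbb{C}$ is a lattice, $[\eta]$ is the class of a diffeomorphism $\eta: \mathbb{C}/\Lambda \to \Sigma$ modulo precomposition with translations of $\mathbb{C}/\Lambda$, and $\nu$ is a flat principal connection on $P \to \Sigma$. It is characterized as follows, for every representative $\eta$ of $[\eta]$. \begin{enumerate} \item $\Lambda$ is the isotropy group of every point of $\Sigma$ under $\tilde\gamma$, and $\tilde\gamma(z)(\eta(c)) = \eta(c + [z])$ for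 all $z \in \mathbb{C}$ and $c \in \mathbb{C}/\Lambda$. \item Every smooth path $\alpha: [0,1] \to \Sigma$ can be written as $\alpha(t) = \eta([\tilde\alpha(t)])$ with a smooth path $\tilde\alpha: [0,1] \to \mathbb{C}$, and for each such $\tilde\alpha$ the parallel transport $P_{\alpha(0)} \to P_{\alpha(1)}$ of $\nu$ along $\alpha$ is the restriction of $\gamma(\tilde\alpha(1) - \tilde\alpha(0))$. \item Conversely, for $z \in \mathbb{C}$, $p \in P$ and any smooth path $\alpha: [0,1] \to \mathbb{C}$ from $0$ to $z$, the point $\gamma(z)(p)$ is the end point of the $\nu$-horizontal lift, starting at $p$, of the path $t \mapsto \eta(\eta^{-1}(\pi(p)) + [\alpha(t)])$ in $\Sigma$. \end{enumerate} -/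

import Mathlib

open scoped Manifold ContDiff Topology

noncomputable section

/-! ### Lattices in the complex plane and the quotient tori -/

/-- A lattice in `ℂ`: a discrete subgroup that spans `ℂ` over `ℝ`. -/
@[ext]
structure PlaneLattice where
  toSubmodule : Submodule ℤ ℂ
  discrete : DiscreteTopology toSubmodule
  isZLattice : IsZLattice ℝ toSubmodule

namespace PlaneLattice

/-- The underlying additive subgroup. -/
def toAddSubgroup (L : PlaneLattice) : AddSubgroup ℂ := L.toSubmodule.toAddSubgroup

/-- The quotient group `ℂ / Λ`, with the quotient topology. -/
abbrev Torus (L : PlaneLattice) : Type := ℂ ⧸ L.toAddSubgroup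

/-- The projection `ℂ → ℂ / Λ`. -/
def toTorus (L : PlaneLattice) (z : ℂ) : L.Torus := QuotientAddGroup.mk z

theorem isLocalHomeomorph_toTorus (L : PlaneLattice) : IsLocalHomeomorph L.toTorus := by
  have h : IsDiscrete (L.toAddSubgroup : Set ℂ) := ⟨L.discrete⟩
  exact (L.toAddSubgroup.isAddQuotientCoveringMap_of_comm h).isCoveringMap.isLocalHomeomorph

theorem surjective_toTorus (L : PlaneLattice) : Function.Surjective L.toTorus :=
  QuotientAddGroup.mk_surjective

/-- The charts of `ℂ / Λ` are the local inverses of the projection `ℂ → ℂ / Λ`. -/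
instance (L : PlaneLattice) : ChartedSpace ℂ L.Torus :=
  L.isLocalHomeomorph_toTorus.chartedSpace L.surjective_toTorus

theorem toTorus_chart (L : PlaneLattice) {e : OpenPartialHomeomorph L.Torus ℂ}
    (he : e ∈ atlas ℂ L.Torus) {x : L.Torus} (hx : x ∈ e.source) : L.toTorus (e x) = x := by
  obtain ⟨q, rfl⟩ := he
  simp only [chartAt_self_eq, OpenPartialHomeomorph.trans_refl] at hx ⊢
  exact L.isLocalHomeomorph_toTorus.apply_localInverseAt_of_mem hx

/-- The transition maps of `ℂ / Λ` are locally translations by elements of `Λ`. -/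
instance (L : PlaneLattice) : IsManifold 𝓘(ℝ, ℂ) ∞ L.Torus := by
  refine isManifold_of_contDiffOn _ _ _ fun e e' he he' => ?_
  simp only [modelWithCornersSelf_coe, modelWithCornersSelf_coe_symm, Function.id_comp,
    Function.comp_id, Set.range_id, Set.preimage_id, Set.inter_univ]
  intro z hz
  set f := e.symm.trans e' with hf
  have hcont : ContinuousAt f z := f.continuousAt hz
  have hmem : ∀ w ∈ f.source, f w - w ∈ L.toSubmodule := by
    intro w hw
    have hw1 : w ∈ e.target := by simpa using hw.1
    have hw2 : e.symm w ∈ e'.source := hw.2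
    have h1 : L.toTorus (f w) = L.toTorus w := by
      have := L.toTorus_chart he (e.map_target hw1)
      rw [e.right_inv hw1] at this
      rw [this]
      exact L.toTorus_chart he' hw2
    have h2 := (QuotientAddGroup.eq (s := L.toAddSubgroup)).1 h1.symm
    rw [neg_add_eq_sub] at h2
    exact h2
  have hev : ∀ᶠ w in 𝓝 z, f w - w = f z - z := by
    have hd := L.discrete
    obtain ⟨V, hV, hVeq⟩ := isOpen_induced_iff.1
      (isOpen_discrete ({⟨f z - z, hmem z hz⟩} : Set L.toSubmodule))
    have hzV : f z - z ∈ V := by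
      have : (⟨f z - z, hmem z hz⟩ : L.toSubmodule) ∈ Subtype.val ⁻¹' V := by
        rw [hVeq]; rfl
      exact this
    have hc : ContinuousAt (fun w => f w - w) z := hcont.sub continuousAt_id
    filter_upwards [hc.preimage_mem_nhds (hV.mem_nhds hzV), f.open_source.mem_nhds hz]
      with w hw1 hw2
    have : (⟨f w - w, hmem w hw2⟩ : L.toSubmodule) ∈ Subtype.val ⁻¹' V := hw1
    rw [hVeq] at this
    exact congrArg Subtype.val this
  have : ContDiffAt ℝ ∞ f z := by
    refine ContDiffAt.congr_of_eventuallyEq (f := fun w => w + (f z - z)) (by fun_prop) ?_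
    filter_upwards [hev] with w hw
    rw [← hw]; ring
  exact this.contDiffWithinAt

end PlaneLattice

/-! ### Smooth principal bundles over surfaces of genus one -/

/-- A smooth manifold is a surface of genus one if it is diffeomorphic to the standard torus. -/
def IsGenusOneSurface {E H : Type*} [NormedAddCommGroup E] [NormedSpace ℝ E] [TopologicalSpace H]
    (I : ModelWithCorners ℝ E H) (S : Type*) [TopologicalSpace S] [ChartedSpace H S] : Prop :=
  Nonempty (S ≃ₘ^∞⟮I, (𝓡 1).prod (𝓡 1)⟯ (Circle × Circle))

/-- A smooth principal `G`-bundle `P → S`: a smooth right action of `G` on `P` and a smooth map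
`P → S` which is locally, and `G`-equivariantly, the projection `U × G → U`. -/
structure SmoothPrincipalBundle
    {EG HG EP HP ES HS : Type*}
    [NormedAddCommGroup EG] [NormedSpace ℝ EG] [TopologicalSpace HG]
    [NormedAddCommGroup EP] [NormedSpace ℝ EP] [TopologicalSpace HP]
    [NormedAddCommGroup ES] [NormedSpace ℝ ES] [TopologicalSpace HS]
    (IG : ModelWithCorners ℝ EG HG) (IP : ModelWithCorners ℝ EP HP)
    (IS : ModelWithCorners ℝ ES HS)
    (G : Type*) [TopologicalSpace G] [ChartedSpace HG G] [Group G]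
    (P : Type*) [TopologicalSpace P] [ChartedSpace HP P]
    (S : Type*) [TopologicalSpace S] [ChartedSpace HS S] where
  /-- the bundle projection -/
  proj : P → S
  /-- the right action of the structure group -/
  act : P → G → P
  contMDiff_proj : ContMDiff IP IS ∞ proj
  contMDiff_act : ContMDiff (IP.prod IG) IP ∞ fun x : P × G => act x.1 x.2
  act_one : ∀ p, act p 1 = p
  act_mul : ∀ p g h, act p (g * h) = act (act p g) h
  proj_act : ∀ p g, proj (act p g) = proj p
  locally_trivial : ∀ b : S, ∃ (U : Set S) (φ : OpenPartialHomeomorph P (S × G)),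
    IsOpen U ∧ b ∈ U ∧ φ.source = proj ⁻¹' U ∧ φ.target = U ×ˢ Set.univ ∧
    ContMDiffOn IP (IS.prod IG) ∞ φ φ.source ∧
    ContMDiffOn (IS.prod IG) IP ∞ φ.symm φ.target ∧
    (∀ p ∈ φ.source, (φ p).1 = proj p) ∧
    (∀ p ∈ φ.source, ∀ g, (φ (act p g)).2 = (φ p).2 * g)

section

variable {EG HG EP HP ES HS : Type*}
  [NormedAddCommGroup EG] [NormedSpace ℝ EG] [TopologicalSpace HG]
  [NormedAddCommGroup EP] [NormedSpace ℝ EP] [TopologicalSpace HP]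
  [NormedAddCommGroup ES] [NormedSpace ℝ ES] [TopologicalSpace HS]
  {IG : ModelWithCorners ℝ EG HG} {IP : ModelWithCorners ℝ EP HP}
  {IS : ModelWithCorners ℝ ES HS}
  {G : Type*} [TopologicalSpace G] [ChartedSpace HG G] [Group G]
  {P : Type*} [TopologicalSpace P] [ChartedSpace HP P]
  {S : Type*} [TopologicalSpace S] [ChartedSpace HS S]

/-! ### The automorphism group of a principal bundle -/

/-- An automorphism of `P → S`: a `G`-equivariant diffeomorphism of `P` that covers a
diffeomorphism of `S`. -/
@[ext]
structure BundleAut (Q : SmoothPrincipalBundle IG IP IS G P S) where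
  /-- the diffeomorphism of the total space -/
  total : P ≃ₘ^∞⟮IP, IP⟯ P
  /-- the diffeomorphism of the base that it covers -/
  base : S ≃ₘ^∞⟮IS, IS⟯ S
  proj_total : ∀ p, Q.proj (total p) = base (Q.proj p)
  total_act : ∀ p g, total (Q.act p g) = Q.act (total p) g

namespace BundleAut

variable {Q : SmoothPrincipalBundle IG IP IS G P S}

/-- Automorphisms form a group under composition, `(f * g) p = f (g p)`. -/
instance : Group (BundleAut Q) where
  mul f g :=
    { total := g.total.trans f.total
      base := g.base.trans f.base
      proj_total := fun p => by simp [f.proj_total, g.proj_total]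
      total_act := fun p a => by simp [f.total_act, g.total_act] }
  one :=
    { total := Diffeomorph.refl IP P ∞
      base := Diffeomorph.refl IS S ∞
      proj_total := fun p => rfl
      total_act := fun p a => rfl }
  inv f :=
    { total := f.total.symm
      base := f.base.symm
      proj_total := fun p => by
        apply EquivLike.injective f.base
        rw [← f.proj_total, f.total.apply_symm_apply, f.base.apply_symm_apply]
      total_act := fun p a => by
        apply EquivLike.injective f.total
        rw [f.total_act, f.total.apply_symm_apply, f.total.apply_symm_apply] }
  mul_assoc f g h := rfl
  one_mul f := rfl
  mul_one f := rfl
  inv_mul_cancel f := by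
    apply BundleAut.ext
    · exact Diffeomorph.self_trans_symm f.total
    · exact Diffeomorph.self_trans_symm f.base

/-- The underlying continuous map of the total space. -/
def toContinuousMap (f : BundleAut Q) : C(P, P) := ⟨f.total, f.total.continuous⟩

/-- The compact-open topology on the automorphism group. -/
instance : TopologicalSpace (BundleAut Q) :=
  TopologicalSpace.induced toContinuousMap inferInstance

end BundleAut

/-- A frame in `P`: a homomorphism of topological groups `ℂ → Aut(P)` such that the induced action
of `ℂ` on the base is transitive. -/
structure Frame (Q : SmoothPrincipalBundle IG IP IS G P S) where
  toHom : Multiplicative ℂ →ₜ* BundleAut Q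
  transitive : ∀ x y : S, ∃ z : ℂ, (toHom (Multiplicative.ofAdd z)).base x = y

namespace Frame

variable {Q : SmoothPrincipalBundle IG IP IS G P S}

/-- The diffeomorphism `γ(z)` of the total space. -/
def total (γ : Frame Q) (z : ℂ) : P ≃ₘ^∞⟮IP, IP⟯ P := (γ.toHom (Multiplicative.ofAdd z)).total

/-- The diffeomorphism of the base covered by `γ(z)`. -/
def base (γ : Frame Q) (z : ℂ) : S ≃ₘ^∞⟮IS, IS⟯ S := (γ.toHom (Multiplicative.ofAdd z)).base

end Frame

/-! ### Flat connections and parallel transport -/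

/-- `X` is a smooth vector field on the open set `U`. -/
def IsSmoothVectorFieldOn [IsManifold IP ∞ P] (X : ∀ p : P, TangentSpace IP p) (U : Set P) : Prop :=
  IsOpen U ∧ ContMDiffOn IP IP.tangent ∞ (fun p => (⟨p, X p⟩ : TangentBundle IP P)) U

/-- A (principal) connection on `P → S`: a smooth `G`-invariant distribution of horizontal
subspaces, complementary to the vertical subspaces `ker dπ`. -/
@[ext]
structure PrincipalConnection [IsManifold IP ∞ P]
    (Q : SmoothPrincipalBundle IG IP IS G P S) where
  /-- the horizontal subspaces -/
  hor : ∀ p : P, Submodule ℝ (TangentSpace IP p)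
  isCompl : ∀ p, IsCompl (hor p) (LinearMap.ker (mfderiv IP IS Q.proj p).toLinearMap)
  smooth : ∀ p, ∀ v ∈ hor p, ∃ (U : Set P) (X : ∀ q : P, TangentSpace IP q),
    p ∈ U ∧ IsSmoothVectorFieldOn X U ∧ (∀ q ∈ U, X q ∈ hor q) ∧ X p = v
  invariant : ∀ p g,
    (hor p).map (mfderiv IP IP (fun q => Q.act q g) p).toLinearMap = hor (Q.act p g)

/-- A connection is flat if its curvature vanishes, that is, if the bracket of any two (local)
horizontal vector fields has no vertical component. -/
@[ext]
structure FlatConnection [IsManifold IP ∞ P]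
    (Q : SmoothPrincipalBundle IG IP IS G P S) extends PrincipalConnection Q where
  flat : ∀ (U : Set P) (X Y : ∀ p : P, TangentSpace IP p),
    IsSmoothVectorFieldOn X U → IsSmoothVectorFieldOn Y U →
    (∀ p ∈ U, X p ∈ hor p) → (∀ p ∈ U, Y p ∈ hor p) →
    ∀ p ∈ U, VectorField.mlieBracket IP X Y p ∈ hor p

/-- `β : [0,1] → P` is a smooth horizontal lift of the path `α : [0,1] → S`. (Paths are represented
by functions on `ℝ` of which only the values on `[0,1]` matter.) -/
def PrincipalConnection.IsHorizontalLift [IsManifold IP ∞ P]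
    {Q : SmoothPrincipalBundle IG IP IS G P S} (ν : PrincipalConnection Q)
    (α : ℝ → S) (β : ℝ → P) : Prop :=
  ContMDiffOn 𝓘(ℝ, ℝ) IP ∞ β (Set.Icc 0 1) ∧
  (∀ t ∈ Set.Icc (0 : ℝ) 1, Q.proj (β t) = α t) ∧
  (∀ t ∈ Set.Icc (0 : ℝ) 1,
    mfderivWithin 𝓘(ℝ, ℝ) IP β (Set.Icc 0 1) t (1 : ℝ) ∈ ν.hor (β t))

/-- Parallel transport along `α : [0,1] → S` carries `p` to `q`. -/
def PrincipalConnection.Transports [IsManifold IP ∞ P]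
    {Q : SmoothPrincipalBundle IG IP IS G P S} (ν : PrincipalConnection Q)
    (α : ℝ → S) (p q : P) : Prop :=
  ∃ β : ℝ → P, ν.IsHorizontalLift α β ∧ β 0 = p ∧ β 1 = q

/-! ### Triples `(Λ, η, ν)` -/

/-- Two diffeomorphisms `ℂ / Λ ≅ S` are identified if they differ by a translation of `ℂ / Λ`. -/
def translationSetoid (IS : ModelWithCorners ℝ ES HS) (S : Type*) [TopologicalSpace S]
    [ChartedSpace HS S] (L : PlaneLattice) :
    Setoid (L.Torus ≃ₘ^∞⟮𝓘(ℝ, ℂ), IS⟯ S) where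
  r η η' := ∃ a : L.Torus, ∀ c, η' c = η (c + a)
  iseqv :=
    { refl := fun η => ⟨0, fun c => by rw [add_zero]⟩
      symm := fun {η η'} ⟨a, h⟩ => ⟨-a, fun c => by rw [h, neg_add_cancel_right]⟩
      trans := fun {η η' η''} ⟨a, h⟩ ⟨b, h'⟩ => ⟨b + a, fun c => by rw [h', h, add_assoc]⟩ }

/-- A triple `(Λ, η, ν)`: a lattice `Λ` in `ℂ`, a diffeomorphism `η : ℂ / Λ ≅ S` up to translation
in `ℂ / Λ`, and a flat connection `ν` on `P → S`. -/
structure FlatTriple [IsManifold IP ∞ P] (Q : SmoothPrincipalBundle IG IP IS G P S) where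
  lattice : PlaneLattice
  marking : Quotient (translationSetoid IS S lattice)
  connection : FlatConnection Q

/-- The relation between a frame `γ` and the geometric data `(Λ, η, ν)` that it corresponds to. -/
structure Frame.CorrespondsTo [IsManifold IP ∞ P] {Q : SmoothPrincipalBundle IG IP IS G P S}
    (γ : Frame Q) (L : PlaneLattice) (η : L.Torus ≃ₘ^∞⟮𝓘(ℝ, ℂ), IS⟯ S)
    (ν : FlatConnection Q) : Prop where
  /-- `Λ` is the isotropy group of the action of `ℂ` on the base. -/
  isotropy : ∀ (x : S) (z : ℂ), z ∈ L.toSubmodule ↔ γ.base z x = x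
  /-- `η` identifies the action of `ℂ` on the base with translation in `ℂ / Λ`. -/
  base_eq : ∀ (c : L.Torus) (z : ℂ), γ.base z (η c) = η (c + L.toTorus z)
  /-- Every smooth path in the base lifts to a smooth path in `ℂ`. -/
  exists_lift : ∀ α : ℝ → S, ContMDiffOn 𝓘(ℝ, ℝ) IS ∞ α (Set.Icc 0 1) →
    ∃ a : ℝ → ℂ, ContDiffOn ℝ ∞ a (Set.Icc 0 1) ∧ ∀ t ∈ Set.Icc (0 : ℝ) 1, η (L.toTorus (a t)) = α t
  /-- The parallel transport of `ν` along a smooth path `α` in the base is everywhere defined on the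
  fibre over `α 0`, and is given by `γ (a 1 - a 0)` for any lift `a` of `α` to `ℂ`. -/
  transport : ∀ (α : ℝ → S) (a : ℝ → ℂ), ContDiffOn ℝ ∞ a (Set.Icc 0 1) →
    (∀ t ∈ Set.Icc (0 : ℝ) 1, η (L.toTorus (a t)) = α t) →
    ∀ p q : P, Q.proj p = α 0 → (ν.Transports α p q ↔ q = γ.total (a 1 - a 0) p)
  /-- `γ z p` is the end point of the horizontal lift, starting at `p`, of the image of any smooth
  path in `ℂ` from `0` to `z` under `w ↦ η (η⁻¹ (π p) + [w])`. -/
  total_eq : ∀ (z : ℂ) (p : P) (a : ℝ → ℂ), ContDiffOn ℝ ∞ a (Set.Icc 0 1) → a 0 = 0 → a 1 = z →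
    ∀ q : P, ν.Transports (fun t => η (η.symm (Q.proj p) + L.toTorus (a t))) p q ↔ q = γ.total z p

end

end

/-! A frame is a continuous action of `ℂ` on `P` by bundle automorphisms. The first point is that
such an action is automatically smooth in both variables (`contMDiff_of_continuous_action`, a case
of Bochner and Montgomery), so that it has infinitesimal generators `gen p : ℂ →L[ℝ] TangentSpace I
p`.

On the base the action is transitive. A generator vanishing at one point would make a whole real
line act trivially there, and the surface would be the image of a curve; hence orbit maps `ℂ → S`
are local diffeomorphisms. Isotropy is then discrete, and compactness of `S` forces it to span `ℂ`.
This gives the lattice and the marking (`exists_lattice_diffeomorph`). On `P` the planes tangent to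
the orbits project isomorphically to the base, are invariant because the action commutes with `G`,
and are involutive because `ℂ` is commutative: they form a flat connection (`Frame.connection`). A
horizontal curve over `η [a t]`, transported back by `γ (-(a t - a 0))`, has zero derivative, which
identifies parallel transport with `γ` (`eq_total_of_isHorizontalLift`).

Conversely, given a marking and a flat connection, the constant vector fields on the torus are
lifted horizontally. The bracket of two lifts is horizontal by flatness and projects to the bracket
of constant fields, so it vanishes (`mlieBracket_horizontalLift`). Commuting fields have local
integral surfaces (`exists_hasFDerivAt_eq_of_commuting`). Equivariance and compactness of `S` make
their size uniform (`exists_uniform_isOrbitOn`), and the resulting local flow extends to a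
homomorphism on `ℂ`, since the plane is divisible and commutative (`exists_monoidHom_of_local`).

The correspondence is one-to-one: the isotropy determines the lattice, the base action determines
the marking up to translation, the generators span the horizontal spaces (`hor_eq`), and end points
of horizontal lifts determine the frame (`frame_eq`). -/

/-! ### Families of smooth maps with jointly continuous derivatives -/

section JetFamilies

open Set Metric Filter MeasureTheory Function

universe u v

variable {W : Type v} [TopologicalSpace W] {X : Type u} [NormedAddCommGroup X] [NormedSpace ℝ X]

/-- All derivatives up to order `k` of `f` on `t` are bounded by `C`. -/
def HasBoundedJet (C : ℝ) (t : Set X) :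
    ℕ → ∀ {Y : Type u} [NormedAddCommGroup Y] [NormedSpace ℝ Y], (X → Y) → Prop
  | 0, _, _, _, f => ∀ x ∈ t, ‖f x‖ ≤ C
  | k + 1, _, _, _, f => (∀ x ∈ t, ‖f x‖ ≤ C) ∧ HasBoundedJet C t k (fderiv ℝ f)

/-- All derivatives up to order `k` in the second variable of the family `f` exist and are jointly
continuous on `s × t`. -/
def JetContinuousOn (s : Set W) (t : Set X) :
    ℕ → ∀ {Y : Type u} [NormedAddCommGroup Y] [NormedSpace ℝ Y], (W → X → Y) → Prop
  | 0, _, _, _, f => ContinuousOn (uncurry f) (s ×ˢ t)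
  | k + 1, Y, _, _, f => ContinuousOn (uncurry f) (s ×ˢ t) ∧ ∃ f' : W → X → X →L[ℝ] Y,
      (∀ w ∈ s, ∀ x ∈ t, HasFDerivAt (f w) (f' w x) x) ∧ JetContinuousOn s t k f'

variable {Y : Type u} [NormedAddCommGroup Y] [NormedSpace ℝ Y]

namespace HasBoundedJet

theorem norm_le {C : ℝ} {t : Set X} {k : ℕ} {f : X → Y} (h : HasBoundedJet C t k f) :
    ∀ x ∈ t, ‖f x‖ ≤ C := by
  cases k with
  | zero => exact h
  | succ k => exact h.1

theorem mono {C C' : ℝ} {t : Set X} {k : ℕ} {f : X → Y} (h : HasBoundedJet C t k f)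
    (hC : C ≤ C') : HasBoundedJet C' t k f := by
  induction k generalizing Y with
  | zero => exact fun x hx => (h x hx).trans hC
  | succ k ih => exact ⟨fun x hx => (h.1 x hx).trans hC, ih h.2⟩

theorem mono_set {C : ℝ} {t t' : Set X} {k : ℕ} {f : X → Y} (h : HasBoundedJet C t k f)
    (ht : t' ⊆ t) : HasBoundedJet C t' k f := by
  induction k generalizing Y with
  | zero => exact fun x hx => h x (ht hx)
  | succ k ih => exact ⟨fun x hx => h.1 x (ht hx), ih h.2⟩

theorem exists_of_contDiffOn {U t : Set X} {f : X → Y} (hU : IsOpen U) (ht : IsCompact t)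
    (htU : t ⊆ U) (hf : ContDiffOn ℝ ∞ f U) (k : ℕ) : ∃ n : ℕ, HasBoundedJet n t k f := by
  have key : ∀ {Y : Type u} [NormedAddCommGroup Y] [NormedSpace ℝ Y] {f : X → Y},
      ContDiffOn ℝ ∞ f U → ∃ n : ℕ, ∀ x ∈ t, ‖f x‖ ≤ n := by
    intro Y _ _ f hf
    obtain ⟨C, hC⟩ := ht.exists_bound_of_continuousOn (hf.continuousOn.mono htU)
    obtain ⟨n, hn⟩ := exists_nat_ge C
    exact ⟨n, fun x hx => (hC x hx).trans hn⟩
  induction k generalizing Y with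
  | zero => exact key hf
  | succ k ih =>
    obtain ⟨n, hn⟩ := key hf
    obtain ⟨m, hm⟩ := ih ((contDiffOn_infty_iff_fderiv_of_isOpen hU).1 hf).2
    exact ⟨max n m, fun x hx => (hn x hx).trans (by simp), hm.mono (by simp)⟩

end HasBoundedJet

/-- The mean value inequality for `fderiv ℝ f` on the convex ball: a bound on second derivatives is
a Lipschitz bound, uniform over any family sharing the constant `C`. -/
theorem norm_fderiv_sub_le_of_hasBoundedJet {C : ℝ} {t : Set X} {k : ℕ} {f : X → Y}
    (ht : IsOpen t) (hf : ContDiffOn ℝ ∞ f t) (h : HasBoundedJet C t (k + 2) f)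
    {x : X} {r : ℝ} (hr : ball x r ⊆ t) {y : X} (hy : y ∈ ball x r) :
    ‖fderiv ℝ f y - fderiv ℝ f x‖ ≤ C * ‖y - x‖ := by
  have h1 : ContDiffOn ℝ ∞ (fderiv ℝ f) t :=
    ((contDiffOn_infty_iff_fderiv_of_isOpen ht).1 hf).2
  refine (convex_ball x r).norm_image_sub_le_of_norm_fderiv_le (𝕜 := ℝ)
    (fun z hz => ?_) (fun z hz => h.2.2.norm_le z (hr hz)) ?_ hy
  · exact (h1.contDiffAt (ht.mem_nhds (hr hz))).differentiableAt (by simp)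
  · exact mem_ball_self (pos_of_mem_ball hy)

/-- If a family is pointwise continuous in the parameter and has bounded second derivatives, then
its first derivatives are continuous in the parameter. -/
theorem continuousWithinAt_fderiv_of_hasBoundedJet [FiniteDimensional ℝ X] {C : ℝ} {s : Set W}
    {t : Set X} {k : ℕ} {f : W → X → Y} {w₀ : W} (ht : IsOpen t)
    (hf : ∀ w ∈ s, ContDiffOn ℝ ∞ (f w) t) (hf₀ : ContDiffOn ℝ ∞ (f w₀) t)
    (hb : ∀ w ∈ s, HasBoundedJet C t (k + 2) (f w))
    (hc : ∀ y ∈ t, ContinuousWithinAt (fun w => f w y) s w₀) {x : X} (hx : x ∈ t) :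
    ContinuousWithinAt (fun w => fderiv ℝ (f w) x) s w₀ := by
  rw [continuousWithinAt_clm_apply]
  intro v
  obtain ⟨r, hr, hrt⟩ := Metric.isOpen_iff.1 ht x hx
  rw [ContinuousWithinAt, Metric.tendsto_nhds]
  intro ε hε
  have hd₀ : HasDerivAt (fun h : ℝ => f w₀ (x + h • v)) (fderiv ℝ (f w₀) x v) 0 := by
    have h1 : HasFDerivAt (f w₀) (fderiv ℝ (f w₀) x) (x + (0 : ℝ) • v) := by
      rw [zero_smul, add_zero]
      exact ((hf₀.contDiffAt (ht.mem_nhds hx)).differentiableAt (by simp)).hasFDerivAt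
    have h2 : HasDerivAt (fun h : ℝ => x + h • v) v 0 := by
      simpa using ((hasDerivAt_id (0 : ℝ)).smul_const v).const_add x
    exact h1.comp_hasDerivAt (0 : ℝ) h2
  have e1 : ∀ᶠ h : ℝ in 𝓝[>] 0, ‖f w₀ (x + h • v) - f w₀ x - h • fderiv ℝ (f w₀) x v‖
      ≤ ε / 4 * ‖h‖ := by
    have := (hasDerivAt_iff_isLittleO.1 hd₀).def (show 0 < ε / 4 by positivity)
    simp only [sub_zero, zero_smul, add_zero] at this
    exact this.filter_mono nhdsWithin_le_nhds
  have e2 : ∀ᶠ h : ℝ in 𝓝[>] 0, h * ‖v‖ < r ∧ C * (h * ‖v‖ ^ 2) < ε / 4 := by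
    have c1 : Tendsto (fun h : ℝ => h * ‖v‖) (𝓝 0) (𝓝 (0 * ‖v‖)) :=
      (continuous_id.mul continuous_const).tendsto _
    have c2 : Tendsto (fun h : ℝ => C * (h * ‖v‖ ^ 2)) (𝓝 0) (𝓝 (C * (0 * ‖v‖ ^ 2))) :=
      (continuous_const.mul (continuous_id.mul continuous_const)).tendsto _
    rw [zero_mul] at c1
    rw [zero_mul, mul_zero] at c2
    exact ((c1.eventually (gt_mem_nhds hr)).and
      (c2.eventually (gt_mem_nhds (by positivity)))).filter_mono nhdsWithin_le_nhds
  -- The increment `h` is fixed before `w` varies. Replacing derivatives by difference quotients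
  -- costs `ε / 4 * h` at `w₀` by differentiability and less than `ε / 4 * h` at every other `w` by
  -- the uniform second-derivative bound; continuity in `w` at the two points `x` and `x + h • v`
  -- costs the remaining two quarters.
  obtain ⟨h, h1, ⟨h2, h3⟩, hpos⟩ := (e1.and (e2.and self_mem_nhdsWithin)).exists
  have hpos : 0 < h := hpos
  have hmem : x + h • v ∈ ball x r := by
    simp [norm_smul, abs_of_pos hpos, h2]
  have t1 := Metric.tendsto_nhds.1 (hc _ (hrt hmem)) (ε / 4 * h) (by positivity)
  have t2 := Metric.tendsto_nhds.1 (hc _ hx) (ε / 4 * h) (by positivity)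
  filter_upwards [t1, t2, self_mem_nhdsWithin] with w hw1 hw2 hws
  have h4 : ‖f w (x + h • v) - f w x - fderiv ℝ (f w) x (x + h • v - x)‖
      ≤ (C * (h * ‖v‖)) * ‖x + h • v - x‖ := by
    have hx' : x ∈ closedBall x (h * ‖v‖) := mem_closedBall_self (by positivity)
    have hsub : closedBall x (h * ‖v‖) ⊆ ball x r := closedBall_subset_ball h2
    refine (convex_closedBall x (h * ‖v‖)).norm_image_sub_le_of_norm_fderiv_le' (𝕜 := ℝ)
      (fun z hz => ?_) (fun z hz => ?_) hx' ?_
    · exact ((hf w hws).contDiffAt (ht.mem_nhds (hrt (hsub hz)))).differentiableAt (by simp)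
    · refine (norm_fderiv_sub_le_of_hasBoundedJet ht (hf w hws) (hb w hws) hrt (hsub hz)).trans ?_
      have hC : 0 ≤ C := (norm_nonneg _).trans ((hb w hws).norm_le x hx)
      exact mul_le_mul_of_nonneg_left (mem_closedBall_iff_norm.1 hz) hC
    · simp [norm_smul, abs_of_pos hpos]
  simp only [add_sub_cancel_left, map_smul, norm_smul, Real.norm_eq_abs, abs_of_pos hpos] at h1 h4
  rw [dist_eq_norm] at hw1 hw2 ⊢
  have h5 : h * ‖fderiv ℝ (f w) x v - fderiv ℝ (f w₀) x v‖ < h * ε := by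
    have : h * ‖fderiv ℝ (f w) x v - fderiv ℝ (f w₀) x v‖
        = ‖h • (fderiv ℝ (f w) x v - fderiv ℝ (f w₀) x v)‖ := by
      rw [norm_smul, Real.norm_eq_abs, abs_of_pos hpos]
    rw [this]
    have e : h • (fderiv ℝ (f w) x v - fderiv ℝ (f w₀) x v)
        = -(f w (x + h • v) - f w x - h • fderiv ℝ (f w) x v)
          + (f w (x + h • v) - f w₀ (x + h • v)) - (f w x - f w₀ x)
          + (f w₀ (x + h • v) - f w₀ x - h • fderiv ℝ (f w₀) x v) := by
      rw [smul_sub]; abel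
    rw [e]
    refine lt_of_le_of_lt (norm_add_le _ _) ?_
    have n1 := norm_sub_le (-(f w (x + h • v) - f w x - h • fderiv ℝ (f w) x v)
          + (f w (x + h • v) - f w₀ (x + h • v))) (f w x - f w₀ x)
    have n2 := norm_add_le (-(f w (x + h • v) - f w x - h • fderiv ℝ (f w) x v))
      (f w (x + h • v) - f w₀ (x + h • v))
    rw [norm_neg] at n2
    have : C * (h * ‖v‖) * (h * ‖v‖) < ε / 4 * h := by
      calc C * (h * ‖v‖) * (h * ‖v‖) = C * (h * ‖v‖ ^ 2) * h := by ring
        _ < ε / 4 * h := by gcongr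
    linarith
  exact lt_of_mul_lt_mul_left h5 hpos.le

/-- Bounds on the derivatives of a family pass to the limit, with a loss of one derivative. -/
theorem HasBoundedJet.of_mem_closure [FiniteDimensional ℝ X] {C : ℝ} {s : Set W}
    {t : Set X} {k : ℕ} {f : W → X → Y} {w₀ : W} (ht : IsOpen t)
    (hf : ∀ w ∈ s, ContDiffOn ℝ ∞ (f w) t) (hf₀ : ContDiffOn ℝ ∞ (f w₀) t)
    (hb : ∀ w ∈ s, HasBoundedJet C t (k + 1) (f w))
    (hc : ∀ y ∈ t, ContinuousWithinAt (fun w => f w y) s w₀) (hw₀ : w₀ ∈ closure s) :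
    HasBoundedJet C t k (f w₀) := by
  have : (𝓝[s] w₀).NeBot := mem_closure_iff_nhdsWithin_neBot.1 hw₀
  induction k generalizing Y with
  | zero =>
    exact fun x hx => le_of_tendsto (hc x hx).norm
      (eventually_mem_nhdsWithin.mono fun w hw => (hb w hw).norm_le x hx)
  | succ k ih =>
    refine ⟨fun x hx => le_of_tendsto (hc x hx).norm
      (eventually_mem_nhdsWithin.mono fun w hw => (hb w hw).norm_le x hx), ?_⟩
    refine ih (f := fun w => fderiv ℝ (f w)) (fun w hw => ?_) ?_ (fun w hw => (hb w hw).2)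
      (fun x hx => continuousWithinAt_fderiv_of_hasBoundedJet ht hf hf₀ hb hc hx)
    · exact ((contDiffOn_infty_iff_fderiv_of_isOpen ht).1 (hf w hw)).2
    · exact ((contDiffOn_infty_iff_fderiv_of_isOpen ht).1 hf₀).2

theorem JetContinuousOn.continuousOn {s : Set W} {t : Set X} {k : ℕ} {f : W → X → Y}
    (h : JetContinuousOn s t k f) : ContinuousOn (uncurry f) (s ×ˢ t) := by
  cases k with
  | zero => exact h
  | succ k => exact h.1

/-- Continuity of `w ↦ fderiv ℝ (f w) x₀` at a fixed point and a Lipschitz bound in `x` that is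
uniform in `w` combine to joint continuity of the derivative. Each order of joint continuity uses a
bound of one order more. -/
theorem JetContinuousOn.of_hasBoundedJet [FiniteDimensional ℝ X] {C : ℝ} {s : Set W}
    {t : Set X} {k : ℕ} {f : W → X → Y} (ht : IsOpen t)
    (hf : ∀ w ∈ s, ContDiffOn ℝ ∞ (f w) t)
    (hb : ∀ w ∈ s, HasBoundedJet C t (k + 1) (f w))
    (hc : ContinuousOn (uncurry f) (s ×ˢ t)) : JetContinuousOn s t k f := by
  induction k generalizing Y with
  | zero => exact hc
  | succ k ih =>
    refine ⟨hc, fun w => fderiv ℝ (f w), fun w hw x hx => ?_, ?_⟩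
    · exact (((hf w hw).contDiffAt (ht.mem_nhds hx)).differentiableAt (by simp)).hasFDerivAt
    refine ih (fun w hw => ((contDiffOn_infty_iff_fderiv_of_isOpen ht).1 (hf w hw)).2)
      (fun w hw => (hb w hw).2) ?_
    rintro ⟨w₀, x₀⟩ ⟨hw₀, hx₀⟩
    have h1 : ContinuousWithinAt (fun w => fderiv ℝ (f w) x₀) s w₀ := by
      refine continuousWithinAt_fderiv_of_hasBoundedJet ht hf (hf w₀ hw₀) hb (fun y hy => ?_) hx₀
      have : ContinuousOn (fun w => uncurry f (w, y)) s :=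
        hc.comp (by fun_prop) (fun w hw => ⟨hw, hy⟩)
      exact this w₀ hw₀
    obtain ⟨r, hr, hrt⟩ := Metric.isOpen_iff.1 ht x₀ hx₀
    have h2 : ContinuousWithinAt (fun q : W × X => fderiv ℝ (f q.1) x₀) (s ×ˢ t) (w₀, x₀) :=
      ContinuousWithinAt.comp (f := Prod.fst) (x := (w₀, x₀)) (g := fun w => fderiv ℝ (f w) x₀)
        h1 continuous_fst.continuousWithinAt (fun q hq => hq.1)
    have h3 : Tendsto (fun q : W × X => fderiv ℝ (f q.1) q.2 - fderiv ℝ (f q.1) x₀)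
        (𝓝[s ×ˢ t] (w₀, x₀)) (𝓝 0) := by
      have hb0 : Tendsto (fun q : W × X => C * ‖q.2 - x₀‖) (𝓝[s ×ˢ t] (w₀, x₀)) (𝓝 0) := by
        have : Continuous (fun q : W × X => C * ‖q.2 - x₀‖) := by fun_prop
        have h := this.tendsto (w₀, x₀)
        simp only [sub_self, norm_zero, mul_zero] at h
        exact h.mono_left nhdsWithin_le_nhds
      refine squeeze_zero_norm' ?_ hb0
      have hn : ∀ᶠ q : W × X in 𝓝[s ×ˢ t] (w₀, x₀), q.2 ∈ ball x₀ r :=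
        (continuous_snd.tendsto (w₀, x₀)).mono_left nhdsWithin_le_nhds (ball_mem_nhds x₀ hr)
      filter_upwards [hn, self_mem_nhdsWithin] with q hq hqs
      exact norm_fderiv_sub_le_of_hasBoundedJet ht (hf q.1 hqs.1) (hb q.1 hqs.1) hrt hq
    have h4 := h3.add h2
    simp only [sub_add_cancel, zero_add] at h4
    exact h4

namespace JetContinuousOn

theorem of_succ {s : Set W} {t : Set X} {k : ℕ} {f : W → X → Y}
    (h : JetContinuousOn s t (k + 1) f) : JetContinuousOn s t k f := by
  induction k generalizing Y with
  | zero => exact h.1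
  | succ k ih =>
    obtain ⟨h1, f', h2, h3⟩ := h
    exact ⟨h1, f', h2, ih h3⟩

theorem add {s : Set W} {t : Set X} {k : ℕ} {f g : W → X → Y} (hf : JetContinuousOn s t k f)
    (hg : JetContinuousOn s t k g) : JetContinuousOn s t k (fun w x => f w x + g w x) := by
  induction k generalizing Y with
  | zero => exact ContinuousOn.add hf hg
  | succ k ih =>
    obtain ⟨f1, f', f2, f3⟩ := hf
    obtain ⟨g1, g', g2, g3⟩ := hg
    exact ⟨f1.add g1, fun w x => f' w x + g' w x,
      fun w hw x hx => (f2 w hw x hx).add (g2 w hw x hx), ih f3 g3⟩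

theorem clm_comp {Z : Type u} [NormedAddCommGroup Z] [NormedSpace ℝ Z] {s : Set W} {t : Set X}
    {k : ℕ} {f : W → X → Y} (hf : JetContinuousOn s t k f) (L : Y →L[ℝ] Z) :
    JetContinuousOn s t k (fun w x => L (f w x)) := by
  induction k generalizing Y Z with
  | zero => exact L.continuous.comp_continuousOn hf
  | succ k ih =>
    obtain ⟨f1, f', f2, f3⟩ := hf
    exact ⟨L.continuous.comp_continuousOn f1, fun w x => L.comp (f' w x),
      fun w hw x hx => L.hasFDerivAt.comp x (f2 w hw x hx),
      ih f3 (ContinuousLinearMap.compL ℝ X Y Z L)⟩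

theorem comp_clm {X' : Type u} [NormedAddCommGroup X'] [NormedSpace ℝ X'] {s : Set W} {t : Set X}
    {k : ℕ} {f : W → X → Y} (hf : JetContinuousOn s t k f) (M : X' →L[ℝ] X) :
    JetContinuousOn s (M ⁻¹' t) k (fun w x => f w (M x)) := by
  have hc : ∀ {Y : Type u} [NormedAddCommGroup Y] [NormedSpace ℝ Y] {f : W → X → Y},
      ContinuousOn (uncurry f) (s ×ˢ t) →
      ContinuousOn (uncurry fun w x => f w (M x)) (s ×ˢ (M ⁻¹' t)) := by
    intro Y _ _ f h
    exact h.comp (f := fun q : W × X' => (q.1, M q.2)) (by fun_prop) (fun q hq => hq)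
  induction k generalizing Y with
  | zero => exact hc hf
  | succ k ih =>
    obtain ⟨f1, f', f2, f3⟩ := hf
    exact ⟨hc f1, fun w x => (f' w (M x)).comp M,
      fun w hw x hx => (f2 w hw (M x) hx).comp x M.hasFDerivAt,
      (ih f3).clm_comp ((ContinuousLinearMap.compL ℝ X' X Y).flip M)⟩

theorem bilinear {Y₁ Y₂ Z : Type u} [NormedAddCommGroup Y₁] [NormedSpace ℝ Y₁]
    [NormedAddCommGroup Y₂] [NormedSpace ℝ Y₂] [NormedAddCommGroup Z] [NormedSpace ℝ Z]
    {s : Set W} {t : Set X} {k : ℕ} {f : W → X → Y₁} {g : W → X → Y₂}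
    (hf : JetContinuousOn s t k f) (hg : JetContinuousOn s t k g) (B : Y₁ →L[ℝ] Y₂ →L[ℝ] Z) :
    JetContinuousOn s t k (fun w x => B (f w x) (g w x)) := by
  have hc : ∀ {k : ℕ}, JetContinuousOn s t k f → JetContinuousOn s t k g →
      ContinuousOn (uncurry fun w x => B (f w x) (g w x)) (s ×ˢ t) := fun hf hg =>
    (B.continuous.comp_continuousOn hf.continuousOn).clm_apply hg.continuousOn
  induction k generalizing Y₁ Y₂ Z with
  | zero => exact hc hf hg
  | succ k ih =>
    -- The Leibniz rule pairs `f` with `g'` and `f'` with `g`, so the undifferentiated factors are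
    -- also needed at order `k`.
    have hf0 := hf.of_succ
    have hg0 := hg.of_succ
    have hc0 := hc hf hg
    obtain ⟨f1, f', f2, f3⟩ := hf
    obtain ⟨g1, g', g2, g3⟩ := hg
    refine ⟨hc0, fun w x => B.precompR X (f w x) (g' w x) + B.precompL X (f' w x) (g w x),
      fun w hw x hx => B.hasFDerivAt_of_bilinear (f2 w hw x hx) (g2 w hw x hx), ?_⟩
    refine (ih hf0 g3 (B.precompR X) ?_).add (ih f3 hg0 (B.precompL X) ?_)
    · intro k a b
      exact ((B.precompR X).continuous.comp_continuousOn a.continuousOn).clm_apply b.continuousOn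
    · intro k a b
      exact ((B.precompL X).continuous.comp_continuousOn a.continuousOn).clm_apply b.continuousOn

theorem of_contDiff {W : Type*} [NormedAddCommGroup W] [NormedSpace ℝ W] {s : Set W} {t : Set X}
    {k : ℕ} {f : W → X → Y} (hf : ContDiff ℝ ∞ (uncurry f)) : JetContinuousOn s t k f := by
  induction k generalizing Y with
  | zero => exact hf.continuous.continuousOn
  | succ k ih =>
    refine ⟨hf.continuous.continuousOn,
      fun w x => (fderiv ℝ (uncurry f) (w, x)).comp (ContinuousLinearMap.inr ℝ W X),
      fun w _ x _ => ?_, ih ?_⟩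
    · have h1 : HasFDerivAt (uncurry f) (fderiv ℝ (uncurry f) (w, x)) (w, x) :=
        (hf.differentiable (by simp) _).hasFDerivAt
      exact h1.comp x (hasFDerivAt_prodMk_right w x)
    · have h1 : ContDiff ℝ ∞ (fderiv ℝ (uncurry f)) := hf.fderiv_right (by simp)
      exact h1.clm_comp contDiff_const

theorem exists_bound_near {X : Type*} [TopologicalSpace X] [LocallyCompactSpace X]
    {Y : Type*} [NormedAddCommGroup Y]
    {s K : Set W} {t : Set X} {f : W → X → Y}
    (hf : ContinuousOn (uncurry f) (s ×ˢ t)) (hK : IsCompact K) (hKs : K ⊆ s) (ht : IsOpen t)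
    {x₀ : X} (hx₀ : x₀ ∈ t) : ∃ V ∈ 𝓝 x₀, V ⊆ t ∧ ∃ C, ∀ w ∈ K, ∀ x ∈ V, ‖f w x‖ ≤ C := by
  obtain ⟨V, hV, hVt, hVc⟩ := local_compact_nhds (ht.mem_nhds hx₀)
  obtain ⟨C, hC⟩ := (hK.prod hVc).exists_bound_of_continuousOn (hf.mono (prod_mono hKs hVt))
  exact ⟨V, hV, hVt, C, fun w hw x hx => hC (w, x) ⟨hw, hx⟩⟩

/-- Differentiation under the integral sign: on the compact set `K` times a compact neighbourhood of
a point, the continuous derivatives are bounded, and a constant serves as dominating function. The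
formula for the first derivative is kept as a second conclusion because the averaged map must later
be shown to have an invertible derivative. -/
theorem contDiffOn_integral [T2Space W] [SecondCountableTopology W] [MeasurableSpace W]
    [OpensMeasurableSpace W]
    [FiniteDimensional ℝ X] {s K : Set W} {t : Set X} {k : ℕ} {f : W → X → Y} (μ : Measure W)
    [IsFiniteMeasureOnCompacts μ]
    (hf : JetContinuousOn s t k f) (hK : IsCompact K) (hKs : K ⊆ s) (ht : IsOpen t) :
    ContDiffOn ℝ k (fun x => ∫ w in K, f w x ∂μ) t ∧
      ∀ (f' : W → X → X →L[ℝ] Y), (∀ w ∈ s, ∀ x ∈ t, HasFDerivAt (f w) (f' w x) x) →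
        ContinuousOn (uncurry f') (s ×ˢ t) →
        ∀ x ∈ t, HasFDerivAt (fun x => ∫ w in K, f w x ∂μ) (∫ w in K, f' w x ∂μ) x := by
  have : ProperSpace X := FiniteDimensional.proper_real X
  have hfin : IsFiniteMeasure (μ.restrict K) := ⟨by
    rw [Measure.restrict_apply_univ]; exact hK.measure_lt_top⟩
  have hmeas : ∀ {Z : Type u} [NormedAddCommGroup Z] {f : W → X → Z},
      ContinuousOn (uncurry f) (s ×ˢ t) → ∀ x ∈ t,
      AEStronglyMeasurable (fun w => f w x) (μ.restrict K) := by
    intro Z _ f hc x hx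
    have : ContinuousOn (fun w => uncurry f (w, x)) K :=
      hc.comp (by fun_prop) (fun w hw => ⟨hKs hw, hx⟩)
    exact this.aestronglyMeasurable hK.isClosed.measurableSet
  have hderiv : ∀ {Z : Type u} [NormedAddCommGroup Z] [NormedSpace ℝ Z] {f : W → X → Z},
      ContinuousOn (uncurry f) (s ×ˢ t) →
      ∀ (f' : W → X → X →L[ℝ] Z), (∀ w ∈ s, ∀ x ∈ t, HasFDerivAt (f w) (f' w x) x) →
        ContinuousOn (uncurry f') (s ×ˢ t) →
        ∀ x ∈ t, HasFDerivAt (fun x => ∫ w in K, f w x ∂μ) (∫ w in K, f' w x ∂μ) x := by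
    intro Z _ _ f hc f' hd hc' x₀ hx₀
    obtain ⟨V, hV, hVt, C, hC⟩ := exists_bound_near hc' hK hKs ht hx₀
    obtain ⟨V₁, hV₁, hVt₁, C₁, hC₁⟩ := exists_bound_near hc hK hKs ht hx₀
    refine hasFDerivAt_integral_of_dominated_of_fderiv_le (bound := fun _ => C)
      (F := fun x w => f w x) (F' := fun x w => f' w x) hV ?_ ?_ (hmeas hc' x₀ hx₀) ?_
      (integrable_const _) ?_
    · filter_upwards [ht.mem_nhds hx₀] with x hx using hmeas hc x hx
    · refine Integrable.of_bound (hmeas hc x₀ hx₀) C₁ ?_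
      exact (ae_restrict_mem hK.isClosed.measurableSet).mono
        fun w hw => hC₁ w hw x₀ (mem_of_mem_nhds hV₁)
    · exact (ae_restrict_mem hK.isClosed.measurableSet).mono fun w hw x hx => hC w hw x hx
    · exact (ae_restrict_mem hK.isClosed.measurableSet).mono
        fun w hw x hx => hd w (hKs hw) x (hVt hx)
  refine ⟨?_, hderiv hf.continuousOn⟩
  induction k generalizing Y with
  | zero =>
    rw [CharP.cast_eq_zero, contDiffOn_zero]
    intro x₀ hx₀
    have hc : ContinuousOn (uncurry f) (s ×ˢ t) := hf
    obtain ⟨V, hV, hVt, C, hC⟩ := exists_bound_near hc hK hKs ht hx₀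
    refine (continuousAt_of_dominated (bound := fun _ => C) ?_ ?_ (integrable_const _)
      ?_).continuousWithinAt
    · filter_upwards [ht.mem_nhds hx₀] with x hx using hmeas hc x hx
    · filter_upwards [hV] with x hx
      exact (ae_restrict_mem hK.isClosed.measurableSet).mono fun w hw => hC w hw x hx
    · refine (ae_restrict_mem hK.isClosed.measurableSet).mono fun w hw => ?_
      have : ContinuousOn (fun x => uncurry f (w, x)) t :=
        hc.comp (by fun_prop) (fun x hx => ⟨hKs hw, hx⟩)
      exact this.continuousAt (ht.mem_nhds hx₀)
  | succ k ih =>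
    obtain ⟨f1, f', f2, f3⟩ := hf
    push_cast
    rw [contDiffOn_succ_iff_hasFDerivWithinAt_of_uniqueDiffOn ht.uniqueDiffOn]
    refine ⟨by simp, fun x => ∫ w in K, f' w x ∂μ, ih f3, fun x hx => ?_⟩
    exact (hderiv f1 f' f2 f3.continuousOn x hx).hasFDerivWithinAt

end JetContinuousOn

end JetFamilies


/-! ### Smoothness of continuous local actions -/

section LocalActions

open Set Metric Filter MeasureTheory Function

universe u

variable {E : Type u} [NormedAddCommGroup E] [NormedSpace ℝ E] [FiniteDimensional ℝ E]

/-- By Baire's theorem, a continuous family of smooth maps has jointly continuous derivatives up to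
any given order near some value of the parameter. -/
theorem exists_isOpen_jetContinuousOn {W : Type*} [TopologicalSpace W] [BaireSpace W]
    {F : W → E → E} {B : Set W} {U : Set E} {p₀ : E} (hB : IsOpen B) (hBn : B.Nonempty)
    (hU : IsOpen U) (hp₀ : p₀ ∈ U) (hcont : ContinuousOn (uncurry F) (B ×ˢ U))
    (hsm : ∀ w ∈ B, ContDiffOn ℝ ∞ (F w) U) (k : ℕ) :
    ∃ ρ > 0, ball p₀ ρ ⊆ U ∧ ∃ W' : Set W, IsOpen W' ∧ W'.Nonempty ∧ W' ⊆ B ∧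
      JetContinuousOn W' (ball p₀ ρ) k F := by
  have : ProperSpace E := FiniteDimensional.proper_real E
  obtain ⟨ρ, hρ, hρU⟩ := Metric.nhds_basis_closedBall.mem_iff.1 (hU.mem_nhds hp₀)
  have hsub : ball p₀ ρ ⊆ U := ball_subset_closedBall.trans hρU
  -- Two spare orders: one is lost in passing to the closure of `Es n`, another in passing from
  -- bounds to joint continuity.
  set Es : ℕ → Set W := fun n => {w | w ∈ B ∧ HasBoundedJet n (closedBall p₀ ρ) (k + 2) (F w)}
  -- Closures are closed for free, and the extra member `Bᶜ` completes the cover so that Baire's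
  -- theorem can be applied to all of `W`.
  have hcover : (⋃ o : Option ℕ, (o.elim Bᶜ fun n => closure (Es n))) = univ := by
    refine eq_univ_of_forall fun w => ?_
    by_cases hw : w ∈ B
    · obtain ⟨n, hn⟩ := HasBoundedJet.exists_of_contDiffOn hU (isCompact_closedBall p₀ ρ) hρU
        (hsm w hw) (k + 2)
      exact mem_iUnion.2 ⟨some n, subset_closure ⟨hw, hn⟩⟩
    · exact mem_iUnion.2 ⟨none, hw⟩
  have hclosed : ∀ o : Option ℕ, IsClosed (o.elim Bᶜ fun n => closure (Es n)) := by
    rintro (_ | n)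
    · exact hB.isClosed_compl
    · exact isClosed_closure
  obtain ⟨w, hwB, hw⟩ := (dense_iUnion_interior_of_closed hclosed hcover).inter_open_nonempty B hB hBn
  obtain ⟨o, ho⟩ := mem_iUnion.1 hw
  rcases o with _ | n
  · exact absurd hwB (interior_subset ho)
  have ho : w ∈ interior (closure (Es n)) := ho
  refine ⟨ρ, hρ, hsub, interior (closure (Es n)) ∩ B, isOpen_interior.inter hB, ⟨w, ho, hwB⟩,
    inter_subset_right, ?_⟩
  refine JetContinuousOn.of_hasBoundedJet (C := n) isOpen_ball
    (fun w hw => (hsm w hw.2).mono hsub) (fun w hw => ?_)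
    (hcont.mono (prod_mono inter_subset_right hsub))
  refine HasBoundedJet.of_mem_closure (s := Es n) isOpen_ball
    (fun w' hw' => (hsm w' hw'.1).mono hsub) ((hsm w hw.2).mono hsub)
    (fun w' hw' => hw'.2.mono_set ball_subset_closedBall) (fun y hy => ?_) (interior_subset hw.1)
  have : ContinuousOn (fun w => uncurry F (w, y)) B :=
    hcont.comp (by fun_prop) (fun w hw => ⟨hw, hsub hy⟩)
  exact (this w hw.2).mono fun w' hw' => hw'.1

/-- A continuous local action of `ℂ` by smooth maps is smooth in both variables (a local form of
the theorem of Bochner and Montgomery). -/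
theorem contDiffAt_of_continuous_local_action {F : ℂ → E → E} {r : ℝ} {U : Set E} {p₀ : E}
    (hr : 0 < r) (hU : IsOpen U) (hp₀ : p₀ ∈ U)
    (hcont : ContinuousOn (uncurry F) (ball 0 r ×ˢ U))
    (hsm : ∀ w ∈ ball (0 : ℂ) r, ContDiffOn ℝ ∞ (F w) U)
    (hinv : ∀ w ∈ ball (0 : ℂ) r, (fderiv ℝ (F w) p₀).IsInvertible)
    (h0 : F 0 p₀ = p₀)
    (hadd : ∀ w z p, w ∈ ball (0 : ℂ) r → z ∈ ball (0 : ℂ) r → w + z ∈ ball (0 : ℂ) r → p ∈ U →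
      F z p ∈ U → F (w + z) p = F w (F z p)) :
    ContDiffAt ℝ ∞ (uncurry F) (0, p₀) := by
  have : ProperSpace E := FiniteDimensional.proper_real E
  rw [contDiffAt_infty]
  intro k
  -- The inverse function theorem requires order at least one.
  suffices ContDiffAt ℝ ((k + 1 : ℕ) : ℕ∞ω) (uncurry F) (0, p₀) from
    this.of_le (by exact_mod_cast k.le_succ)
  -- Baire's theorem controls derivatives only for parameters in some open set, which need not
  -- contain `0`. The averaging therefore takes place around a point `z₁` of that set, and the group
  -- law carries the conclusion back to `0`.
  obtain ⟨ρ, hρ, hρU, W, hW, ⟨z₁, hz₁⟩, hWB, hJ⟩ := exists_isOpen_jetContinuousOn isOpen_ball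
    ⟨0, mem_ball_self hr⟩ hU hp₀ hcont hsm (k + 1)
  have hpO : p₀ ∈ ball p₀ ρ := mem_ball_self hρ
  have hJ' := hJ
  obtain ⟨hc, F', hF', hJ1⟩ := hJ'
  obtain ⟨M, hM⟩ := hinv z₁ (hWB hz₁)
  have hMF : (M : E →L[ℝ] E) = F' z₁ p₀ := by rw [hM, (hF' z₁ hz₁ p₀ hpO).fderiv]
  obtain ⟨ε, hε, hεM⟩ := Metric.mem_nhds_iff.1 M.nhds
  have hF'c : ContinuousAt (fun w => F' w p₀) z₁ := by
    have : ContinuousOn (fun w => uncurry F' (w, p₀)) W :=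
      hJ1.continuousOn.comp (by fun_prop) (fun w hw => ⟨hw, hpO⟩)
    exact this.continuousAt (hW.mem_nhds hz₁)
  obtain ⟨δ, hδ, hδW⟩ := Metric.nhds_basis_closedBall.mem_iff.1 (inter_mem (hW.mem_nhds hz₁)
    (hF'c.preimage_mem_nhds (ball_mem_nhds _ (half_pos hε))))
  set K : Set ℂ := closedBall z₁ δ with hK
  have hKW : K ⊆ W := fun w hw => (hδW hw).1
  have hKc : IsCompact K := isCompact_closedBall z₁ δ
  -- The support has radius `δ / 2`, so its translates by `‖z‖ < δ / 2` remain inside `K`.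
  let χ : ContDiffBump z₁ := ⟨δ / 4, δ / 2, by positivity, by linarith⟩
  set c : ℂ → ℝ := χ.normed volume with hcdef
  have hcs : ContDiff ℝ ∞ c := χ.contDiff_normed
  have hsupp : ∀ w, c w ≠ 0 → w ∈ ball z₁ (δ / 2) := fun w hw => by
    have : w ∈ Function.support c := hw
    rwa [hcdef, χ.support_normed_eq] at this
  -- In `A` the variable `z` occurs only in the smooth kernel and not in `F`, so `A` is jointly as
  -- regular as the family is in `p` alone. `B` is its value at `z = 0`.
  set A : ℂ × E → E := fun q => ∫ w in K, c (w - q.1) • F w q.2 with hA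
  set B : E → E := fun p => ∫ w in K, c w • F w p with hB
  have hAs : ContDiffOn ℝ ((k + 1 : ℕ) : ℕ∞ω) A (ContinuousLinearMap.snd ℝ ℂ E ⁻¹' ball p₀ ρ) := by
    have g : JetContinuousOn W (ContinuousLinearMap.snd ℝ ℂ E ⁻¹' ball p₀ ρ) (k + 1)
        (fun w (q : ℂ × E) => c (w - q.1) • ContinuousLinearMap.id ℝ E) := by
      apply JetContinuousOn.of_contDiff
      have : ContDiff ℝ ∞ fun q : ℂ × (ℂ × E) => q.1 - q.2.1 := by fun_prop
      exact (hcs.comp this).smul contDiff_const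
    have h := g.bilinear (hJ.comp_clm (ContinuousLinearMap.snd ℝ ℂ E)) (ContinuousLinearMap.id ℝ _)
    exact (h.contDiffOn_integral volume hKc hKW
      (isOpen_ball.preimage (ContinuousLinearMap.snd ℝ ℂ E).continuous)).1
  have hBs : ContDiffOn ℝ ((k + 1 : ℕ) : ℕ∞ω) B (ball p₀ ρ) ∧
      HasFDerivAt B (∫ w in K, c w • F' w p₀) p₀ := by
    have g : JetContinuousOn W (ball p₀ ρ) (k + 1)
        (fun w (q : E) => c w • ContinuousLinearMap.id ℝ E) := by
      apply JetContinuousOn.of_contDiff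
      exact (hcs.comp contDiff_fst).smul contDiff_const
    have h := (g.bilinear hJ (ContinuousLinearMap.id ℝ _)).contDiffOn_integral volume hKc hKW
      isOpen_ball
    refine ⟨h.1, h.2 (fun w p => c w • F' w p) (fun w hw p hp => ?_) ?_ p₀ hpO⟩
    · exact (hF' w hw p hp).const_smul (c w)
    · exact (hcs.continuous.comp continuous_fst).continuousOn.smul hJ1.continuousOn
  obtain ⟨hBs, hBd⟩ := hBs
  have hcint : ∫ w in K, c w = 1 := by
    rw [setIntegral_eq_integral_of_forall_compl_eq_zero, hcdef, χ.integral_normed]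
    intro w hw
    by_contra h
    exact hw (ball_subset_closedBall (ball_subset_ball (by linarith) (hsupp w h)))
  have hci : IntegrableOn c K := hcs.continuous.continuousOn.integrableOn_compact hKc
  -- The derivative of `B` at `p₀` is an average, with weights of total mass one, of operators
  -- within `ε / 2` of the invertible operator `M`; the ball of radius `ε` around `M` consists of
  -- invertible operators.
  have hnear : (∫ w in K, c w • F' w p₀) ∈ ball (M : E →L[ℝ] E) ε := by
    rw [mem_ball_iff_norm]
    have hF'K : ContinuousOn (fun w => F' w p₀) K :=
      hJ1.continuousOn.comp (f := fun w => (w, p₀)) (by fun_prop) (fun w hw => ⟨hKW hw, hpO⟩)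
    have e1 : (∫ w in K, c w • F' w p₀) - M = ∫ w in K, c w • (F' w p₀ - M) := by
      simp_rw [smul_sub]
      rw [integral_sub, integral_smul_const, hcint, one_smul]
      · exact (hcs.continuous.continuousOn.smul hF'K).integrableOn_compact hKc
      · exact (hcs.continuous.continuousOn.smul continuousOn_const).integrableOn_compact hKc
    rw [e1]
    have e2 : ‖∫ w in K, c w • (F' w p₀ - M)‖ ≤ ∫ w in K, c w * (ε / 2) := by
      refine norm_integral_le_of_norm_le (hci.mul_const _) ?_
      refine (ae_restrict_mem hKc.isClosed.measurableSet).mono fun w hw => ?_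
      have h1 : ‖F' w p₀ - M‖ ≤ ε / 2 := by
        have := (hδW hw).2
        rw [mem_preimage, mem_ball_iff_norm] at this
        rw [hMF]; exact this.le
      have h2 : 0 ≤ c w := χ.nonneg_normed w
      rw [norm_smul, Real.norm_eq_abs, abs_of_nonneg h2]
      exact mul_le_mul_of_nonneg_left h1 h2
    rw [integral_mul_const, hcint, one_mul] at e2
    linarith
  obtain ⟨N, hN⟩ := hεM hnear
  rw [← hN] at hBd
  have hBat : ContDiffAt ℝ ((k + 1 : ℕ) : ℕ∞ω) B p₀ := hBs.contDiffAt (ball_mem_nhds _ hρ)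
  have hk0 : ((k + 1 : ℕ) : ℕ∞ω) ≠ 0 := by exact_mod_cast k.succ_ne_zero
  have hFcont : ContinuousAt (uncurry F) (0, p₀) :=
    hcont.continuousAt (prod_mem_nhds (ball_mem_nhds _ hr) (hU.mem_nhds hp₀))
  have hFlim : Tendsto (uncurry F) (𝓝 (0, p₀)) (𝓝 p₀) := by
    have := hFcont.tendsto
    simpa only [uncurry, h0] using this
  -- Translation invariance of the integral gives `A (z, p) = ∫ c w • F (w + z) p`, and the local
  -- group law turns this into `∫ c w • F w (F z p) = B (F z p)`.
  have hAB : ∀ᶠ q : ℂ × E in 𝓝 (0, p₀), A q = B (uncurry F q) := by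
    have n1 : ∀ᶠ q : ℂ × E in 𝓝 (0, p₀), q.1 ∈ ball (0 : ℂ) (min r (δ / 2)) ∧ q.2 ∈ U :=
      prod_mem_nhds (ball_mem_nhds _ (by positivity)) (hU.mem_nhds hp₀)
    filter_upwards [n1, hFlim (hU.mem_nhds hp₀)] with q hq hFq
    obtain ⟨z, p⟩ := q
    obtain ⟨hz, hp⟩ := hq
    simp only at hz hp
    have hzr : z ∈ ball (0 : ℂ) r := ball_subset_ball (min_le_left _ _) hz
    have hzδ : ‖z‖ < δ / 2 := mem_ball_zero_iff.1 (ball_subset_ball (min_le_right _ _) hz)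
    have hshift : ∀ w ∈ ball z₁ (δ / 2), w + z ∈ K := fun w hw => by
      rw [mem_ball_iff_norm] at hw
      rw [hK, mem_closedBall_iff_norm]
      calc ‖w + z - z₁‖ = ‖(w - z₁) + z‖ := by ring_nf
        _ ≤ ‖w - z₁‖ + ‖z‖ := norm_add_le _ _
        _ ≤ δ := by linarith
    simp only [hA, hB, uncurry]
    rw [setIntegral_eq_integral_of_forall_compl_eq_zero,
      setIntegral_eq_integral_of_forall_compl_eq_zero,
      ← integral_add_right_eq_self (fun w => c (w - z) • F w p) z]
    · refine integral_congr_ae (Eventually.of_forall fun w => ?_)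
      simp only [add_sub_cancel_right]
      by_cases hw : c w = 0
      · simp [hw]
      · have hw' := hsupp w hw
        rw [hadd w z p (hWB (hKW (ball_subset_closedBall (ball_subset_ball (by linarith) hw')))) hzr
          (hWB (hKW (hshift w hw'))) hp hFq]
    · intro w hw
      by_cases hcw : c w = 0
      · simp [hcw]
      · exact absurd (ball_subset_closedBall (ball_subset_ball (by linarith) (hsupp w hcw))) hw
    · intro w hw
      by_cases hcw : c (w - z) = 0
      · simp [hcw]
      · have := hshift _ (hsupp _ hcw)
        rw [sub_add_cancel] at this
        exact absurd this hw
  have hsrc := hBat.mem_toOpenPartialHomeomorph_source hBd hk0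
  have hA0 : A (0, p₀) = B p₀ := by simp [hA, hB]
  -- Since `B` is locally invertible, `F = B⁻¹ ∘ A`, and the right-hand side is regular in both
  -- variables together.
  have hFA : uncurry F =ᶠ[𝓝 (0, p₀)] (hBat.localInverse hBd hk0) ∘ A := by
    filter_upwards [hAB, hFlim ((hBat.toOpenPartialHomeomorph B hBd hk0).open_source.mem_nhds hsrc)]
      with q hq hq2
    rw [comp_apply, hq]
    exact ((hBat.toOpenPartialHomeomorph B hBd hk0).left_inv hq2).symm
  refine ContDiffAt.congr_of_eventuallyEq ?_ hFA
  have hAat : ContDiffAt ℝ ((k + 1 : ℕ) : ℕ∞ω) A (0, p₀) :=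
    hAs.contDiffAt ((isOpen_ball.preimage (ContinuousLinearMap.snd ℝ ℂ E).continuous).mem_nhds hpO)
  refine ContDiffAt.comp (0, p₀) ?_ hAat
  rw [hA0]
  exact hBat.to_localInverse hBd hk0

end LocalActions


/-! ### Integral surfaces of commuting vector fields -/

section Frobenius

open Set Metric Filter Function
open scoped NNReal

/-- The confinement of the solution to the closed ball is part of the conclusion: the estimates on
the coefficients of the equation hold only there. -/
theorem IsPicardLindelof.exists_hasDerivWithinAt_mem_closedBall {E : Type*} [NormedAddCommGroup E]
    [NormedSpace ℝ E] [CompleteSpace E] {f : ℝ → E → E} {tmin tmax : ℝ} {t₀ : Icc tmin tmax}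
    {x₀ x : E} {a r L K : ℝ≥0} (hf : IsPicardLindelof f t₀ x₀ a r L K) (hx : x ∈ closedBall x₀ r) :
    ∃ α : ℝ → E, α t₀ = x ∧ (∀ t, α t ∈ closedBall x₀ a) ∧
      ∀ t ∈ Icc tmin tmax, HasDerivWithinAt α (f t (α t)) (Icc tmin tmax) t := by
  obtain ⟨α, hα⟩ := ODE.FunSpace.exists_isFixedPt_next hf hx
  refine ⟨α.compProj, by rw [ODE.FunSpace.compProj_val, ← hα, ODE.FunSpace.next_apply₀],
    fun t => α.compProj_mem_closedBall hf.mul_max_le, fun t ht ↦ ?_⟩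
  apply ODE.hasDerivWithinAt_picard_Icc t₀.2 hf.continuousOn_uncurry
    α.continuous_compProj.continuousOn (fun _ ht' ↦ α.compProj_mem_closedBall hf.mul_max_le)
    x ht |>.congr_of_mem _ ht
  intro t' ht'
  nth_rw 1 [← hα]
  rw [ODE.FunSpace.compProj_of_mem ht', ODE.FunSpace.next_apply]

/-- Linearity in the defect `ε`: an approximate solution with defect of order `‖w‖ ^ 2` is then
within order `‖w‖ ^ 2` of the true one. -/
theorem gronwallBound_zero_eq_mul (K ε x : ℝ) :
    gronwallBound 0 K ε x = ε * gronwallBound 0 K 1 x := by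
  unfold gronwallBound
  split_ifs <;> ring

variable {E V : Type*} [NormedAddCommGroup E] [NormedSpace ℝ E]
  [NormedAddCommGroup V] [NormedSpace ℝ V]

theorem exists_ball_bounds_of_contDiffOn {F : Type*} [NormedAddCommGroup F] [NormedSpace ℝ F]
    {A : E → F} {U : Set E} {p₀ : E} (hU : IsOpen U) (hp₀ : p₀ ∈ U) (hA : ContDiffOn ℝ ∞ A U) :
    ∃ R > 0, ball p₀ R ⊆ U ∧ ∃ M > 0, (∀ p ∈ ball p₀ R, ‖A p‖ ≤ M) ∧
      (∀ p ∈ ball p₀ R, ‖fderiv ℝ A p‖ ≤ M) ∧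
      ∀ p ∈ ball p₀ R, ∀ q ∈ ball p₀ R, ‖fderiv ℝ A q - fderiv ℝ A p‖ ≤ M * ‖q - p‖ := by
  have hA' : ContDiffOn ℝ ∞ (fderiv ℝ A) U := ((contDiffOn_infty_iff_fderiv_of_isOpen hU).1 hA).2
  have hc : ContinuousAt A p₀ := hA.continuousOn.continuousAt (hU.mem_nhds hp₀)
  have hc' : ContinuousAt (fderiv ℝ A) p₀ := hA'.continuousOn.continuousAt (hU.mem_nhds hp₀)
  obtain ⟨K, t, ht, hK⟩ := ((hA'.contDiffAt (hU.mem_nhds hp₀)).of_le (m := 1)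
    (by norm_cast)).exists_lipschitzOnWith
  have e1 : ∀ᶠ p in 𝓝 p₀, ‖A p‖ < ‖A p₀‖ + 1 := hc.norm.eventually (gt_mem_nhds (by simp))
  have e2 : ∀ᶠ p in 𝓝 p₀, ‖fderiv ℝ A p‖ < ‖fderiv ℝ A p₀‖ + 1 :=
    hc'.norm.eventually (gt_mem_nhds (by simp))
  obtain ⟨R, hR, h⟩ := Metric.eventually_nhds_iff_ball.1
    (((e1.and e2).and ht).and (hU.mem_nhds hp₀))
  refine ⟨R, hR, fun p hp => (h p hp).2, max (max (‖A p₀‖ + 1) (‖fderiv ℝ A p₀‖ + 1)) K,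
    by positivity, fun p hp => ?_, fun p hp => ?_, fun p hp q hq => ?_⟩
  · exact (h p hp).1.1.1.le.trans ((le_max_left _ _).trans (le_max_left _ _))
  · exact (h p hp).1.1.2.le.trans ((le_max_right _ _).trans (le_max_left _ _))
  · have := hK.norm_sub_le (h q hq).1.2 (h p hp).1.2
    exact this.trans (mul_le_mul_of_nonneg_right (le_max_right _ _) (norm_nonneg _))

/-- Local integral surfaces of a smooth family `A` of commuting vector fields: the total
differential equation `ds = A ∘ s` has a solution through every point. -/
theorem exists_hasFDerivAt_eq_of_commuting [CompleteSpace E] {A : E → V →L[ℝ] E} {U : Set E}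
    {p₀ : E} (hU : IsOpen U) (hp₀ : p₀ ∈ U) (hA : ContDiffOn ℝ ∞ A U)
    (hsymm : ∀ p ∈ U, ∀ v w, fderiv ℝ A p (A p v) w = fderiv ℝ A p (A p w) v) :
    ∃ ε > 0, ∃ s : V → E, s 0 = p₀ ∧
      ∀ x ∈ ball (0 : V) ε, s x ∈ U ∧ HasFDerivAt s (A (s x)) x := by
  obtain ⟨R, hR, hRU, M, hM, hAM, hDM, hLip⟩ := exists_ball_bounds_of_contDiffOn hU hp₀ hA
  -- Half of the radius is for the solutions, the other half for the perturbed curves `y` below.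
  set a : ℝ := R / 2 with ha
  have ha0 : 0 < a := by positivity
  have haR : closedBall p₀ a ⊆ ball p₀ R := closedBall_subset_ball (by linarith)
  have hAd : ∀ p ∈ ball p₀ R, HasFDerivAt A (fderiv ℝ A p) p := fun p hp =>
    ((hA.contDiffAt (hU.mem_nhds (hRU hp))).differentiableAt (by simp)).hasFDerivAt
  have hALip : ∀ p ∈ ball p₀ R, ∀ q ∈ ball p₀ R, ‖A q - A p‖ ≤ M * ‖q - p‖ := fun p hp q hq =>
    (convex_ball p₀ R).norm_image_sub_le_of_norm_fderiv_le (𝕜 := ℝ)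
      (fun z hz => (hAd z hz).differentiableAt) hDM hp hq
  -- For `‖x‖ ≤ ε` the field `A · x` has speed at most `M * ε = a`, so a solution starting at `p₀`
  -- cannot leave the ball of radius `a` in unit time.
  set ε : ℝ := a / M with hε
  have hε0 : 0 < ε := by positivity
  have hεM : M * ε = a := by rw [hε]; field_simp
  have hAxLip : ∀ x ∈ ball (0 : V) ε, LipschitzOnWith a.toNNReal (fun y => A y x) (ball p₀ R) := by
    intro x hx
    refine LipschitzOnWith.of_dist_le_mul fun q hq p hp => ?_
    rw [dist_eq_norm, dist_eq_norm, Real.coe_toNNReal _ ha0.le, ← hεM,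
      ← sub_apply]
    refine (ContinuousLinearMap.le_opNorm _ _).trans ?_
    have h1 := hALip p hp q hq
    have h2 : ‖x‖ ≤ ε := (mem_ball_zero_iff.1 hx).le
    calc ‖A q - A p‖ * ‖x‖ ≤ (M * ‖q - p‖) * ε := by gcongr
      _ = M * ε * ‖q - p‖ := by ring
  -- The equation `ds = A ∘ s` is solved along rays: `σ` plays the role of `t ↦ s (t • x)`, and `s
  -- x` will be its value at time `1`.
  have hsol : ∀ x ∈ ball (0 : V) ε, ∃ σ : ℝ → E, σ 0 = p₀ ∧ (∀ t, σ t ∈ closedBall p₀ a) ∧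
      ∀ t ∈ Icc (0 : ℝ) 1, HasDerivWithinAt σ (A (σ t) x) (Icc 0 1) t := by
    intro x hx
    have hx' : ‖x‖ ≤ ε := (mem_ball_zero_iff.1 hx).le
    have hPL : IsPicardLindelof (fun _ y => A y x) (tmin := 0) (tmax := 1)
        ⟨0, by simp⟩ p₀ a.toNNReal 0 a.toNNReal a.toNNReal := by
      constructor
      · intro t _
        rw [Real.coe_toNNReal _ ha0.le]
        exact (hAxLip x hx).mono haR
      · exact fun y _ => continuousOn_const
      · intro t _ y hy
        rw [Real.coe_toNNReal _ ha0.le] at hy ⊢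
        refine ((A y).le_opNorm x).trans ?_
        rw [← hεM]
        exact mul_le_mul (hAM y (haR hy)) hx' (norm_nonneg _) hM.le
      · simp
    obtain ⟨σ, h1, h2, h3⟩ := hPL.exists_hasDerivWithinAt_mem_closedBall
      (mem_closedBall_self le_rfl)
    rw [Real.coe_toNNReal _ ha0.le] at h2
    exact ⟨σ, h1, h2, h3⟩
  have hsol' : ∀ x : V, ∃ σ : ℝ → E, x ∈ ball (0 : V) ε → σ 0 = p₀ ∧
      (∀ t, σ t ∈ closedBall p₀ a) ∧
      ∀ t ∈ Icc (0 : ℝ) 1, HasDerivWithinAt σ (A (σ t) x) (Icc 0 1) t := by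
    intro x
    by_cases hx : x ∈ ball (0 : V) ε
    · obtain ⟨σ, h⟩ := hsol x hx
      exact ⟨σ, fun _ => h⟩
    · exact ⟨fun _ => 0, fun h => absurd h hx⟩
  choose σ hσ using hsol'
  have hright : ∀ x ∈ ball (0 : V) ε, ∀ t ∈ Ico (0 : ℝ) 1,
      HasDerivWithinAt (σ x) (A (σ x t) x) (Ici t) t := fun x hx t ht =>
    ((hσ x hx).2.2 t ⟨ht.1, ht.2.le⟩).mono_of_mem_nhdsWithin (Icc_mem_nhdsGE_of_mem ht)
  have hcont : ∀ x ∈ ball (0 : V) ε, ContinuousOn (σ x) (Icc 0 1) := fun x hx t ht =>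
    ((hσ x hx).2.2 t ht).continuousWithinAt
  -- An error quadratic in `w` is what identifies `A (s x)` as the derivative of `s` at `x`.
  have hquad : ∀ x ∈ ball (0 : V) ε, ∀ w ∈ ball (0 : V) ε, x + w ∈ ball (0 : V) ε →
      ‖σ (x + w) 1 - σ x 1 - A (σ x 1) w‖ ≤
        ((M * M + M * M * M * ε) * gronwallBound 0 a 1 1) * ‖w‖ ^ 2 := by
    intro x hx w hw hxw
    have hw' : ‖w‖ < ε := mem_ball_zero_iff.1 hw
    have hxw' : ‖x + w‖ ≤ ε := (mem_ball_zero_iff.1 hxw).le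
    set v := σ x with hv
    -- The equation for `s` predicts that `s (t • (x + w))` is `v t + t • A (v t) w` to first order
    -- in `w`; `y` is this guess, to be compared with the solution `σ (x + w)`.
    set y : ℝ → E := fun t => v t + t • A (v t) w with hy
    have hvb : ∀ t, v t ∈ ball p₀ R := fun t => haR ((hσ x hx).2.1 t)
    have hAw : ∀ t, ‖A (v t) w‖ ≤ M * ‖w‖ := fun t =>
      ((A (v t)).le_opNorm w).trans (mul_le_mul_of_nonneg_right (hAM _ (hvb t)) (norm_nonneg _))
    have htAw : ∀ t ∈ Icc (0 : ℝ) 1, ‖t • A (v t) w‖ ≤ M * ‖w‖ := fun t ht => by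
      rw [norm_smul, Real.norm_eq_abs, abs_of_nonneg ht.1]
      exact (mul_le_of_le_one_left (norm_nonneg _) ht.2).trans (hAw t)
    have hyb : ∀ t ∈ Icc (0 : ℝ) 1, y t ∈ ball p₀ R := fun t ht => by
      rw [mem_ball_iff_norm]
      have h1 : ‖v t - p₀‖ ≤ a := mem_closedBall_iff_norm.1 ((hσ x hx).2.1 t)
      have h2 : M * ‖w‖ < a := by rw [← hεM]; gcongr
      calc ‖y t - p₀‖ = ‖(v t - p₀) + t • A (v t) w‖ := by simp only [hy]; congr 1; abel
        _ ≤ ‖v t - p₀‖ + ‖t • A (v t) w‖ := norm_add_le _ _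
        _ < R := by have := htAw t ht; linarith
    set y' : ℝ → E := fun t => A (v t) x + (A (v t) w + t • fderiv ℝ A (v t) (A (v t) x) w) with hy'
    have hyd : ∀ t ∈ Icc (0 : ℝ) 1, HasDerivWithinAt y (y' t) (Icc 0 1) t := by
      intro t ht
      have d1 := (hσ x hx).2.2 t ht
      have d2 : HasDerivWithinAt (fun t => A (v t) w) (fderiv ℝ A (v t) (A (v t) x) w)
          (Icc 0 1) t := by
        have := ((hAd (v t) (hvb t)).comp_hasDerivWithinAt t d1)
        exact ((ContinuousLinearMap.apply ℝ E w).hasFDerivAt.comp_hasDerivWithinAt t this)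
      have d3 := (hasDerivWithinAt_id t (Icc (0:ℝ) 1)).smul d2
      have d4 := d1.add d3
      refine d4.congr_deriv ?_
      simp only [hy', id, one_smul]
      abel
    have hbound : ∀ t ∈ Ico (0 : ℝ) 1, dist (y' t) (A (y t) (x + w)) ≤
        (M * M + M * M * M * ε) * ‖w‖ ^ 2 := by
      intro t ht
      have ht' : t ∈ Icc (0 : ℝ) 1 := ⟨ht.1, ht.2.le⟩
      set Rm : V →L[ℝ] E := A (y t) - A (v t) - fderiv ℝ A (v t) (y t - v t) with hRm
      have hyv : y t - v t = t • A (v t) w := by simp [hy]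
      have hR1 : ‖Rm‖ ≤ M * (M * ‖w‖) * (M * ‖w‖) := by
        have hseg : segment ℝ (v t) (y t) ⊆ ball p₀ R :=
          (convex_ball p₀ R).segment_subset (hvb t) (hyb t ht')
        have h1 := (convex_segment (v t) (y t)).norm_image_sub_le_of_norm_fderiv_le' (𝕜 := ℝ)
          (f := A) (φ := fderiv ℝ A (v t)) (C := M * (M * ‖w‖))
          (fun z hz => (hAd z (hseg hz)).differentiableAt)
          (fun z hz => ?_) (left_mem_segment ℝ _ _) (right_mem_segment ℝ _ _)
        · refine h1.trans ?_
          rw [hyv]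
          exact mul_le_mul_of_nonneg_left (htAw t ht') (by positivity)
        · refine (hLip _ (hvb t) _ (hseg hz)).trans ?_
          refine mul_le_mul_of_nonneg_left ?_ hM.le
          have h3 : ‖z - v t‖ ≤ ‖y t - v t‖ := norm_sub_le_of_mem_segment hz
          rw [hyv] at h3
          exact h3.trans (htAw t ht')
      have hAy : A (y t) = A (v t) + t • fderiv ℝ A (v t) (A (v t) w) + Rm := by
        rw [hRm, hyv, map_smul]; abel
      -- The two terms linear in `w`, `t • DA (A x) w` from `y'` and `t • DA (A w) x` from the
      -- expansion of `A (y t)`, cancel by the symmetry hypothesis. What remains is quadratic.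
      have hdiff : y' t - A (y t) (x + w)
          = -(t • fderiv ℝ A (v t) (A (v t) w) w) - Rm (x + w) := by
        simp only [hy', hAy, add_apply, smul_apply, map_add]
        rw [hsymm (v t) (hRU (hvb t)) x w]
        module
      rw [dist_eq_norm, hdiff]
      refine (norm_sub_le _ _).trans ?_
      have n1 : ‖-(t • fderiv ℝ A (v t) (A (v t) w) w)‖ ≤ M * (M * ‖w‖) * ‖w‖ := by
        rw [norm_neg, norm_smul, Real.norm_eq_abs, abs_of_nonneg ht.1]
        refine (mul_le_of_le_one_left (norm_nonneg _) ht.2.le).trans ?_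
        refine (ContinuousLinearMap.le_opNorm _ _).trans ?_
        refine mul_le_mul_of_nonneg_right ?_ (norm_nonneg _)
        refine (ContinuousLinearMap.le_opNorm _ _).trans ?_
        exact mul_le_mul (hDM _ (hvb t)) (hAw t) (norm_nonneg _) hM.le
      have n2 : ‖Rm (x + w)‖ ≤ M * (M * ‖w‖) * (M * ‖w‖) * ε :=
        (Rm.le_opNorm _).trans (mul_le_mul hR1 hxw' (norm_nonneg _) (by positivity))
      calc _ ≤ M * (M * ‖w‖) * ‖w‖ + M * (M * ‖w‖) * (M * ‖w‖) * ε := add_le_add n1 n2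
        _ = _ := by ring
    have key := dist_le_of_approx_trajectories_ODE_of_mem (v := fun _ y => A y (x + w))
      (s := fun _ => ball p₀ R) (K := a.toNNReal) (f := σ (x + w)) (g := y)
      (f' := fun t => A (σ (x + w) t) (x + w)) (g' := y') (a := 0) (b := 1) (εf := 0)
      (εg := (M * M + M * M * M * ε) * ‖w‖ ^ 2) (δ := 0)
      (fun t _ => hAxLip _ hxw) (hcont _ hxw) (hright _ hxw) (fun t _ => by simp)
      (fun t _ => haR ((hσ _ hxw).2.1 t)) (fun t ht => (hyd t ht).continuousWithinAt)
      (fun t ht => (hyd t ⟨ht.1, ht.2.le⟩).mono_of_mem_nhdsWithin (Icc_mem_nhdsGE_of_mem ht))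
      hbound (fun t ht => hyb t ⟨ht.1, ht.2.le⟩)
      (by simp [hy, (hσ _ hxw).1, hv, (hσ x hx).1]) 1 (by simp)
    rw [zero_add, sub_zero, Real.coe_toNNReal _ ha0.le, gronwallBound_zero_eq_mul, dist_eq_norm] at key
    simp only [hy, one_smul] at key
    calc ‖σ (x + w) 1 - v 1 - A (v 1) w‖ = ‖σ (x + w) 1 - (v 1 + A (v 1) w)‖ := by
          rw [sub_sub]
      _ ≤ _ := key
      _ = _ := by ring
  refine ⟨ε, hε0, fun x => σ x 1, ?_, fun x hx => ⟨hRU (haR ((hσ x hx).2.1 1)), ?_⟩⟩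
  · have h0 : (0 : V) ∈ ball (0 : V) ε := mem_ball_self hε0
    have hc := constant_of_has_deriv_right_zero (f := σ 0) (hcont 0 h0)
      (fun t ht => by simpa using hright 0 h0 t ht) 1 (by simp)
    exact hc.trans (hσ 0 h0).1
  · rw [hasFDerivAt_iff_isLittleO_nhds_zero]
    refine Asymptotics.IsBigO.trans_isLittleO (g := fun w : V => ‖w‖ ^ 2) ?_ ?_
    · refine Asymptotics.IsBigO.of_bound
        ((M * M + M * M * M * ε) * gronwallBound 0 a 1 1) ?_
      have n1 : ∀ᶠ w : V in 𝓝 0, x + w ∈ ball (0 : V) ε := by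
        have : Tendsto (fun w : V => x + w) (𝓝 0) (𝓝 x) := by
          have h := (show Continuous fun w : V => x + w by fun_prop).tendsto 0
          rwa [add_zero] at h
        exact this (isOpen_ball.mem_nhds hx)
      filter_upwards [ball_mem_nhds (0 : V) hε0, n1] with w hw hxw
      have := hquad x hx w hw hxw
      simpa using this
    · have := Asymptotics.isLittleO_norm_pow_id (E' := V) (one_lt_two)
      exact this

/-- Solutions of `ds = A ∘ s` are smooth. -/
theorem contDiffOn_of_hasFDerivAt_comp {A : E → V →L[ℝ] E} {U : Set E} {O : Set V} {s : V → E}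
    (hO : IsOpen O) (hA : ContDiffOn ℝ ∞ A U)
    (hs : ∀ x ∈ O, s x ∈ U ∧ HasFDerivAt s (A (s x)) x) : ContDiffOn ℝ ∞ s O := by
  rw [contDiffOn_infty]
  intro n
  induction n with
  | zero =>
    rw [CharP.cast_eq_zero, contDiffOn_zero]
    exact fun x hx => (hs x hx).2.continuousAt.continuousWithinAt
  | succ n ih =>
    push_cast
    rw [contDiffOn_succ_iff_hasFDerivWithinAt_of_uniqueDiffOn hO.uniqueDiffOn]
    -- The derivative `A ∘ s` is as regular as `s`, so each order of differentiability yields the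
    -- next.
    refine ⟨by simp, fun x => A (s x), ?_, fun x hx => (hs x hx).2.hasFDerivWithinAt⟩
    exact (hA.of_le (by exact_mod_cast le_top)).comp ih fun x hx => (hs x hx).1

end Frobenius


/-! ### Maps with vanishing derivative -/

section ManifoldPreliminaries

open Set Metric Filter Function

/-- A map on a convex set whose derivative vanishes is constant. -/
theorem eq_of_hasMFDerivWithinAt_zero {V : Type*} [NormedAddCommGroup V] [NormedSpace ℝ V]
    {E H M : Type*} [NormedAddCommGroup E] [NormedSpace ℝ E] [TopologicalSpace H]
    {I : ModelWithCorners ℝ E H} [TopologicalSpace M] [ChartedSpace H M] [IsManifold I ∞ M]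
    {c : V → M} {s : Set V} (hs : Convex ℝ s)
    (hc : ∀ t ∈ s, HasMFDerivWithinAt 𝓘(ℝ, V) I c s t 0)
    {t t' : V} (ht : t ∈ s) (ht' : t' ∈ s) : c t = c t' := by
  have : IsManifold I 1 M := .of_le (n := ∞) (by norm_cast)
  have hloc : IsLocallyConstant (s.domRestrict c) := by
    rw [IsLocallyConstant.iff_eventually_eq]
    rintro ⟨t₀, ht₀⟩
    have h1 : c ⁻¹' (extChartAt I (c t₀)).source ∈ 𝓝[s] t₀ :=
      (hc t₀ ht₀).continuousWithinAt.preimage_mem_nhdsWithin (extChartAt_source_mem_nhds (c t₀))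
    obtain ⟨δ, hδ, hδs⟩ := Metric.mem_nhdsWithin_iff.1 h1
    rw [nhds_subtype_eq_comap]
    refine mem_comap.2 ⟨ball t₀ δ, ball_mem_nhds _ hδ, ?_⟩
    rintro ⟨t, ht⟩ (hb : t ∈ ball t₀ δ)
    have hd : ∀ x ∈ ball t₀ δ ∩ s, HasFDerivWithinAt (extChartAt I (c t₀) ∘ c)
        ((fun _ => 0 : V → V →L[ℝ] E) x) (ball t₀ δ ∩ s) x := by
      intro x hx
      have hx1 : c x ∈ (chartAt H (c t₀)).source := by
        have := hδs hx
        rwa [mem_preimage, extChartAt_source] at this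
      have h2 := (mdifferentiableAt_extChartAt (I := I) hx1).hasMFDerivAt.comp_hasMFDerivWithinAt x
        (hc x hx.2)
      have h3 : HasFDerivWithinAt (extChartAt I (c t₀) ∘ c) (0 : V →L[ℝ] E) s x := by
        rw [hasMFDerivWithinAt_iff_hasFDerivWithinAt] at h2
        exact h2.congr_fderiv (ContinuousLinearMap.comp_zero _)
      exact h3.mono inter_subset_right
    have hconv : Convex ℝ (ball t₀ δ ∩ s) := (convex_ball t₀ δ).inter hs
    have h4 := hconv.norm_image_sub_le_of_norm_hasFDerivWithin_le (C := 0) hd (fun x _ => by simp)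
      ⟨mem_ball_self hδ, ht₀⟩ ⟨hb, ht⟩
    rw [zero_mul, norm_le_zero_iff, sub_eq_zero] at h4
    exact (extChartAt I (c t₀)).injOn (hδs ⟨hb, ht⟩) (hδs ⟨mem_ball_self hδ, ht₀⟩) h4
  have : PreconnectedSpace s := isPreconnected_iff_preconnectedSpace.1 hs.isPreconnected
  exact hloc.apply_eq_of_preconnectedSpace ⟨t, ht⟩ ⟨t', ht'⟩

end ManifoldPreliminaries

/-! ### Smooth structure of the quotient torus -/

namespace PlaneLattice

open Set

variable (L : PlaneLattice)

theorem toTorus_add (z w : ℂ) : L.toTorus (z + w) = L.toTorus z + L.toTorus w := rfl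

theorem toTorus_zero : L.toTorus 0 = 0 := rfl

theorem toTorus_sub (z w : ℂ) : L.toTorus (z - w) = L.toTorus z - L.toTorus w := rfl

theorem toTorus_eq_zero_iff {z : ℂ} : L.toTorus z = 0 ↔ z ∈ L.toSubmodule :=
  QuotientAddGroup.eq_zero_iff z

theorem toTorus_eq_iff {z w : ℂ} : L.toTorus z = L.toTorus w ↔ z - w ∈ L.toSubmodule := by
  rw [← toTorus_eq_zero_iff, toTorus_sub, sub_eq_zero]

theorem chart_symm_eq {e : OpenPartialHomeomorph L.Torus ℂ} (he : e ∈ atlas ℂ L.Torus) {w : ℂ}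
    (hw : w ∈ e.target) : e.symm w = L.toTorus w := by
  have := L.toTorus_chart he (e.map_target hw)
  rw [e.right_inv hw] at this
  exact this.symm

/-- A chart inverts the projection locally, but its value at the class of `z₀` may be another
representative of that class. Translation by the lattice vector `a`, the difference of the two,
corrects this. -/
theorem isLocalDiffeomorph_toTorus : IsLocalDiffeomorph 𝓘(ℝ, ℂ) 𝓘(ℝ, ℂ) ∞ L.toTorus := by
  intro z₀
  set e := chartAt ℂ (L.toTorus z₀) with he
  have hat : e ∈ atlas ℂ L.Torus := chart_mem_atlas ℂ _
  have hsrc : L.toTorus z₀ ∈ e.source := mem_chart_source ℂ _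
  set a : ℂ := e (L.toTorus z₀) - z₀ with ha
  have haz : z₀ + a = e (L.toTorus z₀) := by rw [ha]; ring
  have haL : L.toTorus a = 0 := by
    rw [ha, toTorus_sub, L.toTorus_chart hat hsrc, sub_self]
  have hcoe : ∀ z, L.toTorus z = L.toTorus (z + a) := fun z => by rw [toTorus_add, haL, add_zero]
  have hmd : e ∈ IsManifold.maximalAtlas 𝓘(ℝ, ℂ) ∞ L.Torus :=
    IsManifold.subset_maximalAtlas hat
  let Φ : PartialDiffeomorph 𝓘(ℝ, ℂ) 𝓘(ℝ, ℂ) ℂ L.Torus ∞ :=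
    { toFun := L.toTorus
      invFun := fun x => e x - a
      source := (fun z => z + a) ⁻¹' e.target
      target := e.source
      map_source' := fun z hz => by
        rw [hcoe, ← L.chart_symm_eq hat hz]
        exact e.map_target hz
      map_target' := fun x hx => by
        rw [mem_preimage, sub_add_cancel]
        exact e.map_source hx
      left_inv' := fun z hz => by
        rw [hcoe, ← L.chart_symm_eq hat hz, e.right_inv hz]
        ring
      right_inv' := fun x hx => by
        rw [hcoe, sub_add_cancel, L.toTorus_chart hat hx]
      open_source := e.open_target.preimage (continuous_id.add continuous_const)
      open_target := e.open_source
      contMDiffOn_toFun := by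
        have h1 : ContMDiffOn 𝓘(ℝ, ℂ) 𝓘(ℝ, ℂ) ∞ e.symm e.target := contMDiffOn_symm_of_mem_maximalAtlas hmd
        have h2 : ContMDiff 𝓘(ℝ, ℂ) 𝓘(ℝ, ℂ) ∞ fun z : ℂ => z + a :=
          (contDiff_id.add contDiff_const).contMDiff
        refine (h1.comp h2.contMDiffOn (fun z hz => hz)).congr fun z hz => ?_
        rw [Function.comp_apply, L.chart_symm_eq hat hz, ← hcoe]
      contMDiffOn_invFun := by
        have h1 : ContMDiffOn 𝓘(ℝ, ℂ) 𝓘(ℝ, ℂ) ∞ e e.source := contMDiffOn_of_mem_maximalAtlas hmd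
        have h2 : ContMDiff 𝓘(ℝ, ℂ) 𝓘(ℝ, ℂ) ∞ fun z : ℂ => z - a :=
          (contDiff_id.sub contDiff_const).contMDiff
        exact h2.comp_contMDiffOn h1 }
  exact ⟨Φ, by change z₀ + a ∈ e.target; rw [haz]; exact e.map_source hsrc, fun z _ => rfl⟩

theorem contMDiff_toTorus : ContMDiff 𝓘(ℝ, ℂ) 𝓘(ℝ, ℂ) ∞ L.toTorus :=
  L.isLocalDiffeomorph_toTorus.contMDiff

/-- Maps out of the torus are smooth if their composition with the projection is. -/
theorem contMDiff_of_comp_toTorus {E H M : Type*} [NormedAddCommGroup E] [NormedSpace ℝ E]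
    [TopologicalSpace H] {I : ModelWithCorners ℝ E H} [TopologicalSpace M] [ChartedSpace H M]
    {f : L.Torus → M} (hf : ContMDiff 𝓘(ℝ, ℂ) I ∞ (f ∘ L.toTorus)) :
    ContMDiff 𝓘(ℝ, ℂ) I ∞ f := by
  intro c
  obtain ⟨z, rfl⟩ := L.surjective_toTorus c
  have h := L.isLocalDiffeomorph_toTorus z
  refine (hf.contMDiffAt.comp (L.toTorus z) h.localInverse_contMDiffAt).congr_of_eventuallyEq ?_
  filter_upwards [h.localInverse_eventuallyEq_right] with x hx
  simp only [Function.comp_apply, id] at hx ⊢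
  rw [hx]

theorem contMDiff_add_const (a : L.Torus) :
    ContMDiff 𝓘(ℝ, ℂ) 𝓘(ℝ, ℂ) ∞ fun c : L.Torus => c + a := by
  obtain ⟨w, rfl⟩ := L.surjective_toTorus a
  apply L.contMDiff_of_comp_toTorus
  have h2 : ContMDiff 𝓘(ℝ, ℂ) 𝓘(ℝ, ℂ) ∞ fun z : ℂ => z + w :=
    (contDiff_id.add contDiff_const).contMDiff
  exact L.contMDiff_toTorus.comp h2

/-- Translation of the torus, as a diffeomorphism. -/
def translation (a : L.Torus) : L.Torus ≃ₘ^∞⟮𝓘(ℝ, ℂ), 𝓘(ℝ, ℂ)⟯ L.Torus where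
  toEquiv := Equiv.addRight a
  contMDiff_toFun := L.contMDiff_add_const a
  contMDiff_invFun := by
    have := L.contMDiff_add_const (-a)
    exact this

end PlaneLattice


/-! ### Smooth actions of the plane -/

section PlaneActions

open Set Metric Filter Function

variable {E H : Type*} [NormedAddCommGroup E] [NormedSpace ℝ E] [TopologicalSpace H]

/-- A smooth action of the additive group `ℂ` on a manifold. -/
structure SmoothPlaneAction (I : ModelWithCorners ℝ E H) (M : Type*) [TopologicalSpace M]
    [ChartedSpace H M] where
  /-- the action -/
  flow : ℂ → M → M
  flow_zero : ∀ p, flow 0 p = p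
  flow_add : ∀ z w p, flow (z + w) p = flow z (flow w p)
  contMDiff_flow : ContMDiff (𝓘(ℝ, ℂ).prod I) I ∞ fun q : ℂ × M => flow q.1 q.2

variable {I : ModelWithCorners ℝ E H} {M : Type*} [TopologicalSpace M] [ChartedSpace H M]

theorem contMDiffAt_extChartAt_symm_of_boundaryless [IsManifold I ∞ M] [I.Boundaryless] {x : M} {y : E}
    (hy : y ∈ (extChartAt I x).target) :
    ContMDiffAt 𝓘(ℝ, E) I ∞ (extChartAt I x).symm y :=
  (contMDiffOn_extChartAt_symm x).contMDiffAt (extChartAt_target_mem_nhds' hy)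

theorem isInvertible_mfderiv_extChartAt_symm_of_boundaryless [IsManifold I ∞ M] [I.Boundaryless] {x : M} {y : E}
    (hy : y ∈ (extChartAt I x).target) :
    (mfderiv 𝓘(ℝ, E) I (extChartAt I x).symm y).IsInvertible := by
  have : IsManifold I 1 M := .of_le (n := ∞) (by norm_cast)
  have h := isInvertible_mfderivWithin_extChartAt_symm (I := I) hy
  rwa [I.range_eq_univ, mfderivWithin_univ] at h

/-- A continuous action of `ℂ` by diffeomorphisms is smooth. -/
theorem contMDiff_of_continuous_action [IsManifold I ∞ M] [FiniteDimensional ℝ E] [I.Boundaryless]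
    (F : ℂ → M ≃ₘ^∞⟮I, I⟯ M) (h0 : ∀ p, F 0 p = p) (hadd : ∀ z w p, F (z + w) p = F z (F w p))
    (hcont : Continuous fun q : ℂ × M => F q.1 q.2) :
    ContMDiff (𝓘(ℝ, ℂ).prod I) I ∞ fun q : ℂ × M => F q.1 q.2 := by
  have : IsManifold I 1 M := .of_le (n := ∞) (by norm_cast)
  have hzero : ∀ p₀ : M, ContMDiffAt (𝓘(ℝ, ℂ).prod I) I ∞ (fun q : ℂ × M => F q.1 q.2) (0, p₀) := by
    intro p₀
    set e := extChartAt I p₀ with he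
    have hy₀ : e p₀ ∈ e.target := mem_extChartAt_target p₀
    have hsymm₀ : e.symm (e p₀) = p₀ := extChartAt_to_inv p₀
    have hto : IsOpen e.target := isOpen_extChartAt_target p₀
    have hso : IsOpen e.source := isOpen_extChartAt_source p₀
    set Fh : ℂ → E → E := fun w y => e (F w (e.symm y)) with hFh
    have hG : ContinuousOn (fun q : ℂ × E => F q.1 (e.symm q.2)) (univ ×ˢ e.target) := by
      have h1 : ContinuousOn (fun q : ℂ × E => (q.1, e.symm q.2)) (univ ×ˢ e.target) :=
        continuousOn_fst.prodMk ((continuousOn_extChartAt_symm p₀).comp continuousOn_snd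
          (fun q hq => hq.2))
      exact hcont.comp_continuousOn h1
    have hGopen := hG.isOpen_inter_preimage (isOpen_univ.prod hto) hso
    have hGmem : ((0 : ℂ), e p₀) ∈ (univ ×ˢ e.target) ∩
        (fun q : ℂ × E => F q.1 (e.symm q.2)) ⁻¹' e.source := by
      refine ⟨⟨trivial, hy₀⟩, ?_⟩
      simp only [mem_preimage, h0, hsymm₀]
      exact mem_extChartAt_source p₀
    -- By continuity at `(0, p₀)`, small parameters move a small neighbourhood of `p₀` inside the
    -- chart domain, so the action can be read as a local action on `E`.
    obtain ⟨O, hO, U', hU', hOU⟩ := mem_nhds_prod_iff.1 (hGopen.mem_nhds hGmem)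
    obtain ⟨r, hr, hrO⟩ := Metric.mem_nhds_iff.1 hO
    obtain ⟨U, hUU', hU, hpU⟩ := _root_.mem_nhds_iff.1 hU'
    have hsub : ∀ w ∈ ball (0 : ℂ) r, ∀ y ∈ U, y ∈ e.target ∧ F w (e.symm y) ∈ e.source := by
      intro w hw y hy
      have := hOU (show (w, y) ∈ O ×ˢ U' from ⟨hrO hw, hUU' hy⟩)
      exact ⟨this.1.2, this.2⟩
    have h00 : (0 : ℂ) ∈ ball (0 : ℂ) r := mem_ball_self hr
    have hUt : U ⊆ e.target := fun y hy => (hsub 0 h00 y hy).1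
    have key : ContDiffAt ℝ ∞ (uncurry Fh) (0, e p₀) := by
      refine contDiffAt_of_continuous_local_action hr hU hpU ?_ ?_ ?_ ?_ ?_
      · exact (continuousOn_extChartAt p₀).comp (hG.mono (prod_mono (subset_univ _) hUt))
          (fun q hq => (hsub q.1 hq.1 q.2 hq.2).2)
      · intro w hw
        rw [← contMDiffOn_iff_contDiffOn]
        have h1 : ContMDiffOn 𝓘(ℝ, E) I ∞ (fun y => F w (e.symm y)) U :=
          (F w).contMDiff.comp_contMDiffOn ((contMDiffOn_extChartAt_symm p₀).mono hUt)
        exact contMDiffOn_extChartAt.comp h1 (fun y hy => by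
          have := (hsub w hw y hy).2
          rwa [he, extChartAt_source] at this)
      · intro w hw
        have hsrc : F w p₀ ∈ e.source := by
          have := (hsub w hw _ hpU).2
          rwa [hsymm₀] at this
        have d1 : HasMFDerivAt 𝓘(ℝ, E) I e.symm (e p₀) (mfderiv 𝓘(ℝ, E) I e.symm (e p₀)) :=
          ((contMDiffAt_extChartAt_symm_of_boundaryless hy₀).mdifferentiableAt (by simp)).hasMFDerivAt
        have d2 : HasMFDerivAt I I (F w) (e.symm (e p₀)) (mfderiv I I (F w) (e.symm (e p₀))) :=
          ((F w).contMDiff.mdifferentiable (by simp) _).hasMFDerivAt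
        have d3 : HasMFDerivAt I 𝓘(ℝ, E) e (F w (e.symm (e p₀)))
            (mfderiv I 𝓘(ℝ, E) e (F w (e.symm (e p₀)))) := by
          refine (mdifferentiableAt_extChartAt ?_).hasMFDerivAt
          rw [hsymm₀, ← extChartAt_source (I := I)]
          exact hsrc
        have d := d3.comp (e p₀) (d2.comp (e p₀) d1)
        have d' : mfderiv 𝓘(ℝ, E) 𝓘(ℝ, E) (Fh w) (e p₀) = _ := d.mfderiv
        rw [← mfderiv_eq_fderiv, d']
        have i1 := isInvertible_mfderiv_extChartAt_symm_of_boundaryless (I := I) hy₀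
        have i2 : (mfderiv I I (F w) (e.symm (e p₀))).IsInvertible :=
          ⟨(F w).mfderivToContinuousLinearEquiv (by simp) _,
            (F w).mfderivToContinuousLinearEquiv_coe (by simp)⟩
        have i3 : (mfderiv I 𝓘(ℝ, E) e (F w (e.symm (e p₀)))).IsInvertible := by
          apply isInvertible_mfderiv_extChartAt
          rw [hsymm₀]
          exact hsrc
        exact i3.comp (i2.comp i1)
      · simp only [hFh, h0, hsymm₀]
      · intro w z y hw hz hwz hy hzy
        simp only [hFh]
        rw [hadd, e.left_inv (hsub z hz y hy).2]
    have hev : (fun q : ℂ × M => F q.1 q.2) =ᶠ[𝓝 (0, p₀)]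
        e.symm ∘ uncurry Fh ∘ fun q : ℂ × M => (q.1, e q.2) := by
      have n1 : ∀ᶠ q : ℂ × M in 𝓝 (0, p₀), q.2 ∈ e.source :=
        (continuous_snd.tendsto _) (extChartAt_source_mem_nhds p₀)
      have n2 : ∀ᶠ q : ℂ × M in 𝓝 (0, p₀), F q.1 q.2 ∈ e.source := by
        refine (hcont.tendsto (0, p₀)) ?_
        rw [h0]
        exact extChartAt_source_mem_nhds p₀
      filter_upwards [n1, n2] with q hq1 hq2
      simp only [comp_apply, uncurry, hFh]
      rw [e.left_inv hq1, e.left_inv hq2]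
    refine ContMDiffAt.congr_of_eventuallyEq ?_ hev
    have hk0 : uncurry Fh (0, e p₀) = e p₀ := by simp only [uncurry, hFh, h0, hsymm₀]
    have m1 : ContMDiffAt (𝓘(ℝ, ℂ).prod I) 𝓘(ℝ, ℂ × E) ∞ (fun q : ℂ × M => (q.1, e q.2)) (0, p₀) := by
      rw [modelWithCornersSelf_prod, ← chartedSpaceSelf_prod]
      exact contMDiffAt_fst.prodMk (ContMDiffAt.comp (0, p₀) (g := e)
        (contMDiffAt_extChartAt (x := p₀)) contMDiffAt_snd)
    have m2 : ContMDiffAt 𝓘(ℝ, ℂ × E) 𝓘(ℝ, E) ∞ (uncurry Fh) (0, e p₀) := key.contMDiffAt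
    have m3 : ContMDiffAt 𝓘(ℝ, E) I ∞ e.symm (uncurry Fh (0, e p₀)) := by
      rw [hk0]; exact contMDiffAt_extChartAt_symm_of_boundaryless hy₀
    exact ContMDiffAt.comp (0, p₀) (g := e.symm) m3
      (ContMDiffAt.comp (0, p₀) (g := uncurry Fh) m2 m1)
  rintro ⟨z₀, p₀⟩
  -- The identity `F z = F z₀ ∘ F (z - z₀)` carries smoothness from parameter `0` to parameter `z₀`.
  have e1 : (fun q : ℂ × M => F q.1 q.2) =
      (F z₀) ∘ (fun q : ℂ × M => F q.1 q.2) ∘ fun q : ℂ × M => (q.1 - z₀, q.2) := by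
    funext q
    simp only [comp_apply]
    rw [← hadd, add_sub_cancel]
  rw [e1]
  refine ContMDiffAt.comp (z₀, p₀) (F z₀).contMDiff.contMDiffAt ?_
  have s1 : ContMDiffAt (𝓘(ℝ, ℂ).prod I) (𝓘(ℝ, ℂ).prod I) ∞
      (fun q : ℂ × M => (q.1 - z₀, q.2)) (z₀, p₀) := by
    have h2 : ContMDiff 𝓘(ℝ, ℂ) 𝓘(ℝ, ℂ) ∞ fun z : ℂ => z - z₀ :=
      (contDiff_id.sub contDiff_const).contMDiff
    exact (h2.contMDiffAt.comp (z₀, p₀) contMDiffAt_fst).prodMk contMDiffAt_snd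
  have s2 := hzero p₀
  rw [← sub_self z₀] at s2
  exact ContMDiffAt.comp (z₀, p₀) (g := fun q : ℂ × M => F q.1 q.2) s2 s1

namespace SmoothPlaneAction

variable (T : SmoothPlaneAction I M)

theorem flow_neg_flow (z : ℂ) (p : M) : T.flow (-z) (T.flow z p) = p := by
  rw [← T.flow_add, neg_add_cancel, T.flow_zero]

theorem flow_comm (z w : ℂ) (p : M) : T.flow z (T.flow w p) = T.flow w (T.flow z p) := by
  rw [← T.flow_add, add_comm, T.flow_add]

theorem contMDiff_flow_left (p : M) : ContMDiff 𝓘(ℝ, ℂ) I ∞ fun z => T.flow z p :=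
  T.contMDiff_flow.comp (contMDiff_id.prodMk contMDiff_const)

theorem contMDiff_flow_right (z : ℂ) : ContMDiff I I ∞ (T.flow z) :=
  T.contMDiff_flow.comp (contMDiff_const.prodMk contMDiff_id)

/-- The infinitesimal action of `v : ℂ` at the point `p`. -/
noncomputable def gen (p : M) : ℂ →L[ℝ] TangentSpace I p := mfderiv 𝓘(ℝ, ℂ) I (fun z => T.flow z p) 0

/-- The group law reduces differentiation at `z` to differentiation at `0` from the point `T.flow z
p`. Thus orbit maps solve the total differential equation defined by the generators. -/
theorem hasMFDerivAt_flow (z : ℂ) (p : M) :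
    HasMFDerivAt 𝓘(ℝ, ℂ) I (fun w => T.flow w p) z (T.gen (T.flow z p)) := by
  have e : (fun w => T.flow w p) = (fun w => T.flow w (T.flow z p)) ∘ fun w => w - z := by
    funext w
    rw [comp_apply, ← T.flow_add, sub_add_cancel]
  have h1 : HasMFDerivAt 𝓘(ℝ, ℂ) I (fun w => T.flow w (T.flow z p)) (z - z)
      (T.gen (T.flow z p)) := by
    rw [sub_self]
    exact ((T.contMDiff_flow_left (T.flow z p)).mdifferentiable (by simp) 0).hasMFDerivAt
  have h2 : HasMFDerivAt 𝓘(ℝ, ℂ) 𝓘(ℝ, ℂ) (fun w : ℂ => w - z) z (ContinuousLinearMap.id ℝ ℂ) :=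
    ((hasFDerivAt_id z).sub_const z).hasMFDerivAt
  rw [e]
  exact HasMFDerivAt.comp (f := fun w => w - z) z h1 h2

/-- Generators are invariant under the action because `ℂ` is commutative: `T.flow z` maps the orbit
map of `p` to that of `T.flow z p`. -/
theorem mfderiv_flow_gen (z : ℂ) (p : M) (v : ℂ) :
    mfderiv I I (T.flow z) p (T.gen p v) = T.gen (T.flow z p) v := by
  have h1 : HasMFDerivAt I I (T.flow z) p (mfderiv I I (T.flow z) p) :=
    ((T.contMDiff_flow_right z).mdifferentiable (by simp) p).hasMFDerivAt
  have h2 := T.hasMFDerivAt_flow 0 p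
  have h1' : HasMFDerivAt I I (T.flow z) (T.flow 0 p) (mfderiv I I (T.flow z) p) := by
    rw [T.flow_zero]; exact h1
  have h3 := h1'.comp 0 h2
  have h4 := T.hasMFDerivAt_flow 0 (T.flow z p)
  have e : (T.flow z ∘ fun w => T.flow w p) = fun w => T.flow w (T.flow z p) := by
    funext w; exact T.flow_comm z w p
  rw [e] at h3
  have h5 := hasMFDerivAt_unique h3 h4
  have h6 := congrArg (fun A : ℂ →L[ℝ] E => A v) h5
  have e0 : T.flow 0 p = p := T.flow_zero p
  have e1 : T.flow 0 (T.flow z p) = T.flow z p := T.flow_zero _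
  change (mfderiv I I (T.flow z) p) (T.gen (T.flow 0 p) v) = T.gen (T.flow 0 (T.flow z p)) v at h6
  rw [e1] at h6
  convert h6 using 2
  rw [e0]

end SmoothPlaneAction

end PlaneActions


/-! ### Local structure of principal bundles and the actions defined by a frame -/

section BundleGeometry

open Set Filter Function

variable {EG HG EP HP ES HS : Type*}
  [NormedAddCommGroup EG] [NormedSpace ℝ EG] [TopologicalSpace HG]
  [NormedAddCommGroup EP] [NormedSpace ℝ EP] [TopologicalSpace HP]
  [NormedAddCommGroup ES] [NormedSpace ℝ ES] [TopologicalSpace HS]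
  {IG : ModelWithCorners ℝ EG HG} {IP : ModelWithCorners ℝ EP HP}
  {IS : ModelWithCorners ℝ ES HS}
  {G : Type*} [TopologicalSpace G] [ChartedSpace HG G] [Group G]
  {P : Type*} [TopologicalSpace P] [ChartedSpace HP P]
  {S : Type*} [TopologicalSpace S] [ChartedSpace HS S]

namespace SmoothPrincipalBundle

variable (Q : SmoothPrincipalBundle IG IP IS G P S)

theorem contMDiff_act_right (g : G) : ContMDiff IP IP ∞ fun p => Q.act p g :=
  Q.contMDiff_act.comp (contMDiff_id.prodMk contMDiff_const)

/-- Near every point of the base there is a smooth equivariant map to the structure group. -/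
theorem exists_equivariant_map (b : S) : ∃ (U : Set S) (δ : P → G), IsOpen U ∧ b ∈ U ∧
    ContMDiffOn IP IG ∞ δ (Q.proj ⁻¹' U) ∧
    ∀ p q, Q.proj p ∈ U → Q.proj p = Q.proj q → Q.act p ((δ p)⁻¹ * δ q) = q := by
  obtain ⟨U, φ, hU, hb, hsrc, htgt, hφ, hφs, hfst, hsnd⟩ := Q.locally_trivial b
  refine ⟨U, fun p => (φ p).2, hU, hb, ?_, fun p q hp hpq => ?_⟩
  · rw [← hsrc]
    exact contMDiff_snd.comp_contMDiffOn hφ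
  · have hp' : p ∈ φ.source := by rw [hsrc]; exact hp
    have hq' : q ∈ φ.source := by rw [hsrc, mem_preimage, ← hpq]; exact hp
    set g := (φ p).2⁻¹ * (φ q).2
    have hpg : Q.act p g ∈ φ.source := by rw [hsrc, mem_preimage, Q.proj_act]; exact hp
    refine φ.injOn hpg hq' (Prod.ext ?_ ?_)
    · rw [hfst _ hpg, hfst _ hq', Q.proj_act, hpq]
    · rw [hsnd p hp' g, mul_inv_cancel_left]

theorem exists_act_eq {p q : P} (h : Q.proj p = Q.proj q) : ∃ g, Q.act p g = q := by
  obtain ⟨U, δ, -, hb, -, hδ⟩ := Q.exists_equivariant_map (Q.proj p)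
  exact ⟨_, hδ p q hb h⟩

/-- Through every point of the total space there is a smooth local section. -/
theorem exists_section (p : P) : ∃ (U : Set S) (σ : S → P), IsOpen U ∧ Q.proj p ∈ U ∧
    ContMDiffOn IS IP ∞ σ U ∧ (∀ x ∈ U, Q.proj (σ x) = x) ∧ σ (Q.proj p) = p := by
  obtain ⟨U, φ, hU, hb, hsrc, htgt, hφ, hφs, hfst, hsnd⟩ := Q.locally_trivial (Q.proj p)
  have hp' : p ∈ φ.source := by rw [hsrc]; exact hb
  have hmem : ∀ x ∈ U, (x, (φ p).2) ∈ φ.target := fun x hx => by rw [htgt]; exact ⟨hx, trivial⟩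
  refine ⟨U, fun x => φ.symm (x, (φ p).2), hU, hb, ?_, fun x hx => ?_, ?_⟩
  · exact hφs.comp (contMDiff_id.prodMk contMDiff_const).contMDiffOn hmem
  · rw [← hfst _ (φ.map_target (hmem x hx)), φ.right_inv (hmem x hx)]
  · have : (Q.proj p, (φ p).2) = φ p := by rw [← hfst p hp']
    simp only [this, φ.left_inv hp']

theorem proj_surjective : Surjective Q.proj := by
  intro b
  obtain ⟨U, φ, hU, hb, hsrc, htgt, hφ, hφs, hfst, hsnd⟩ := Q.locally_trivial b
  have hmem : (b, (1 : G)) ∈ φ.target := by rw [htgt]; exact ⟨hb, trivial⟩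
  exact ⟨φ.symm (b, 1), by rw [← hfst _ (φ.map_target hmem), φ.right_inv hmem]⟩

/-- Points of one fibre are separated inside a trivialization, points of different fibres by
preimages of open sets in the base. -/
theorem t2Space (Q : SmoothPrincipalBundle IG IP IS G P S) [T2Space S] [T2Space G] : T2Space P := by
  refine ⟨fun p q hpq => ?_⟩
  by_cases h : Q.proj p = Q.proj q
  · obtain ⟨U, φ, hU, hb, hsrc, htgt, hφ, hφs, hfst, hsnd⟩ := Q.locally_trivial (Q.proj p)
    have hp' : p ∈ φ.source := by rw [hsrc]; exact hb
    have hq' : q ∈ φ.source := by rw [hsrc, mem_preimage, ← h]; exact hb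
    have hne : φ p ≠ φ q := fun he => hpq (φ.injOn hp' hq' he)
    obtain ⟨A, B, hA, hB, hpA, hqB, hAB⟩ := t2_separation hne
    refine ⟨φ.source ∩ φ ⁻¹' A, φ.source ∩ φ ⁻¹' B, φ.isOpen_inter_preimage hA,
      φ.isOpen_inter_preimage hB, ⟨hp', hpA⟩, ⟨hq', hqB⟩, ?_⟩
    exact (hAB.preimage φ).mono inter_subset_right inter_subset_right
  · obtain ⟨A, B, hA, hB, hpA, hqB, hAB⟩ := t2_separation h
    exact ⟨_, _, hA.preimage Q.contMDiff_proj.continuous, hB.preimage Q.contMDiff_proj.continuous,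
      hpA, hqB, hAB.preimage Q.proj⟩

theorem hasMFDerivAt_proj (p : P) :
    HasMFDerivAt IP IS Q.proj p (mfderiv IP IS Q.proj p) :=
  (Q.contMDiff_proj.mdifferentiable (by simp) p).hasMFDerivAt

theorem surjective_mfderiv_proj (p : P) : Surjective (mfderiv IP IS Q.proj p) := by
  obtain ⟨U, σ, hU, hb, hσ, hσp, hσ0⟩ := Q.exists_section p
  have h1 : HasMFDerivAt IS IP σ (Q.proj p) (mfderiv IS IP σ (Q.proj p)) :=
    ((hσ.contMDiffAt (hU.mem_nhds hb)).mdifferentiableAt (by simp)).hasMFDerivAt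
  have h2 : HasMFDerivAt IP IS Q.proj (σ (Q.proj p)) (mfderiv IP IS Q.proj p) := by
    rw [hσ0]; exact Q.hasMFDerivAt_proj p
  have h3 : HasMFDerivAt IS IS (Q.proj ∘ σ) (Q.proj p)
      (ContinuousLinearMap.id ℝ (TangentSpace IS (Q.proj p))) := by
    refine (hasMFDerivAt_id (Q.proj p)).congr_of_eventuallyEq ?_
    filter_upwards [hU.mem_nhds hb] with x hx using hσp x hx
  have h4 := hasMFDerivAt_unique (h2.comp (Q.proj p) h1) h3
  intro v
  exact ⟨mfderiv IS IP σ (Q.proj p) v, congrArg (fun A : ES →L[ℝ] ES => A v) h4⟩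

end SmoothPrincipalBundle

namespace Frame

variable {Q : SmoothPrincipalBundle IG IP IS G P S} (γ : Frame Q)

theorem total_zero (p : P) : γ.total 0 p = p := by
  have : γ.toHom (Multiplicative.ofAdd 0) = 1 := map_one γ.toHom
  rw [total, this]; rfl

theorem base_zero (x : S) : γ.base 0 x = x := by
  have : γ.toHom (Multiplicative.ofAdd 0) = 1 := map_one γ.toHom
  rw [base, this]; rfl

theorem total_add (z w : ℂ) (p : P) : γ.total (z + w) p = γ.total z (γ.total w p) := by
  have : γ.toHom (Multiplicative.ofAdd (z + w)) =
    γ.toHom (Multiplicative.ofAdd z) * γ.toHom (Multiplicative.ofAdd w) := map_mul γ.toHom _ _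
  rw [total, this]; rfl

theorem base_add (z w : ℂ) (x : S) : γ.base (z + w) x = γ.base z (γ.base w x) := by
  have : γ.toHom (Multiplicative.ofAdd (z + w)) =
    γ.toHom (Multiplicative.ofAdd z) * γ.toHom (Multiplicative.ofAdd w) := map_mul γ.toHom _ _
  rw [base, this]; rfl

theorem proj_total (z : ℂ) (p : P) : Q.proj (γ.total z p) = γ.base z (Q.proj p) :=
  BundleAut.proj_total _ p

theorem total_act (z : ℂ) (p : P) (g : G) : γ.total z (Q.act p g) = Q.act (γ.total z p) g :=
  BundleAut.total_act _ p g

/-- Over a locally compact space evaluation is continuous for the compact-open topology, so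
continuity of the homomorphism becomes joint continuity of the action. -/
theorem continuous_total [LocallyCompactSpace P] : Continuous fun q : ℂ × P => γ.total q.1 q.2 := by
  have h1 : Continuous fun z : ℂ =>
      BundleAut.toContinuousMap (γ.toHom (Multiplicative.ofAdd z)) :=
    continuous_induced_dom.comp (γ.toHom.continuous_toFun.comp continuous_ofAdd)
  exact (h1.comp continuous_fst).eval continuous_snd

/-- The topology of `BundleAut Q` sees only the total space; continuity of the base action is
recovered by moving the points of a local section and projecting. -/
theorem continuous_base [LocallyCompactSpace P] : Continuous fun q : ℂ × S => γ.base q.1 q.2 := by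
  rw [continuous_iff_continuousAt]
  rintro ⟨z₀, x₀⟩
  obtain ⟨p, rfl⟩ := Q.proj_surjective x₀
  obtain ⟨U, σ, hU, hb, hσ, hσp, -⟩ := Q.exists_section p
  have h1 : ContinuousAt (fun q : ℂ × S => Q.proj (γ.total q.1 (σ q.2))) (z₀, Q.proj p) := by
    have h2 : ContinuousAt (fun q : ℂ × S => (q.1, σ q.2)) (z₀, Q.proj p) :=
      continuousAt_fst.prodMk (ContinuousAt.comp (f := Prod.snd) (x := (z₀, Q.proj p))
        (hσ.continuousOn.continuousAt (hU.mem_nhds hb)) continuousAt_snd)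
    exact (Q.contMDiff_proj.continuous.comp γ.continuous_total).continuousAt.comp h2
  refine h1.congr ?_
  filter_upwards [continuous_snd.continuousAt.preimage_mem_nhds (hU.mem_nhds hb)] with q hq
  rw [γ.proj_total, hσp _ hq]

/-- The smooth action of `ℂ` on the total space. -/
noncomputable def totalAction [FiniteDimensional ℝ EP] [IP.Boundaryless] [IsManifold IP ∞ P] :
    SmoothPlaneAction IP P where
  flow z p := γ.total z p
  flow_zero := γ.total_zero
  flow_add := γ.total_add
  contMDiff_flow := by
    have : LocallyCompactSpace P := Manifold.locallyCompact_of_finiteDimensional IP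
    exact contMDiff_of_continuous_action γ.total γ.total_zero γ.total_add γ.continuous_total

/-- The smooth action of `ℂ` on the base. -/
noncomputable def baseAction [FiniteDimensional ℝ EP] [IP.Boundaryless] [IsManifold IP ∞ P]
    [FiniteDimensional ℝ ES] [IS.Boundaryless] [IsManifold IS ∞ S] :
    SmoothPlaneAction IS S where
  flow z p := γ.base z p
  flow_zero := γ.base_zero
  flow_add := γ.base_add
  contMDiff_flow := by
    have : LocallyCompactSpace P := Manifold.locallyCompact_of_finiteDimensional IP
    exact contMDiff_of_continuous_action γ.base γ.base_zero γ.base_add γ.continuous_base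

end Frame

end BundleGeometry


/-! ### Transitive plane actions on compact surfaces -/

section TransitiveActions

open Set Metric Filter Function

variable {E H : Type*} [NormedAddCommGroup E] [NormedSpace ℝ E] [TopologicalSpace H]
  {I : ModelWithCorners ℝ E H} {M : Type*} [TopologicalSpace M] [ChartedSpace H M]

/-- A smooth map from a vector space to a manifold with invertible derivatives is a local
diffeomorphism. -/
theorem isLocalDiffeomorph_of_isInvertible_mfderiv {V : Type*} [NormedAddCommGroup V]
    [NormedSpace ℝ V] [CompleteSpace V] [IsManifold I ∞ M] [I.Boundaryless] {f : V → M}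
    (hf : ContMDiff 𝓘(ℝ, V) I ∞ f) (hinv : ∀ z, (mfderiv 𝓘(ℝ, V) I f z).IsInvertible) :
    IsLocalDiffeomorph 𝓘(ℝ, V) I ∞ f := by
  have : IsManifold I 1 M := .of_le (n := ∞) (by norm_cast)
  intro z₀
  set e := extChartAt I (f z₀) with he
  set O : Set V := f ⁻¹' e.source with hO
  have hOo : IsOpen O := (isOpen_extChartAt_source (f z₀)).preimage hf.continuous
  have hz₀ : z₀ ∈ O := mem_extChartAt_source (f z₀)
  set h : V → E := e ∘ f with hh
  have hsm : ∀ z ∈ O, ContDiffAt ℝ ∞ h z := by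
    intro z hz
    rw [← contMDiffAt_iff_contDiffAt]
    refine ContMDiffAt.comp z (g := e) (contMDiffAt_extChartAt' ?_) hf.contMDiffAt
    rw [← extChartAt_source (I := I)]
    exact hz
  have hder : ∀ z ∈ O, ∃ A : V ≃L[ℝ] E, HasFDerivAt h (A : V →L[ℝ] E) z := by
    intro z hz
    have hz' : f z ∈ (chartAt H (f z₀)).source := by
      rw [← extChartAt_source (I := I)]; exact hz
    have d1 : HasMFDerivAt 𝓘(ℝ, V) I f z (mfderiv 𝓘(ℝ, V) I f z) :=
      (hf.mdifferentiable (by simp) z).hasMFDerivAt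
    have d2 := (mdifferentiableAt_extChartAt (I := I) hz').hasMFDerivAt
    have i : ((mfderiv I 𝓘(ℝ, E) e (f z)).comp (mfderiv 𝓘(ℝ, V) I f z)).IsInvertible :=
      (isInvertible_mfderiv_extChartAt (I := I) hz).comp (hinv z)
    obtain ⟨A, hA⟩ := i
    refine ⟨A, ?_⟩
    have d3 := hasMFDerivAt_iff_hasFDerivAt.1 (d2.comp z d1)
    exact d3.congr_fderiv hA.symm
  obtain ⟨A₀, hA₀⟩ := hder z₀ hz₀
  let φ := (hsm z₀ hz₀).toOpenPartialHomeomorph h hA₀ (by simp)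
  have hφ : (φ : V → E) = h := rfl
  have hφ0 : z₀ ∈ φ.source := (hsm z₀ hz₀).mem_toOpenPartialHomeomorph_source hA₀ (by simp)
  let ψ := φ.restrOpen O hOo
  have hψs : ψ.source = φ.source ∩ O := rfl
  have hψc : ∀ z, ψ z = h z := fun z => rfl
  have hsrc : (ψ.toPartialEquiv.trans e.symm).source = ψ.source := by
    rw [PartialEquiv.trans_source]
    refine inter_eq_left.2 fun z hz => ?_
    exact e.map_source hz.2
  have hmap : ∀ z ∈ ψ.source, e.symm (ψ z) = f z := fun z hz => e.left_inv hz.2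
  let Φ : PartialDiffeomorph 𝓘(ℝ, V) I V M ∞ :=
    { toPartialEquiv := ψ.toPartialEquiv.trans e.symm
      open_source := by rw [hsrc]; exact ψ.open_source
      open_target := by
        rw [PartialEquiv.trans_target]
        exact (continuousOn_extChartAt (f z₀)).isOpen_inter_preimage
          (isOpen_extChartAt_source (f z₀)) ψ.open_target
      contMDiffOn_toFun := by
        rw [hsrc]
        exact hf.contMDiffOn.congr hmap
      contMDiffOn_invFun := by
        have h1 : ContMDiffOn 𝓘(ℝ, E) 𝓘(ℝ, V) ∞ ψ.symm ψ.target := by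
          rw [contMDiffOn_iff_contDiffOn]
          intro y hy
          have hy' := ψ.map_target hy
          obtain ⟨A, hA⟩ := hder _ hy'.2
          exact (ψ.contDiffAt_symm hy hA (hsm _ hy'.2)).contDiffWithinAt
        refine h1.comp (contMDiffOn_extChartAt.mono ?_) ?_
        · intro y hy
          rw [PartialEquiv.trans_target] at hy
          rw [← extChartAt_source (I := I)]
          exact hy.1
        · intro y hy
          rw [PartialEquiv.trans_target] at hy
          exact hy.2 }
  refine ⟨Φ, ?_, ?_⟩
  · change z₀ ∈ (ψ.toPartialEquiv.trans e.symm).source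
    rw [hsrc]; exact ⟨hφ0, hz₀⟩
  · intro z hz
    have hz' : z ∈ ψ.source := by
      rw [← hsrc]; exact hz
    exact (hmap z hz').symm

/-- A manifold of dimension at least two is not the image of a smooth curve. -/
theorem not_surjective_of_two_le_finrank [IsManifold I ∞ M] [I.Boundaryless]
    [FiniteDimensional ℝ E] (hE : 2 ≤ Module.finrank ℝ E) {c : ℝ → M} (hc : ContMDiff 𝓘(ℝ, ℝ) I ∞ c) :
    ¬ Surjective c := by
  intro hsurj
  set x := c 0
  set e := extChartAt I x
  set V : Set ℝ := c ⁻¹' e.source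
  have hVo : IsOpen V := (isOpen_extChartAt_source x).preimage hc.continuous
  -- Locally Lipschitz maps do not raise Hausdorff dimension, whereas a chart target, being open,
  -- has dimension `finrank ℝ E`.
  have h1 : dimH ((e ∘ c) '' V) ≤ dimH V := by
    refine dimH_image_le_of_locally_lipschitzOn fun t ht => ?_
    have h2 : ContDiffAt ℝ ∞ (e ∘ c) t := by
      rw [← contMDiffAt_iff_contDiffAt]
      refine ContMDiffAt.comp t (g := e) (contMDiffAt_extChartAt' ?_) hc.contMDiffAt
      rw [← extChartAt_source (I := I)]
      exact ht
    obtain ⟨K, s, hs, hK⟩ := (h2.of_le (m := 1) (by norm_cast)).exists_lipschitzOnWith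
    exact ⟨K, s, mem_nhdsWithin_of_mem_nhds hs, hK⟩
  have h3 : (e ∘ c) '' V = e.target := by
    rw [image_comp, image_preimage_eq _ hsurj, e.image_source_eq_target]
  rw [h3, Real.dimH_of_mem_nhds (extChartAt_target_mem_nhds x)] at h1
  have h4 : dimH V ≤ 1 := (dimH_mono (subset_univ V)).trans (by rw [Real.dimH_univ])
  have h5 := h1.trans h4
  have h6 : Module.finrank ℝ E ≤ 1 := by exact_mod_cast h5
  omega

namespace SmoothPlaneAction

variable (T : SmoothPlaneAction I M)

/-- If `gen x v = 0` with `v ≠ 0`, then by invariance the generator of `v` vanishes along the curve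
`t ↦ flow (t • v) x`, so the line `ℝ v` fixes `x`. As `ℂ` is spanned by `v` and `I * v`, the orbit
of `x`, which is all of `M`, is the image of the single curve `t ↦ flow (t • (I * v)) x`; in
dimension at least two this is impossible. -/
theorem gen_injective_of_transitive [IsManifold I ∞ M] [I.Boundaryless] [FiniteDimensional ℝ E]
    (hE : 2 ≤ Module.finrank ℝ E)
    (htrans : ∀ x y, ∃ z, T.flow z x = y) (x : M) : Injective (T.gen x) := by
  rw [injective_iff_map_eq_zero]
  intro v hv
  by_contra hv0
  have hline : ∀ u : ℂ, ContMDiff 𝓘(ℝ, ℝ) I ∞ fun t : ℝ => T.flow (t • u) x := fun u =>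
    (T.contMDiff_flow_left x).comp (contDiff_id.smul contDiff_const).contMDiff
  have hfix : ∀ t : ℝ, T.flow (t • v) x = x := by
    intro t
    have hd : ∀ t ∈ (univ : Set ℝ), HasMFDerivWithinAt 𝓘(ℝ, ℝ) I (fun t : ℝ => T.flow (t • v) x)
        univ t 0 := by
      intro t _
      have h1 : HasMFDerivAt 𝓘(ℝ, ℝ) 𝓘(ℝ, ℂ) (fun t : ℝ => t • v) t
          ((ContinuousLinearMap.id ℝ ℝ).smulRight v) :=
        ((hasFDerivAt_id t).smul_const v).hasMFDerivAt
      have h2 := (T.hasMFDerivAt_flow (t • v) x).comp t h1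
      have h3 : ((T.gen (T.flow (t • v) x)).comp
          ((ContinuousLinearMap.id ℝ ℝ).smulRight v) : ℝ →L[ℝ] E) = 0 := by
        ext
        have : T.gen (T.flow (t • v) x) v = 0 := by
          rw [← T.mfderiv_flow_gen, hv, map_zero]
        simpa using this
      exact (h2.congr_mfderiv h3).hasMFDerivWithinAt
    have := eq_of_hasMFDerivWithinAt_zero (I := I) convex_univ hd (mem_univ t) (mem_univ 0)
    simpa [T.flow_zero] using this
  refine not_surjective_of_two_le_finrank hE (hline (Complex.I * v)) fun y => ?_
  obtain ⟨z, rfl⟩ := htrans x y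
  refine ⟨(z / v).im, ?_⟩
  have hz : z = (z / v).im • (Complex.I * v) + (z / v).re • v := by
    have h1 : z = (z / v) * v := by field_simp
    conv_lhs => rw [h1, ← Complex.re_add_im (z / v)]
    simp only [Complex.real_smul]
    ring
  conv_rhs => rw [hz, T.flow_add, hfix]

theorem isLocalDiffeomorph_flow [IsManifold I ∞ M] [I.Boundaryless] [FiniteDimensional ℝ E]
    (hE : Module.finrank ℝ E = 2)
    (htrans : ∀ x y, ∃ z, T.flow z x = y) (x : M) :
    IsLocalDiffeomorph 𝓘(ℝ, ℂ) I ∞ fun z => T.flow z x := by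
  refine isLocalDiffeomorph_of_isInvertible_mfderiv (T.contMDiff_flow_left x) fun z => ?_
  rw [(T.hasMFDerivAt_flow z x).mfderiv]
  have hinj := T.gen_injective_of_transitive hE.ge htrans (T.flow z x)
  have hfr : Module.finrank ℝ ℂ = Module.finrank ℝ E := by rw [hE, Complex.finrank_real_complex]
  let A : ℂ →ₗ[ℝ] E := (T.gen (T.flow z x)).toLinearMap
  have hA : Injective A := hinj
  exact ⟨(LinearEquiv.ofInjectiveOfFinrankEq A hA hfr).toContinuousLinearEquiv,
    by ext v; rfl⟩

/-- The isotropy group of a point. -/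
def isotropy (x : M) : AddSubgroup ℂ where
  carrier := {z | T.flow z x = x}
  zero_mem' := T.flow_zero x
  add_mem' := fun {z w} (hz : T.flow z x = x) (hw : T.flow w x = x) => by
    change T.flow (z + w) x = x
    rw [T.flow_add, hw, hz]
  neg_mem' := fun {z} (hz : T.flow z x = x) => by
    change T.flow (-z) x = x
    conv_lhs => rw [← hz]
    exact T.flow_neg_flow z x

/-- A transitive smooth action on a compact surface has a lattice of isotropy, and the surface is
the corresponding torus. -/
theorem exists_lattice_diffeomorph [IsManifold I ∞ M] [I.Boundaryless] [FiniteDimensional ℝ E]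
    [CompactSpace M] [Nonempty M] (hE : Module.finrank ℝ E = 2)
    (htrans : ∀ x y, ∃ z, T.flow z x = y) :
    ∃ (L : PlaneLattice) (η : L.Torus ≃ₘ^∞⟮𝓘(ℝ, ℂ), I⟯ M),
      ∀ c z, T.flow z (η c) = η (c + L.toTorus z) := by
  obtain ⟨x⟩ := ‹Nonempty M›
  set o : ℂ → M := fun z => T.flow z x with ho
  have hloc : IsLocalDiffeomorph 𝓘(ℝ, ℂ) I ∞ o := T.isLocalDiffeomorph_flow hE htrans x
  have hcont : Continuous o := hloc.contMDiff.continuous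
  have hsurj : Surjective o := fun y => htrans x y
  have hopen : IsOpenMap o := hloc.isOpenMap
  set Λ : Submodule ℤ ℂ := AddSubgroup.toIntSubmodule (T.isotropy x) with hΛ
  have hmem : ∀ z, z ∈ Λ ↔ o z = x := fun z => Iff.rfl
  have heq : ∀ z w, o z = o w ↔ z - w ∈ Λ := by
    intro z w
    rw [hmem]
    constructor
    · intro h
      change T.flow (z - w) x = x
      rw [sub_eq_neg_add, T.flow_add]
      change T.flow (-w) (o z) = x
      rw [h]
      exact T.flow_neg_flow w x
    · intro h
      have : z = w + (z - w) := by ring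
      change T.flow z x = T.flow w x
      rw [this, T.flow_add]
      exact congrArg _ h
  have hdisc : DiscreteTopology Λ := by
    obtain ⟨Φ, h0, hΦ⟩ := hloc 0
    refine discreteTopology_of_isOpen_singleton_zero ?_
    -- The orbit map is injective near `0`, so no other isotropy element lies there.
    have : ({0} : Set Λ) = Subtype.val ⁻¹' Φ.source := by
      ext ⟨z, hz⟩
      simp only [mem_singleton_iff, mem_preimage]
      constructor
      · intro h
        have : z = 0 := congrArg Subtype.val h
        rw [this]; exact h0
      · intro h
        have h1 : o z = o 0 := by rw [(hmem z).1 hz]; exact (T.flow_zero x).symm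
        rw [hΦ h, hΦ h0] at h1
        exact Subtype.ext (Φ.injOn h h0 h1)
    rw [this]
    exact Φ.open_source.preimage continuous_subtype_val
  -- If the isotropy did not span, a nonzero real functional would vanish on it and descend through
  -- the orbit map to a continuous unbounded function on the compact space `M`.
  have hspan : Submodule.span ℝ (Λ : Set ℂ) = ⊤ := by
    by_contra hne
    obtain ⟨f, hf0, hf⟩ := Submodule.exists_le_ker_of_lt_top _ (lt_top_iff_ne_top.2 hne)
    have hfΛ : ∀ z ∈ Λ, f z = 0 := fun z hz => hf (Submodule.subset_span hz)
    have hfc : Continuous f := f.continuous_of_finiteDimensional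
    have hq : Topology.IsQuotientMap o := hopen.isQuotientMap hcont hsurj
    let g : M → ℝ := fun y => f (surjInv hsurj y)
    have hg : g ∘ o = f := by
      funext z
      have h1 : o (surjInv hsurj (o z)) = o z := surjInv_eq hsurj (o z)
      have h2 := hfΛ _ ((heq _ _).1 h1)
      rw [map_sub, sub_eq_zero] at h2
      exact h2
    have hgc : Continuous g := by rw [hq.continuous_iff, hg]; exact hfc
    obtain ⟨v, hv⟩ : ∃ v, f v ≠ 0 := by
      by_contra! h
      exact hf0 (LinearMap.ext h)
    obtain ⟨C, hC⟩ := (isCompact_range hgc).bddAbove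
    have h3 : f (((C + 1) / f v) • v) ≤ C := by
      have := hC ⟨o (((C + 1) / f v) • v), rfl⟩
      rwa [← comp_apply (f := g), hg] at this
    rw [map_smul, smul_eq_mul, div_mul_cancel₀ _ hv] at h3
    linarith
  let L : PlaneLattice := ⟨Λ, hdisc, ⟨hspan⟩⟩
  have heq' : ∀ z w, o z = o w ↔ L.toTorus z = L.toTorus w := fun z w => by
    rw [heq, L.toTorus_eq_iff]
  let η₀ : L.Torus → M := fun c => o (surjInv L.surjective_toTorus c)
  have hη₀ : ∀ z, η₀ (L.toTorus z) = o z := fun z =>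
    (heq' _ _).2 (surjInv_eq L.surjective_toTorus _)
  have hbij : Bijective η₀ := by
    constructor
    · intro c d h
      obtain ⟨z, rfl⟩ := L.surjective_toTorus c
      obtain ⟨w, rfl⟩ := L.surjective_toTorus d
      rw [hη₀, hη₀] at h
      exact (heq' z w).1 h
    · intro y
      obtain ⟨z, rfl⟩ := hsurj y
      exact ⟨L.toTorus z, hη₀ z⟩
  have hη₀c : η₀ ∘ L.toTorus = o := funext hη₀
  let η : L.Torus ≃ₘ^∞⟮𝓘(ℝ, ℂ), I⟯ M :=
    { toEquiv := Equiv.ofBijective η₀ hbij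
      contMDiff_toFun := by
        apply L.contMDiff_of_comp_toTorus
        change ContMDiff 𝓘(ℝ, ℂ) I ∞ (η₀ ∘ L.toTorus)
        rw [hη₀c]
        exact hloc.contMDiff
      contMDiff_invFun := by
        intro y
        obtain ⟨z, rfl⟩ := hsurj y
        refine (L.contMDiff_toTorus.contMDiffAt.comp (o z)
          (hloc z).localInverse_contMDiffAt).congr_of_eventuallyEq ?_
        filter_upwards [(hloc z).localInverse_eventuallyEq_right] with y hy
        change (Equiv.ofBijective η₀ hbij).symm y = L.toTorus ((hloc z).localInverse y)
        rw [Equiv.symm_apply_eq]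
        change y = η₀ _
        rw [hη₀]
        exact hy.symm }
  refine ⟨L, η, fun c z => ?_⟩
  obtain ⟨w, rfl⟩ := L.surjective_toTorus c
  change T.flow z (η₀ (L.toTorus w)) = η₀ (L.toTorus w + L.toTorus z)
  rw [← L.toTorus_add, hη₀, hη₀, add_comm]
  exact (T.flow_add z w x).symm

end SmoothPlaneAction

end TransitiveActions

/-! ### Topology and dimension of genus-one surfaces -/

namespace IsGenusOneSurface

variable {E H : Type*} [NormedAddCommGroup E] [NormedSpace ℝ E] [TopologicalSpace H]
  {I : ModelWithCorners ℝ E H} {S : Type*} [TopologicalSpace S] [ChartedSpace H S]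

theorem t2Space (h : IsGenusOneSurface I S) : T2Space S := by
  obtain ⟨Φ⟩ := h
  exact Φ.toHomeomorph.symm.t2Space

theorem compactSpace (h : IsGenusOneSurface I S) : CompactSpace S := by
  obtain ⟨Φ⟩ := h
  exact Φ.toHomeomorph.symm.compactSpace

theorem nonempty (h : IsGenusOneSurface I S) : Nonempty S := by
  obtain ⟨Φ⟩ := h
  exact ⟨Φ.symm (1, 1)⟩

theorem finrank_eq_two [IsManifold I ∞ S] (h : IsGenusOneSurface I S) :
    Module.finrank ℝ E = 2 := by
  obtain ⟨x⟩ := h.nonempty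
  obtain ⟨Φ⟩ := h
  have A := Φ.mfderivToContinuousLinearEquiv (by simp) x
  have B : E ≃L[ℝ] EuclideanSpace ℝ (Fin 1) × EuclideanSpace ℝ (Fin 1) := A
  rw [B.toLinearEquiv.finrank_eq]
  simp

end IsGenusOneSurface


/-! ### Horizontal curves and orbits of a frame -/

section HorizontalCurves

open Set Metric Filter Function

namespace SmoothPlaneAction

variable {E H : Type*} [NormedAddCommGroup E] [NormedSpace ℝ E] [TopologicalSpace H]
  {I : ModelWithCorners ℝ E H} {M : Type*} [TopologicalSpace M] [ChartedSpace H M]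
  (T : SmoothPlaneAction I M)

theorem hasMFDerivAt_flow_uncurry (z : ℂ) (q : M) :
    HasMFDerivAt (𝓘(ℝ, ℂ).prod I) I (fun x : ℂ × M => T.flow x.1 x.2) (z, q)
      (mfderiv (𝓘(ℝ, ℂ).prod I) I (fun x : ℂ × M => T.flow x.1 x.2) (z, q)) :=
  (T.contMDiff_flow.mdifferentiable (by simp) (z, q)).hasMFDerivAt

/-- Moving along an orbit and backwards in time at the same speed, one stays in place. -/
theorem mfderiv_flow_neg_gen (z : ℂ) (q : M) (w : ℂ) :
    mfderiv (𝓘(ℝ, ℂ).prod I) I (fun x : ℂ × M => T.flow x.1 x.2) (z, q)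
      ((-w, T.gen q w) : ℂ × E) = (0 : E) := by
  have h1 : HasMFDerivAt 𝓘(ℝ, ℂ) 𝓘(ℝ, ℂ) (fun τ : ℂ => z - τ) 0 (-ContinuousLinearMap.id ℝ ℂ) :=
    ((hasFDerivAt_id (0 : ℂ)).const_sub z).hasMFDerivAt
  have h2 := T.hasMFDerivAt_flow 0 q
  have h3 := h1.prodMk h2
  have h4 : HasMFDerivAt (𝓘(ℝ, ℂ).prod I) I (fun x : ℂ × M => T.flow x.1 x.2)
      (z - 0, T.flow 0 q)
      (mfderiv (𝓘(ℝ, ℂ).prod I) I (fun x : ℂ × M => T.flow x.1 x.2) (z, q)) := by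
    rw [sub_zero, T.flow_zero]
    exact T.hasMFDerivAt_flow_uncurry z q
  have h5 := HasMFDerivAt.comp (f := fun τ : ℂ => (z - τ, T.flow τ q)) 0 h4 h3
  have e : ((fun x : ℂ × M => T.flow x.1 x.2) ∘ fun τ : ℂ => (z - τ, T.flow τ q)) =
      fun _ => T.flow z q := by
    funext τ
    simp only [comp_apply]
    rw [← T.flow_add, sub_add_cancel]
  rw [e] at h5
  have h6 := hasMFDerivAt_unique h5 (hasMFDerivAt_const (T.flow z q) (0 : ℂ))
  have h7 := congrArg (fun A : ℂ →L[ℝ] E => A w) h6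
  change mfderiv (𝓘(ℝ, ℂ).prod I) I (fun x : ℂ × M => T.flow x.1 x.2) (z, q)
      ((-w, T.gen (T.flow 0 q) w) : ℂ × E) = (0 : E) at h7
  rwa [T.flow_zero] at h7

end SmoothPlaneAction

/-- The covering `ℂ → ℂ / Λ` provides a continuous lift. It is smooth because near each parameter it
is the composition of `c` with a smooth local inverse of the projection. -/
theorem PlaneLattice.exists_contDiffOn_lift (L : PlaneLattice) {c : ℝ → L.Torus}
    (hc : ContMDiffOn 𝓘(ℝ, ℝ) 𝓘(ℝ, ℂ) ∞ c (Icc 0 1)) :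
    ∃ a : ℝ → ℂ, ContDiffOn ℝ ∞ a (Icc 0 1) ∧ ∀ t ∈ Icc (0 : ℝ) 1, L.toTorus (a t) = c t := by
  have hdisc : IsDiscrete (L.toAddSubgroup : Set ℂ) := ⟨L.discrete⟩
  have hcov : IsCoveringMap L.toTorus :=
    (L.toAddSubgroup.isAddQuotientCoveringMap_of_comm hdisc).isCoveringMap
  let c₀ : C(unitInterval, L.Torus) := ⟨fun t => c t, hc.continuousOn.domRestrict⟩
  obtain ⟨z₀, hz₀⟩ := L.surjective_toTorus (c₀ 0)
  let a₀ := hcov.liftPath c₀ z₀ hz₀.symm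
  have ha₀ : ∀ t, L.toTorus (a₀ t) = c₀ t := fun t =>
    congrFun (hcov.liftPath_lifts c₀ z₀ hz₀.symm) t
  let a : ℝ → ℂ := fun t => a₀ (projIcc 0 1 zero_le_one t)
  have hac : Continuous a := a₀.continuous.comp continuous_projIcc
  have hlift : ∀ t ∈ Icc (0 : ℝ) 1, L.toTorus (a t) = c t := by
    intro t ht
    change L.toTorus (a₀ (projIcc 0 1 zero_le_one t)) = c t
    rw [ha₀, projIcc_of_mem _ ht]
    rfl
  refine ⟨a, fun t ht => ?_, hlift⟩
  obtain ⟨Φ, h0, hΦ⟩ := L.isLocalDiffeomorph_toTorus (a t)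
  have hmem : c t ∈ Φ.target := by
    rw [← hlift t ht, hΦ h0]
    exact Φ.map_source h0
  have h1 : ContMDiffWithinAt 𝓘(ℝ, ℝ) 𝓘(ℝ, ℂ) ∞ (Φ.symm ∘ c) (Icc 0 1) t :=
    ContMDiffAt.comp_contMDiffWithinAt t
      (Φ.contMDiffOn_invFun.contMDiffAt (Φ.open_target.mem_nhds hmem)) (hc t ht)
  rw [contMDiffWithinAt_iff_contDiffWithinAt] at h1
  have hev : ∀ t' ∈ Icc (0 : ℝ) 1, a t' ∈ Φ.source → a t' = (Φ.symm ∘ c) t' := by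
    intro t' ht' hs
    rw [comp_apply, ← hlift t' ht', hΦ hs]
    exact (Φ.left_inv hs).symm
  refine h1.congr_of_eventuallyEq ?_ (hev t ht h0)
  filter_upwards [self_mem_nhdsWithin,
    mem_nhdsWithin_of_mem_nhds (hac.continuousAt.preimage_mem_nhds (Φ.open_source.mem_nhds h0))]
    with t' ht' hs using hev t' ht' hs

variable {EG HG EP HP ES HS : Type*}
  [NormedAddCommGroup EG] [NormedSpace ℝ EG] [TopologicalSpace HG]
  [NormedAddCommGroup EP] [NormedSpace ℝ EP] [TopologicalSpace HP]
  [NormedAddCommGroup ES] [NormedSpace ℝ ES] [TopologicalSpace HS]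
  {IG : ModelWithCorners ℝ EG HG} {IP : ModelWithCorners ℝ EP HP}
  {IS : ModelWithCorners ℝ ES HS}
  {G : Type*} [TopologicalSpace G] [ChartedSpace HG G] [Group G]
  {P : Type*} [TopologicalSpace P] [ChartedSpace HP P]
  {S : Type*} [TopologicalSpace S] [ChartedSpace HS S]
  {Q : SmoothPrincipalBundle IG IP IS G P S}

theorem PrincipalConnection.eq_of_mfderiv_proj_eq [IsManifold IP ∞ P] (ν : PrincipalConnection Q)
    {p : P} {u v : TangentSpace IP p} (hu : u ∈ ν.hor p) (hv : v ∈ ν.hor p)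
    (h : mfderiv IP IS Q.proj p u = mfderiv IP IS Q.proj p v) : u = v := by
  have h1 : u - v ∈ ν.hor p := sub_mem hu hv
  have h2 : u - v ∈ LinearMap.ker (mfderiv IP IS Q.proj p).toLinearMap := by
    rw [LinearMap.mem_ker]
    change mfderiv IP IS Q.proj p (u - v) = 0
    rw [map_sub, h, sub_self]
  have h3 := (Submodule.disjoint_def.1 (ν.isCompl p).disjoint) _ h1 h2
  exact sub_eq_zero.1 h3

namespace Frame

variable (γ : Frame Q)
  {L : PlaneLattice} {η : L.Torus ≃ₘ^∞⟮𝓘(ℝ, ℂ), IS⟯ S}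

theorem contMDiff_marking_toTorus (η : L.Torus ≃ₘ^∞⟮𝓘(ℝ, ℂ), IS⟯ S) :
    ContMDiff 𝓘(ℝ, ℂ) IS ∞ fun z => η (L.toTorus z) :=
  η.contMDiff.comp L.contMDiff_toTorus

theorem proj_total_eq_of_base_eq (hη : ∀ c z, γ.base z (η c) = η (c + L.toTorus z)) {p : P} {w : ℂ}
    (hp : Q.proj p = η (L.toTorus w)) (z : ℂ) : Q.proj (γ.total z p) = η (L.toTorus (w + z)) := by
  rw [γ.proj_total, hp, hη, L.toTorus_add]

variable [FiniteDimensional ℝ EP] [IP.Boundaryless] [IsManifold IP ∞ P]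

/-- The projection of an orbit in `P` is `z ↦ η [w + z]`, so the generators on `P` lie over the
constant vector fields of the marked torus. -/
theorem mfderiv_proj_gen (hη : ∀ c z, γ.base z (η c) = η (c + L.toTorus z)) {p : P} {w : ℂ}
    (hp : Q.proj p = η (L.toTorus w)) (v : ℂ) :
    mfderiv IP IS Q.proj p (γ.totalAction.gen p v) =
      (mfderiv 𝓘(ℝ, ℂ) IS (fun z => η (L.toTorus z)) w v : ES) := by
  have h1 := γ.totalAction.hasMFDerivAt_flow 0 p
  have h2 : HasMFDerivAt IP IS Q.proj (γ.totalAction.flow 0 p) (mfderiv IP IS Q.proj p) := by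
    rw [γ.totalAction.flow_zero]; exact Q.hasMFDerivAt_proj p
  have h3 := h2.comp (0 : ℂ) h1
  have e : (Q.proj ∘ fun z => γ.totalAction.flow z p) =
      (fun z => η (L.toTorus z)) ∘ fun z => w + z := by
    funext z
    exact γ.proj_total_eq_of_base_eq hη hp z
  have h4 : HasMFDerivAt 𝓘(ℝ, ℂ) 𝓘(ℝ, ℂ) (fun z : ℂ => w + z) 0 (ContinuousLinearMap.id ℝ ℂ) :=
    ((hasFDerivAt_id (0 : ℂ)).const_add w).hasMFDerivAt
  have h5 : HasMFDerivAt 𝓘(ℝ, ℂ) IS (fun z => η (L.toTorus z)) (w + 0)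
      (mfderiv 𝓘(ℝ, ℂ) IS (fun z => η (L.toTorus z)) w) := by
    rw [add_zero]
    exact ((contMDiff_marking_toTorus η).mdifferentiable (by simp) w).hasMFDerivAt
  have h6 := HasMFDerivAt.comp (f := fun z : ℂ => w + z) 0 h5 h4
  rw [e] at h3
  have h7 := congrArg (fun A : ℂ →L[ℝ] ES => A v) (hasMFDerivAt_unique h3 h6)
  change mfderiv IP IS Q.proj p (γ.totalAction.gen (γ.totalAction.flow 0 p) v) =
    (mfderiv 𝓘(ℝ, ℂ) IS (fun z => η (L.toTorus z)) w v : ES) at h7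
  rwa [γ.totalAction.flow_zero] at h7

variable {ν : PrincipalConnection Q}

theorem isHorizontalLift_total (hη : ∀ c z, γ.base z (η c) = η (c + L.toTorus z))
    (hν : ∀ p v, γ.totalAction.gen p v ∈ ν.hor p) {α : ℝ → S} {a : ℝ → ℂ}
    (ha : ContDiffOn ℝ ∞ a (Icc 0 1)) (hα : ∀ t ∈ Icc (0 : ℝ) 1, η (L.toTorus (a t)) = α t)
    {p : P} (hp : Q.proj p = α 0) : ν.IsHorizontalLift α fun t => γ.total (a t - a 0) p := by
  have ha' : ContDiffOn ℝ ∞ (fun t => a t - a 0) (Icc 0 1) := ha.sub contDiffOn_const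
  refine ⟨?_, fun t ht => ?_, fun t ht => ?_⟩
  · exact (γ.totalAction.contMDiff_flow_left p).comp_contMDiffOn ha'.contMDiffOn
  · rw [γ.proj_total_eq_of_base_eq hη (w := a 0), add_sub_cancel, hα t ht]
    rw [hp, hα 0 (by simp)]
  · have h1 : HasFDerivWithinAt (fun t => a t - a 0) (fderivWithin ℝ (fun t => a t - a 0) (Icc 0 1) t)
        (Icc 0 1) t := ((ha'.differentiableOn (by simp)) t ht).hasFDerivWithinAt
    have h2 := (γ.totalAction.hasMFDerivAt_flow (a t - a 0) p).comp_hasMFDerivWithinAt t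
      h1.hasMFDerivWithinAt
    have hu : UniqueMDiffWithinAt 𝓘(ℝ, ℝ) (Icc (0 : ℝ) 1) t :=
      (uniqueDiffOn_Icc zero_lt_one t ht).uniqueMDiffWithinAt
    have h3 := h2.mfderivWithin hu
    change (mfderivWithin 𝓘(ℝ, ℝ) IP ((fun w => γ.totalAction.flow w p) ∘ fun t => a t - a 0)
      (Icc 0 1) t) (1 : ℝ) ∈ ν.hor (γ.total (a t - a 0) p)
    rw [h3]
    exact hν _ _

/-- The velocity of `β` and the generator in direction `a' t` are both horizontal and have the same
projection, hence agree. Moving `β t` back by `-(a t - a 0)` then gives a curve with zero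
derivative, which is constant; this replaces a uniqueness theorem for the lifting equation. -/
theorem eq_total_of_isHorizontalLift (hη : ∀ c z, γ.base z (η c) = η (c + L.toTorus z))
    (hν : ∀ p v, γ.totalAction.gen p v ∈ ν.hor p) {α : ℝ → S} {a : ℝ → ℂ}
    (ha : ContDiffOn ℝ ∞ a (Icc 0 1)) (hα : ∀ t ∈ Icc (0 : ℝ) 1, η (L.toTorus (a t)) = α t)
    {β : ℝ → P} (hβ : ν.IsHorizontalLift α β) {t : ℝ} (ht : t ∈ Icc (0 : ℝ) 1) :
    β t = γ.total (a t - a 0) (β 0) := by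
  obtain ⟨hβs, hβp, hβh⟩ := hβ
  set T := γ.totalAction with hT
  obtain ⟨a', ha'⟩ : ∃ a' : ℝ → ℝ →L[ℝ] ℂ, ∀ t ∈ Icc (0 : ℝ) 1,
      HasFDerivWithinAt a (a' t) (Icc (0 : ℝ) 1) t :=
    ⟨fderivWithin ℝ a (Icc (0 : ℝ) 1), fun t ht =>
      (ha.differentiableOn (by simp) t ht).hasFDerivWithinAt⟩
  have hder : ∀ t ∈ Icc (0 : ℝ) 1, mfderivWithin 𝓘(ℝ, ℝ) IP β (Icc (0 : ℝ) 1) t (1 : ℝ) =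
      T.gen (β t) (a' t (1 : ℝ)) := by
    intro t ht
    have hu : UniqueMDiffWithinAt 𝓘(ℝ, ℝ) (Icc (0 : ℝ) 1) t :=
      (uniqueDiffOn_Icc zero_lt_one t ht).uniqueMDiffWithinAt
    refine ν.eq_of_mfderiv_proj_eq (hβh t ht) (hν _ _) ?_
    have hpt : Q.proj (β t) = η (L.toTorus (a t)) := by rw [hβp t ht, hα t ht]
    refine Eq.trans ?_ (γ.mfderiv_proj_gen hη hpt _).symm
    have d1 : HasMFDerivWithinAt 𝓘(ℝ, ℝ) IP β (Icc (0 : ℝ) 1) t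
        (mfderivWithin 𝓘(ℝ, ℝ) IP β (Icc (0 : ℝ) 1) t) :=
      ((hβs t ht).mdifferentiableWithinAt (by simp)).hasMFDerivWithinAt
    have d2 := (Q.hasMFDerivAt_proj (β t)).comp_hasMFDerivWithinAt t d1
    have d3 : HasMFDerivWithinAt 𝓘(ℝ, ℝ) 𝓘(ℝ, ℂ) a (Icc 0 1) t (a' t) :=
      (ha' t ht).hasMFDerivWithinAt
    have d4 : HasMFDerivAt 𝓘(ℝ, ℂ) IS (fun z => η (L.toTorus z)) (a t)
        (mfderiv 𝓘(ℝ, ℂ) IS (fun z => η (L.toTorus z)) (a t)) :=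
      ((contMDiff_marking_toTorus η).mdifferentiable (by simp) (a t)).hasMFDerivAt
    have d5 := d4.comp_hasMFDerivWithinAt t d3
    have d6 : HasMFDerivWithinAt 𝓘(ℝ, ℝ) IS (Q.proj ∘ β) (Icc 0 1) t
        ((mfderiv 𝓘(ℝ, ℂ) IS (fun z => η (L.toTorus z)) (a t)).comp
          (a' t)) := by
      refine d5.congr_of_eventuallyEq ?_ ?_
      · filter_upwards [self_mem_nhdsWithin] with t' ht'
        rw [comp_apply, comp_apply, hβp t' ht', hα t' ht']
      · rw [comp_apply, comp_apply, hpt]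
    have d7 := (d2.mfderivWithin hu).symm.trans (d6.mfderivWithin hu)
    exact congrArg (fun A : ℝ →L[ℝ] ES => A 1) d7
  have hconst : ∀ t ∈ Icc (0 : ℝ) 1, HasMFDerivWithinAt 𝓘(ℝ, ℝ) IP
      (fun t => T.flow (-(a t - a 0)) (β t)) (Icc 0 1) t 0 := by
    intro t ht
    have d1 : HasMFDerivWithinAt 𝓘(ℝ, ℝ) IP β (Icc (0 : ℝ) 1) t
        (mfderivWithin 𝓘(ℝ, ℝ) IP β (Icc (0 : ℝ) 1) t) :=
      ((hβs t ht).mdifferentiableWithinAt (by simp)).hasMFDerivWithinAt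
    have d3 : HasMFDerivWithinAt 𝓘(ℝ, ℝ) 𝓘(ℝ, ℂ) (fun t => -(a t - a 0)) (Icc 0 1) t
        (-a' t) :=
      ((ha' t ht).sub_const (a 0)).neg.hasMFDerivWithinAt
    have d4 := (T.hasMFDerivAt_flow_uncurry (-(a t - a 0)) (β t)).comp_hasMFDerivWithinAt
      (f := fun t => (-(a t - a 0), β t)) t (d3.prodMk d1)
    refine d4.congr_mfderiv ?_
    -- The contributions of the moving point `β t` and of the moving parameter `-(a t - a 0)` to the
    -- velocity cancel.
    have h0 := T.mfderiv_flow_neg_gen (-(a t - a 0)) (β t) (a' t 1)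
    rw [← hder t ht] at h0
    refine ContinuousLinearMap.ext_ring ?_
    exact h0
  have h1 := eq_of_hasMFDerivWithinAt_zero (I := IP) (convex_Icc (0 : ℝ) 1) hconst ht
    (by simp : (0 : ℝ) ∈ Icc (0 : ℝ) 1)
  simp only [sub_self, neg_zero, T.flow_zero] at h1
  have h2 : T.flow (a t - a 0) (T.flow (-(a t - a 0)) (β t)) = T.flow (a t - a 0) (β 0) := by
    rw [h1]
  rw [← T.flow_add, add_neg_cancel, T.flow_zero] at h2
  exact h2

/-- A frame corresponds to the geometric data `(Λ, η, ν)` as soon as `η` intertwines the action on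
the base with translations and the orbits of the action on the total space are horizontal. -/
theorem correspondsTo_of_gen_mem {ν : FlatConnection Q}
    (hη : ∀ c z, γ.base z (η c) = η (c + L.toTorus z))
    (hν : ∀ p v, γ.totalAction.gen p v ∈ ν.hor p) : γ.CorrespondsTo L η ν := by
  have htr : ∀ (α : ℝ → S) (a : ℝ → ℂ), ContDiffOn ℝ ∞ a (Icc 0 1) →
      (∀ t ∈ Icc (0 : ℝ) 1, η (L.toTorus (a t)) = α t) →
      ∀ p q : P, Q.proj p = α 0 → (ν.Transports α p q ↔ q = γ.total (a 1 - a 0) p) := by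
    intro α a ha hα p q hp
    constructor
    · rintro ⟨β, hβ, rfl, rfl⟩
      exact γ.eq_total_of_isHorizontalLift hη hν ha hα hβ (by simp)
    · rintro rfl
      refine ⟨_, γ.isHorizontalLift_total hη hν ha hα hp, ?_, rfl⟩
      simp only [sub_self]
      exact γ.total_zero p
  refine ⟨fun x z => ?_, hη, fun α hα => ?_, htr, fun z p a ha h0 h1 q => ?_⟩
  · obtain ⟨c, rfl⟩ : ∃ c, η c = x := ⟨η.symm x, η.apply_symm_apply x⟩
    rw [hη, ← L.toTorus_eq_zero_iff, (EquivLike.injective η).eq_iff, add_eq_left]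
  · have hc : ContMDiffOn 𝓘(ℝ, ℝ) 𝓘(ℝ, ℂ) ∞ (fun t => η.symm (α t)) (Icc 0 1) :=
      η.symm.contMDiff.comp_contMDiffOn hα
    obtain ⟨a, ha, hac⟩ := L.exists_contDiffOn_lift hc
    exact ⟨a, ha, fun t ht => by rw [hac t ht, η.apply_symm_apply]⟩
  · obtain ⟨w, hw⟩ := L.surjective_toTorus (η.symm (Q.proj p))
    have := htr (fun t => η (η.symm (Q.proj p) + L.toTorus (a t))) (fun t => w + a t)
      (contDiffOn_const.add ha) (fun t _ => by rw [L.toTorus_add, hw]) p q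
      (by rw [h0, L.toTorus_zero, add_zero, η.apply_symm_apply])
    rw [this, h0, h1]
    simp

end Frame

end HorizontalCurves


/-! ### Vector fields in a chart -/

section ChartFields

open Set Metric Filter Function VectorField

variable {E H : Type*} [NormedAddCommGroup E] [NormedSpace ℝ E] [TopologicalSpace H]
  {I : ModelWithCorners ℝ E H} {M : Type*} [TopologicalSpace M] [ChartedSpace H M]

/-- The representation of a vector field in the preferred chart at `x`. -/
noncomputable def chartField (I : ModelWithCorners ℝ E H) (x : M) (X : ∀ p : M, TangentSpace I p)
    (y : E) : E :=
  mfderiv I 𝓘(ℝ, E) (extChartAt I x) ((extChartAt I x).symm y) (X ((extChartAt I x).symm y))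

theorem isOpen_extChartAt_target_inter_preimage [I.Boundaryless] (x : M) {U : Set M}
    (hU : IsOpen U) : IsOpen ((extChartAt I x).target ∩ (extChartAt I x).symm ⁻¹' U) :=
  (continuousOn_extChartAt_symm x).isOpen_inter_preimage (isOpen_extChartAt_target x) hU

variable [IsManifold I ∞ M]

theorem hasMFDerivAt_extChartAt_of_mem {x p : M} (hp : p ∈ (extChartAt I x).source) :
    HasMFDerivAt I 𝓘(ℝ, E) (extChartAt I x) p (mfderiv I 𝓘(ℝ, E) (extChartAt I x) p) := by
  have : IsManifold I 1 M := .of_le (n := ∞) (by norm_cast)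
  exact (mdifferentiableAt_extChartAt (by simpa using hp)).hasMFDerivAt

theorem IsSmoothVectorFieldOn.mono {X : ∀ p : M, TangentSpace I p} {U V : Set M}
    (hX : IsSmoothVectorFieldOn X U) (hV : IsOpen V) (hVU : V ⊆ U) : IsSmoothVectorFieldOn X V :=
  ⟨hV, hX.2.mono hVU⟩

theorem ContMDiffOn.contDiffOn_comp_extChartAt_symm {V : Type*} [NormedAddCommGroup V]
    [NormedSpace ℝ V] {f : M → V} {U : Set M} (hf : ContMDiffOn I 𝓘(ℝ, V) ∞ f U) (x : M) :
    ContDiffOn ℝ ∞ (f ∘ (extChartAt I x).symm)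
      ((extChartAt I x).target ∩ (extChartAt I x).symm ⁻¹' U) := by
  rw [← contMDiffOn_iff_contDiffOn]
  exact hf.comp ((contMDiffOn_extChartAt_symm x).mono inter_subset_left) inter_subset_right

variable [I.Boundaryless]

theorem mfderiv_symm_mfderiv_extChartAt {x : M} {y : E} (hy : y ∈ (extChartAt I x).target) (v : E) :
    (mfderiv 𝓘(ℝ, E) I (extChartAt I x).symm y
      (mfderiv I 𝓘(ℝ, E) (extChartAt I x) ((extChartAt I x).symm y) v : E) : E) = v := by
  have : IsManifold I 1 M := .of_le (n := ∞) (by norm_cast)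
  have h := mfderivWithin_extChartAt_symm_comp_mfderiv_extChartAt (I := I) hy
  rw [I.range_eq_univ, mfderivWithin_univ] at h
  exact congrArg (fun A : E →L[ℝ] E => A v) h

theorem hasMFDerivAt_extChartAt_symm_of_mem {x : M} {y : E} (hy : y ∈ (extChartAt I x).target) :
    HasMFDerivAt 𝓘(ℝ, E) I (extChartAt I x).symm y
      (mfderiv 𝓘(ℝ, E) I (extChartAt I x).symm y) :=
  ((contMDiffAt_extChartAt_symm_of_boundaryless hy).mdifferentiableAt (by simp)).hasMFDerivAt

theorem mpullback_extChartAt_symm_eq {x : M} (X : ∀ p : M, TangentSpace I p) {y : E}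
    (hy : y ∈ (extChartAt I x).target) :
    mpullback 𝓘(ℝ, E) I (extChartAt I x).symm X y = chartField I x X y := by
  exact ((isInvertible_mfderiv_extChartAt_symm_of_boundaryless hy).inverse_apply_eq).2
    (mfderiv_symm_mfderiv_extChartAt hy (X ((extChartAt I x).symm y))).symm

theorem IsSmoothVectorFieldOn.contDiffOn_chartField {X : ∀ p : M, TangentSpace I p} {U : Set M}
    (hX : IsSmoothVectorFieldOn X U) (x : M) :
    ContDiffOn ℝ ∞ (chartField I x X)
      ((extChartAt I x).target ∩ (extChartAt I x).symm ⁻¹' U) := by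
  intro y hy
  have hopen := isOpen_extChartAt_target_inter_preimage (I := I) x hX.1
  have h1 : ContMDiffOn I.tangent (𝓘(ℝ, E)).tangent ∞
      (tangentMapWithin I 𝓘(ℝ, E) (extChartAt I x) (extChartAt I x).source)
      (Bundle.TotalSpace.proj ⁻¹' (extChartAt I x).source) :=
    ((contMDiffOn_extChartAt (n := ∞) (I := I) (x := x)).mono
      (by rw [extChartAt_source])).contMDiffOn_tangentMapWithin (by simp)
      (isOpen_extChartAt_source x).uniqueMDiffOn
  have h2 : ContMDiffOn 𝓘(ℝ, E) I.tangent ∞ (fun y => (⟨(extChartAt I x).symm y,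
      X ((extChartAt I x).symm y)⟩ : TangentBundle I M))
      ((extChartAt I x).target ∩ (extChartAt I x).symm ⁻¹' U) :=
    hX.2.comp ((contMDiffOn_extChartAt_symm x).mono inter_subset_left) inter_subset_right
  have h3 := h1.comp h2 (fun y hy => (extChartAt I x).map_target hy.1)
  have h4 := (contMDiff_snd_tangentBundle_modelSpace E 𝓘(ℝ, E)).comp_contMDiffOn h3
  rw [contMDiffOn_iff_contDiffOn] at h4
  have h5 : ∀ y' ∈ (extChartAt I x).target ∩ (extChartAt I x).symm ⁻¹' U, chartField I x X y' =
      ((fun p : TangentBundle 𝓘(ℝ, E) E => p.2) ∘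
        tangentMapWithin I 𝓘(ℝ, E) (extChartAt I x) (extChartAt I x).source ∘
        fun y => (⟨(extChartAt I x).symm y, X ((extChartAt I x).symm y)⟩ : TangentBundle I M)) y' :=
    fun y' hy' => congrArg (fun A : E →L[ℝ] E => A (X ((extChartAt I x).symm y')))
      (mfderivWithin_of_isOpen (f := extChartAt I x) (isOpen_extChartAt_source x)
        ((extChartAt I x).map_target hy'.1)).symm
  exact (h4 y hy).congr h5 (h5 y hy)

theorem mlieBracket_modelSpace (X Y : E → E) (y : E) :
    mlieBracket 𝓘(ℝ, E) X Y y = lieBracket ℝ X Y y := by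
  rw [← lieBracketWithin_univ]
  exact congrFun (mlieBracketWithin_eq_lieBracketWithin (s := univ)) y

/-- Naturality of the bracket under pullback by the inverse chart; it reduces bracket computations
on the manifold to the formula in a vector space. -/
theorem mfderiv_extChartAt_mlieBracket [CompleteSpace E] {X Y : ∀ p : M, TangentSpace I p}
    {U : Set M} (hX : IsSmoothVectorFieldOn X U) (hY : IsSmoothVectorFieldOn Y U) {x : M} {y : E}
    (hy : y ∈ (extChartAt I x).target) (hyU : (extChartAt I x).symm y ∈ U) :
    chartField I x (mlieBracket I X Y) y =
      lieBracket ℝ (chartField I x X) (chartField I x Y) y := by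
  have hd : ∀ {Z : ∀ p : M, TangentSpace I p}, IsSmoothVectorFieldOn Z U →
      MDifferentiableAt I I.tangent (fun p => (⟨p, Z p⟩ : TangentBundle I M))
        ((extChartAt I x).symm y) := fun hZ =>
    (hZ.2.contMDiffAt (hZ.1.mem_nhds hyU)).mdifferentiableAt (by simp)
  have h2 : IsManifold I (minSmoothness ℝ 3) M := by
    rw [minSmoothness_of_isRCLikeNormedField]
    exact .of_le (n := ∞) (by norm_cast)
  have := mpullback_mlieBracket (n := ∞) (hd hX) (hd hY)
    (contMDiffAt_extChartAt_symm_of_boundaryless hy)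
    (by rw [minSmoothness_of_isRCLikeNormedField]; norm_cast)
  rw [mpullback_extChartAt_symm_eq _ hy] at this
  rw [this]
  obtain ⟨X', hX'⟩ : ∃ X' : E → E, X' = mpullback 𝓘(ℝ, E) I (extChartAt I x).symm X := ⟨_, rfl⟩
  obtain ⟨Y', hY'⟩ : ∃ Y' : E → E, Y' = mpullback 𝓘(ℝ, E) I (extChartAt I x).symm Y := ⟨_, rfl⟩
  rw [← hX', ← hY']
  have hb : lieBracket ℝ X' Y' y = lieBracket ℝ (chartField I x X) (chartField I x Y) y := by
    refine Filter.EventuallyEq.lieBracket_vectorField_eq ?_ ?_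
    all_goals
      subst hX' hY'
      filter_upwards [(isOpen_extChartAt_target (I := I) x).mem_nhds hy] with y' hy'
      exact mpullback_extChartAt_symm_eq _ hy'
  exact (mlieBracket_modelSpace X' Y' y).trans hb

theorem fderiv_comp_extChartAt_symm {V : Type*} [NormedAddCommGroup V]
    [NormedSpace ℝ V] {f : M → V} {x : M} {y : E} (hy : y ∈ (extChartAt I x).target)
    (hf : MDifferentiableAt I 𝓘(ℝ, V) f ((extChartAt I x).symm y))
    (X : ∀ p : M, TangentSpace I p) :
    fderiv ℝ (f ∘ (extChartAt I x).symm) y (chartField I x X y) =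
      (mfderiv I 𝓘(ℝ, V) f ((extChartAt I x).symm y) (X ((extChartAt I x).symm y)) : V) := by
  obtain ⟨A, hA⟩ : ∃ A : E →L[ℝ] V, A = mfderiv I 𝓘(ℝ, V) f ((extChartAt I x).symm y) := ⟨_, rfl⟩
  obtain ⟨B, hB⟩ : ∃ B : E →L[ℝ] E, B = mfderiv 𝓘(ℝ, E) I (extChartAt I x).symm y := ⟨_, rfl⟩
  have h : HasFDerivAt (f ∘ (extChartAt I x).symm) (A.comp B) y := by
    subst hA hB
    exact (hf.hasMFDerivAt.comp y (hasMFDerivAt_extChartAt_symm_of_mem hy)).hasFDerivAt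
  have h1 : B (chartField I x X y) = X ((extChartAt I x).symm y) := by
    subst hB
    exact mfderiv_symm_mfderiv_extChartAt hy (X ((extChartAt I x).symm y))
  have h2 : A (B (chartField I x X y)) = A (X ((extChartAt I x).symm y)) := by rw [h1]
  have h3 : fderiv ℝ (f ∘ (extChartAt I x).symm) y (chartField I x X y) =
      A (B (chartField I x X y)) := by rw [h.fderiv]; rfl
  rw [h3, h2, hA]
  rfl

/-- If a function has constant derivative along two vector fields, then its derivative along their
bracket vanishes. -/
theorem mfderiv_mlieBracket_eq_zero [CompleteSpace E] {V : Type*} [NormedAddCommGroup V]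
    [NormedSpace ℝ V] {X Y : ∀ p : M, TangentSpace I p} {U : Set M}
    (hX : IsSmoothVectorFieldOn X U) (hY : IsSmoothVectorFieldOn Y U) {f : M → V}
    (hf : ContMDiffOn I 𝓘(ℝ, V) ∞ f U) {a b : V}
    (ha : ∀ p ∈ U, mfderiv I 𝓘(ℝ, V) f p (X p) = a) (hb : ∀ p ∈ U, mfderiv I 𝓘(ℝ, V) f p (Y p) = b)
    {p : M} (hp : p ∈ U) : (mfderiv I 𝓘(ℝ, V) f p (mlieBracket I X Y p) : V) = 0 := by
  have hy : extChartAt I p p ∈ (extChartAt I p).target := mem_extChartAt_target p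
  have hsymm : (extChartAt I p).symm (extChartAt I p p) = p := extChartAt_to_inv p
  have hyU : (extChartAt I p).symm (extChartAt I p p) ∈ U := by rw [hsymm]; exact hp
  have hopen := isOpen_extChartAt_target_inter_preimage (I := I) p hX.1
  have hN := hopen.mem_nhds ⟨hy, hyU⟩
  have hdf : ∀ q ∈ U, MDifferentiableAt I 𝓘(ℝ, V) f q := fun q hq =>
    (hf.contMDiffAt (hX.1.mem_nhds hq)).mdifferentiableAt (by simp)
  have key := fderiv_comp_extChartAt_symm hy (hdf _ hyU) (mlieBracket I X Y)
  rw [mfderiv_extChartAt_mlieBracket hX hY hy hyU] at key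
  have hcf : ContDiffAt ℝ ∞ (f ∘ (extChartAt I p).symm) (extChartAt I p p) :=
    (hf.contDiffOn_comp_extChartAt_symm p).contDiffAt hN
  have hXd : DifferentiableAt ℝ (chartField I p X) (extChartAt I p p) :=
    ((hX.contDiffOn_chartField p).contDiffAt hN).differentiableAt (by simp)
  have hYd : DifferentiableAt ℝ (chartField I p Y) (extChartAt I p p) :=
    ((hY.contDiffOn_chartField p).contDiffAt hN).differentiableAt (by simp)
  -- The derivative along a bracket is the commutator of the two derivatives. Each inner derivative
  -- is constant near the point, so both terms vanish.
  have h1 := fderiv_apply_lieBracket (𝕜 := ℝ) hcf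
    (by rw [minSmoothness_of_isRCLikeNormedField]; norm_cast) hYd hXd
  change (_ : V) = _ at key
  rw [h1] at key
  have hc : ∀ (Z : ∀ p : M, TangentSpace I p) (c : V),
      (∀ p ∈ U, mfderiv I 𝓘(ℝ, V) f p (Z p) = c) →
      (fun y => fderiv ℝ (f ∘ (extChartAt I p).symm) y (chartField I p Z y)) =ᶠ[𝓝 (extChartAt I p p)] fun _ => c := by
    intro Z c hZ
    filter_upwards [hN] with y hy'
    rw [fderiv_comp_extChartAt_symm hy'.1 (hdf _ hy'.2) Z]
    exact hZ _ hy'.2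
  rw [(hc Y b hb).fderiv_eq, (hc X a ha).fderiv_eq] at key
  simp only [fderiv_fun_const, Pi.zero_apply, zero_apply, sub_self] at key
  rw [hsymm] at key
  exact key.symm

end ChartFields


/-! ### The generators of a plane action -/

section Generators

open Set Metric Filter Function VectorField

variable {E H : Type*} [NormedAddCommGroup E] [NormedSpace ℝ E] [TopologicalSpace H]
  {I : ModelWithCorners ℝ E H} {M : Type*} [TopologicalSpace M] [ChartedSpace H M]

/-- The representation in the preferred chart at `x` of a linear family of vector fields. -/
noncomputable def chartFieldMap (I : ModelWithCorners ℝ E H) (x : M)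
    (A : ∀ p : M, ℂ →L[ℝ] TangentSpace I p) (y : E) : ℂ →L[ℝ] E :=
  (mfderiv I 𝓘(ℝ, E) (extChartAt I x) ((extChartAt I x).symm y)).comp (A ((extChartAt I x).symm y))

/-- For constant `v` and `w` only `A` is differentiated. Commutation of the fields is therefore
exactly the symmetry required for solving `ds = A ∘ s`. -/
theorem lieBracket_chartFieldMap {A : ∀ p : M, ℂ →L[ℝ] TangentSpace I p} {x : M} {y : E}
    (hA : DifferentiableAt ℝ (chartFieldMap I x A) y) (v w : ℂ) :
    lieBracket ℝ (chartField I x fun p => A p v) (chartField I x fun p => A p w) y =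
      fderiv ℝ (chartFieldMap I x A) y (chartFieldMap I x A y v) w -
        fderiv ℝ (chartFieldMap I x A) y (chartFieldMap I x A y w) v := by
  have h : ∀ u : ℂ, HasFDerivAt (chartField I x fun p => A p u)
      ((ContinuousLinearMap.apply ℝ E u).comp (fderiv ℝ (chartFieldMap I x A) y)) y := fun u =>
    (ContinuousLinearMap.apply ℝ E u).hasFDerivAt.comp y hA.hasFDerivAt
  rw [lieBracket_eq]
  simp only [(h v).fderiv, (h w).fderiv]
  rfl

variable [IsManifold I ∞ M]

theorem hasFDerivAt_extChartAt_comp {A : ∀ p : M, ℂ →L[ℝ] TangentSpace I p} {s : ℂ → M} {z : ℂ}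
    {x : M} (hs : HasMFDerivAt 𝓘(ℝ, ℂ) I s z (A (s z))) (hz : s z ∈ (extChartAt I x).source) :
    HasFDerivAt (fun z => extChartAt I x (s z)) (chartFieldMap I x A (extChartAt I x (s z))) z := by
  have h1 := ((hasMFDerivAt_extChartAt_of_mem hz).comp z hs).hasFDerivAt
  have h2 : (chartFieldMap I x A (extChartAt I x (s z))) =
      (mfderiv I 𝓘(ℝ, E) (extChartAt I x) (s z)).comp (A (s z)) := by
    unfold chartFieldMap
    rw [(extChartAt I x).left_inv hz]
  rw [h2]
  exact h1

/-- `T.gen p v` is the image of the tangent vector `(v, 0)` at `(0, p)` under the tangent map of the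
action `ℂ × M → M`, and this vector depends smoothly on `p`. -/
theorem SmoothPlaneAction.isSmoothVectorFieldOn_gen (T : SmoothPlaneAction I M) (v : ℂ) :
    IsSmoothVectorFieldOn (fun p => T.gen p v) univ := by
  refine ⟨isOpen_univ, contMDiffOn_univ.2 ?_⟩
  have h1 : ContMDiff (𝓘(ℝ, ℂ).prod I).tangent I.tangent ∞
      (tangentMap (𝓘(ℝ, ℂ).prod I) I fun q : ℂ × M => T.flow q.1 q.2) :=
    T.contMDiff_flow.contMDiff_tangentMap (by simp)
  have h2 : ContMDiff I ((𝓘(ℝ, ℂ)).tangent.prod I.tangent) ∞ fun p : M =>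
      ((⟨(0 : ℂ), v⟩ : TangentBundle 𝓘(ℝ, ℂ) ℂ), (⟨p, (0 : TangentSpace I p)⟩ : TangentBundle I M)) :=
    contMDiff_const.prodMk (Bundle.contMDiff_zeroSection ℝ (TangentSpace I : M → Type _))
  have h3 := h1.comp (contMDiff_equivTangentBundleProd_symm.comp h2)
  refine h3.congr fun p => ?_
  have hext : ∀ (a b : M) (u w : E), a = b → u = w →
      (⟨a, u⟩ : TangentBundle I M) = ⟨b, w⟩ := by
    rintro a _ u _ rfl rfl; rfl
  refine hext _ _ _ _ (T.flow_zero p).symm ?_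
  have d1 : HasMFDerivAt 𝓘(ℝ, ℂ) (𝓘(ℝ, ℂ).prod I) (fun z : ℂ => (z, p)) 0
      ((ContinuousLinearMap.id ℝ ℂ).prod 0) :=
    (hasMFDerivAt_id (0 : ℂ)).prodMk (hasMFDerivAt_const p (0 : ℂ))
  have d2 := HasMFDerivAt.comp (f := fun z : ℂ => (z, p)) 0 (T.hasMFDerivAt_flow_uncurry 0 p) d1
  exact congrArg (fun A : ℂ →L[ℝ] E => A v) d2.mfderiv

variable [I.Boundaryless]

theorem hasMFDerivAt_extChartAt_symm_comp {A : ∀ p : M, ℂ →L[ℝ] TangentSpace I p} {s : ℂ → E}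
    {z : ℂ} {x : M} (hs : HasFDerivAt s (chartFieldMap I x A (s z)) z)
    (hz : s z ∈ (extChartAt I x).target) :
    HasMFDerivAt 𝓘(ℝ, ℂ) I (fun z => (extChartAt I x).symm (s z)) z
      (A ((extChartAt I x).symm (s z))) := by
  have h1 := (hasMFDerivAt_extChartAt_symm_of_mem hz).comp z hs.hasMFDerivAt
  refine h1.congr_mfderiv ?_
  ext v
  exact mfderiv_symm_mfderiv_extChartAt hz (A ((extChartAt I x).symm (s z)) v)

theorem contDiffOn_chartFieldMap {A : ∀ p : M, ℂ →L[ℝ] TangentSpace I p} {U : Set M}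
    (hA : ∀ v, IsSmoothVectorFieldOn (fun p => A p v) U) (x : M) :
    ContDiffOn ℝ ∞ (chartFieldMap I x A)
      ((extChartAt I x).target ∩ (extChartAt I x).symm ⁻¹' U) :=
  contDiffOn_clm_apply.2 fun v => (hA v).contDiffOn_chartField x

namespace SmoothPlaneAction

variable (T : SmoothPlaneAction I M)

/-- In the chart the orbit map has derivative `A` evaluated along itself, so its second derivative
at `0` is `(v, w) ↦ DA (A v) w`. Symmetry of second derivatives says that the generators commute. -/
theorem fderiv_chartFieldMap_gen_symm {x p : M} (hp : p ∈ (extChartAt I x).source) (v w : ℂ) :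
    fderiv ℝ (chartFieldMap I x T.gen) (extChartAt I x p)
        (chartFieldMap I x T.gen (extChartAt I x p) v) w =
      fderiv ℝ (chartFieldMap I x T.gen) (extChartAt I x p)
        (chartFieldMap I x T.gen (extChartAt I x p) w) v := by
  have hA : DifferentiableAt ℝ (chartFieldMap I x T.gen) (extChartAt I x p) :=
    ((contDiffOn_chartFieldMap T.isSmoothVectorFieldOn_gen x).contDiffAt
      ((isOpen_extChartAt_target_inter_preimage x isOpen_univ).mem_nhds
        ⟨(extChartAt I x).map_source hp, trivial⟩)).differentiableAt (by simp)
  have hev : ∀ᶠ z in 𝓝 (0 : ℂ), T.flow z p ∈ (extChartAt I x).source := by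
    refine (T.contMDiff_flow_left p).continuous.continuousAt.preimage_mem_nhds
      ((isOpen_extChartAt_source x).mem_nhds ?_)
    rwa [T.flow_zero]
  have h1 : ∀ᶠ z in 𝓝 (0 : ℂ), HasFDerivAt (fun z => extChartAt I x (T.flow z p))
      (chartFieldMap I x T.gen (extChartAt I x (T.flow z p))) z :=
    hev.mono fun z hz => hasFDerivAt_extChartAt_comp (T.hasMFDerivAt_flow z p) hz
  have h2 := h1.self_of_nhds
  have hA' := hA
  rw [← T.flow_zero p] at hA'
  have h3 := hA'.hasFDerivAt.comp (0 : ℂ) h2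
  have h4 := second_derivative_symmetric_of_eventually h1 h3 v w
  simp only [ContinuousLinearMap.comp_apply, T.flow_zero] at h4
  exact h4

/-- The distribution spanned by the generators of a plane action is involutive. -/
theorem mlieBracket_mem_range_gen [CompleteSpace E] {U : Set M} {f : M → ℂ}
    (hf : ContMDiffOn I 𝓘(ℝ, ℂ) ∞ f U)
    (hfg : ∀ p ∈ U, ∀ v, (mfderiv I 𝓘(ℝ, ℂ) f p (T.gen p v) : ℂ) = v)
    {X Y : ∀ p : M, TangentSpace I p} (hX : IsSmoothVectorFieldOn X U)
    (hY : IsSmoothVectorFieldOn Y U) (hXg : ∀ p ∈ U, ∃ v, T.gen p v = X p)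
    (hYg : ∀ p ∈ U, ∃ v, T.gen p v = Y p) {p : M} (hp : p ∈ U) :
    ∃ v, T.gen p v = mlieBracket I X Y p := by
  have hy : extChartAt I p p ∈ (extChartAt I p).target := mem_extChartAt_target p
  have hsymm : (extChartAt I p).symm (extChartAt I p p) = p := extChartAt_to_inv p
  have hyU : (extChartAt I p).symm (extChartAt I p p) ∈ U := by rw [hsymm]; exact hp
  have hN := (isOpen_extChartAt_target_inter_preimage (I := I) p hX.1).mem_nhds ⟨hy, hyU⟩
  have hdf : ∀ q ∈ U, MDifferentiableAt I 𝓘(ℝ, ℂ) f q := fun q hq =>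
    (hf.contMDiffAt (hX.1.mem_nhds hq)).mdifferentiableAt (by simp)
  set y₀ := extChartAt I p p with hy₀
  set A := chartFieldMap I p T.gen with hA
  set φ := f ∘ (extChartAt I p).symm with hφ
  have hAd : DifferentiableAt ℝ A y₀ :=
    ((contDiffOn_chartFieldMap T.isSmoothVectorFieldOn_gen p).contDiffAt
      ((isOpen_extChartAt_target_inter_preimage p isOpen_univ).mem_nhds
        ⟨hy, trivial⟩)).differentiableAt (by simp)
  have hφd : DifferentiableAt ℝ (fderiv ℝ φ) y₀ :=
    (((hf.contDiffOn_comp_extChartAt_symm p).contDiffAt hN).fderiv_right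
      (m := 1) (by norm_cast)).differentiableAt (by simp)
  -- A field tangent to the orbits is `A ζ` with coefficient `ζ = Df Z`, because `Df` inverts the
  -- generators. The coefficient is thus differentiable, and the product rule gives the derivative
  -- of the field.
  have hfield : ∀ Z : ∀ p : M, TangentSpace I p, IsSmoothVectorFieldOn Z U →
      (∀ p ∈ U, ∃ v, T.gen p v = Z p) →
      ∃ c : ℂ, ∃ D : E →L[ℝ] ℂ, chartField I p Z y₀ = A y₀ c ∧
        ∀ u, fderiv ℝ (chartField I p Z) y₀ u = A y₀ (D u) + fderiv ℝ A y₀ u c := by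
    intro Z hZ hZg
    have hZd : DifferentiableAt ℝ (chartField I p Z) y₀ :=
      ((hZ.contDiffOn_chartField p).contDiffAt hN).differentiableAt (by simp)
    set ζ : E → ℂ := fun y => fderiv ℝ φ y (chartField I p Z y) with hζ
    have hζd : DifferentiableAt ℝ ζ y₀ := hφd.clm_apply hZd
    have heq : ∀ y ∈ (extChartAt I p).target ∩ (extChartAt I p).symm ⁻¹' U,
        chartField I p Z y = A y (ζ y) := by
      rintro y ⟨hy1, hy2⟩
      obtain ⟨v, hv⟩ := hZg _ hy2
      have h1 : ζ y = v := by
        rw [hζ]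
        simp only
        rw [fderiv_comp_extChartAt_symm hy1 (hdf _ hy2) Z, ← hv]
        exact hfg _ hy2 v
      rw [h1]
      exact congrArg (fun u : E => (mfderiv I 𝓘(ℝ, E) (extChartAt I p)
        ((extChartAt I p).symm y) : E →L[ℝ] E) u) hv.symm
    have hder : HasFDerivAt (chartField I p Z)
        ((A y₀).comp (fderiv ℝ ζ y₀) + (fderiv ℝ A y₀).flip (ζ y₀)) y₀ :=
      (hAd.hasFDerivAt.clm_apply hζd.hasFDerivAt).congr_of_eventuallyEq
        (by filter_upwards [hN] with y hy' using heq y hy')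
    refine ⟨ζ y₀, fderiv ℝ ζ y₀, heq y₀ ⟨hy, hyU⟩, fun u => ?_⟩
    rw [hder.fderiv]
    rfl
  obtain ⟨a, Da, ha, hDa⟩ := hfield X hX hXg
  obtain ⟨b, Db, hb, hDb⟩ := hfield Y hY hYg
  have hbr := mfderiv_extChartAt_mlieBracket hX hY hy hyU
  rw [lieBracket_eq] at hbr
  simp only [hDa, hDb] at hbr
  -- The terms that differentiate `A` cancel by symmetry; those that differentiate the coefficients
  -- are values of `A`, that is, tangent to the orbit.
  rw [ha, hb, T.fderiv_chartFieldMap_gen_symm (mem_extChartAt_source p) a b,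
    add_sub_add_right_eq_sub, ← map_sub] at hbr
  refine ⟨Db (A y₀ a) - Da (A y₀ b), ?_⟩
  have h1 := mfderiv_symm_mfderiv_extChartAt hy
    (T.gen ((extChartAt I p).symm y₀) (Db (A y₀ a) - Da (A y₀ b)))
  have h2 := mfderiv_symm_mfderiv_extChartAt hy (mlieBracket I X Y ((extChartAt I p).symm y₀))
  have h3 := congrArg (fun u : E => (mfderiv 𝓘(ℝ, E) I (extChartAt I p).symm y₀ : E →L[ℝ] E) u) hbr
  have h4 := h1.symm.trans (h3.symm.trans h2)
  rw [hsymm] at h4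
  exact h4

end SmoothPlaneAction

end Generators


/-! ### The flat connection of a frame -/

section FrameConnection

open Set Metric Filter Function VectorField

variable {EG HG EP HP ES HS : Type*}
  [NormedAddCommGroup EG] [NormedSpace ℝ EG] [TopologicalSpace HG]
  [NormedAddCommGroup EP] [NormedSpace ℝ EP] [TopologicalSpace HP]
  [NormedAddCommGroup ES] [NormedSpace ℝ ES] [TopologicalSpace HS]
  {IG : ModelWithCorners ℝ EG HG} {IP : ModelWithCorners ℝ EP HP}
  {IS : ModelWithCorners ℝ ES HS}
  {G : Type*} [TopologicalSpace G] [ChartedSpace HG G] [Group G]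
  {P : Type*} [TopologicalSpace P] [ChartedSpace HP P]
  {S : Type*} [TopologicalSpace S] [ChartedSpace HS S]
  {Q : SmoothPrincipalBundle IG IP IS G P S} {L : PlaneLattice}

theorem isLocalDiffeomorph_marking (η : L.Torus ≃ₘ^∞⟮𝓘(ℝ, ℂ), IS⟯ S) :
    IsLocalDiffeomorph 𝓘(ℝ, ℂ) IS ∞ fun z => η (L.toTorus z) := by
  intro z
  obtain ⟨Φ, hz, hΦ⟩ := L.isLocalDiffeomorph_toTorus z
  refine ⟨⟨Φ.toPartialEquiv.transEquiv η.toEquiv, Φ.open_source,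
    Φ.open_target.preimage η.symm.continuous, η.contMDiff.comp_contMDiffOn Φ.contMDiffOn_toFun,
    Φ.contMDiffOn_invFun.comp η.symm.contMDiff.contMDiffOn fun x hx => hx⟩, hz, fun w hw => ?_⟩
  exact congrArg η (hΦ hw)

theorem bijective_mfderiv_marking (η : L.Torus ≃ₘ^∞⟮𝓘(ℝ, ℂ), IS⟯ S) (w : ℂ) :
    Bijective (mfderiv 𝓘(ℝ, ℂ) IS (fun z => η (L.toTorus z)) w) := by
  have h := (isLocalDiffeomorph_marking η w).mfderivToContinuousLinearEquiv_coe (by simp)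
  rw [← h]
  exact ((isLocalDiffeomorph_marking η w).mfderivToContinuousLinearEquiv (by simp)).bijective

/-- The projection of a bundle over a marked torus lifts locally to the plane. -/
theorem SmoothPrincipalBundle.exists_local_lift (Q : SmoothPrincipalBundle IG IP IS G P S)
    (η : L.Torus ≃ₘ^∞⟮𝓘(ℝ, ℂ), IS⟯ S) {p : P} {w : ℂ} (hp : η (L.toTorus w) = Q.proj p) :
    ∃ (U : Set P) (f : P → ℂ), IsOpen U ∧ p ∈ U ∧ ContMDiffOn IP 𝓘(ℝ, ℂ) ∞ f U ∧ f p = w ∧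
      ∀ q ∈ U, η (L.toTorus (f q)) = Q.proj q := by
  obtain ⟨Φ, hw, hΦ⟩ := isLocalDiffeomorph_marking η w
  have hpt : Q.proj p ∈ Φ.target := by
    rw [← hp]
    exact (hΦ hw).symm.subst (motive := fun x => x ∈ Φ.target) (Φ.map_source hw)
  refine ⟨Q.proj ⁻¹' Φ.target, Φ.symm ∘ Q.proj, Φ.open_target.preimage Q.contMDiff_proj.continuous,
    hpt, ?_, ?_, fun q hq => ?_⟩
  · exact Φ.contMDiffOn_invFun.comp Q.contMDiff_proj.contMDiffOn fun q hq => hq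
  · rw [comp_apply, ← hp]
    exact (congrArg Φ.symm (hΦ hw)).trans (Φ.left_inv hw)
  · exact (hΦ (Φ.map_target hq)).trans (Φ.right_inv hq)

theorem mfderiv_proj_eq_of_local_lift {η : L.Torus ≃ₘ^∞⟮𝓘(ℝ, ℂ), IS⟯ S} {U : Set P} {f : P → ℂ}
    (hU : IsOpen U) (hf : ContMDiffOn IP 𝓘(ℝ, ℂ) ∞ f U)
    (h : ∀ q ∈ U, η (L.toTorus (f q)) = Q.proj q) {p : P} (hp : p ∈ U) (u : TangentSpace IP p) :
    mfderiv IP IS Q.proj p u =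
      (mfderiv 𝓘(ℝ, ℂ) IS (fun z => η (L.toTorus z)) (f p) (mfderiv IP 𝓘(ℝ, ℂ) f p u) : ES) := by
  have h1 : HasMFDerivAt IP 𝓘(ℝ, ℂ) f p (mfderiv IP 𝓘(ℝ, ℂ) f p) :=
    ((hf.contMDiffAt (hU.mem_nhds hp)).mdifferentiableAt (by simp)).hasMFDerivAt
  have h2 : HasMFDerivAt 𝓘(ℝ, ℂ) IS (fun z => η (L.toTorus z)) (f p)
      (mfderiv 𝓘(ℝ, ℂ) IS (fun z => η (L.toTorus z)) (f p)) :=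
    ((Frame.contMDiff_marking_toTorus η).mdifferentiable (by simp) (f p)).hasMFDerivAt
  have h3 := h2.comp p h1
  have h4 : HasMFDerivAt IP IS ((fun z => η (L.toTorus z)) ∘ f) p (mfderiv IP IS Q.proj p) := by
    refine (Q.hasMFDerivAt_proj p).congr_of_eventuallyEq ?_
    filter_upwards [hU.mem_nhds hp] with q hq using h q hq
  exact congrArg (fun A : EP →L[ℝ] ES => A u) (hasMFDerivAt_unique h4 h3)

theorem SmoothPrincipalBundle.exists_marking_eq (Q : SmoothPrincipalBundle IG IP IS G P S)
    (η : L.Torus ≃ₘ^∞⟮𝓘(ℝ, ℂ), IS⟯ S) (p : P) : ∃ w, η (L.toTorus w) = Q.proj p := by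
  obtain ⟨w, hw⟩ := L.surjective_toTorus (η.symm (Q.proj p))
  exact ⟨w, by rw [hw, η.apply_symm_apply]⟩

namespace Frame

variable [FiniteDimensional ℝ EP] [IP.Boundaryless] [IsManifold IP ∞ P] (γ : Frame Q)
  {η : L.Torus ≃ₘ^∞⟮𝓘(ℝ, ℂ), IS⟯ S}

theorem mfderiv_local_lift_gen (hη : ∀ c z, γ.base z (η c) = η (c + L.toTorus z)) {U : Set P}
    {f : P → ℂ} (hU : IsOpen U) (hf : ContMDiffOn IP 𝓘(ℝ, ℂ) ∞ f U)
    (h : ∀ q ∈ U, η (L.toTorus (f q)) = Q.proj q) {p : P} (hp : p ∈ U) (v : ℂ) :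
    (mfderiv IP 𝓘(ℝ, ℂ) f p (γ.totalAction.gen p v) : ℂ) = v := by
  have h1 := mfderiv_proj_eq_of_local_lift hU hf h hp (γ.totalAction.gen p v)
  rw [γ.mfderiv_proj_gen hη (h p hp).symm] at h1
  exact ((bijective_mfderiv_marking η (f p)).injective h1).symm

/-- Invariance comes from equivariance: right translation by `g` maps the orbit of `p` to the orbit
of `Q.act p g`. -/
theorem mfderiv_act_gen (p : P) (g : G) (v : ℂ) :
    mfderiv IP IP (fun q => Q.act q g) p (γ.totalAction.gen p v) =
      γ.totalAction.gen (Q.act p g) v := by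
  have h1 : HasMFDerivAt IP IP (fun q => Q.act q g) (γ.totalAction.flow 0 p)
      (mfderiv IP IP (fun q => Q.act q g) p) := by
    rw [γ.totalAction.flow_zero]
    exact ((Q.contMDiff_act_right g).mdifferentiable (by simp) p).hasMFDerivAt
  have h2 := h1.comp (0 : ℂ) (γ.totalAction.hasMFDerivAt_flow 0 p)
  have h3 := γ.totalAction.hasMFDerivAt_flow 0 (Q.act p g)
  have e : ((fun q => Q.act q g) ∘ fun z => γ.totalAction.flow z p) =
      fun z => γ.totalAction.flow z (Q.act p g) := by
    funext z
    exact (γ.total_act z p g).symm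
  rw [e] at h2
  have h4 := congrArg (fun A : ℂ →L[ℝ] EP => A v) (hasMFDerivAt_unique h2 h3)
  change (mfderiv IP IP (fun q => Q.act q g) p) (γ.totalAction.gen (γ.totalAction.flow 0 p) v) =
    γ.totalAction.gen (γ.totalAction.flow 0 (Q.act p g)) v at h4
  rw [γ.totalAction.flow_zero, γ.totalAction.flow_zero] at h4
  exact h4

/-- The flat connection whose horizontal subspaces are tangent to the orbits of a frame. -/
noncomputable def connection (hη : ∀ c z, γ.base z (η c) = η (c + L.toTorus z)) :
    FlatConnection Q where
  hor p := LinearMap.range (γ.totalAction.gen p).toLinearMap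
  isCompl p := by
    obtain ⟨w, hw⟩ := Q.exists_marking_eq η p
    have hb := bijective_mfderiv_marking η w
    have hg := γ.mfderiv_proj_gen hη hw.symm
    constructor
    · rw [Submodule.disjoint_def]
      rintro _ ⟨v, rfl⟩ h
      have h1 : mfderiv IP IS Q.proj p (γ.totalAction.gen p v) = 0 := h
      rw [hg] at h1
      have h2 : v = 0 := hb.injective (h1.trans (map_zero _).symm)
      rw [h2, map_zero]
    · rw [codisjoint_iff, eq_top_iff]
      intro u _
      obtain ⟨v, hv⟩ : ∃ v : ℂ, mfderiv 𝓘(ℝ, ℂ) IS (fun z => η (L.toTorus z)) w v =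
        mfderiv IP IS Q.proj p u := hb.surjective (mfderiv IP IS Q.proj p u)
      refine Submodule.mem_sup.2 ⟨γ.totalAction.gen p v, ⟨v, rfl⟩, u - γ.totalAction.gen p v, ?_,
        add_sub_cancel _ _⟩
      rw [LinearMap.mem_ker]
      change mfderiv IP IS Q.proj p (u - γ.totalAction.gen p v) = 0
      rw [map_sub, hg, ← hv]
      exact sub_self _
  smooth p := by
    rintro _ ⟨v, rfl⟩
    exact ⟨univ, fun q => γ.totalAction.gen q v, trivial, γ.totalAction.isSmoothVectorFieldOn_gen v,
      fun q _ => ⟨v, rfl⟩, rfl⟩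
  invariant p g := by
    ext u
    constructor
    · rintro ⟨_, ⟨v, rfl⟩, rfl⟩
      exact ⟨v, (γ.mfderiv_act_gen p g v).symm⟩
    · rintro ⟨v, rfl⟩
      exact ⟨_, ⟨v, rfl⟩, γ.mfderiv_act_gen p g v⟩
  flat U X Y hX hY hXh hYh p hp := by
    obtain ⟨w, hw⟩ := Q.exists_marking_eq η p
    -- The local lift of the projection to `ℂ` has derivative the identity on generators, and so
    -- reads off the coefficients of horizontal fields.
    obtain ⟨V, f, hV, hpV, hf, -, hlift⟩ := Q.exists_local_lift η hw
    have hUV : IsOpen (U ∩ V) := hX.1.inter hV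
    obtain ⟨v, hv⟩ := γ.totalAction.mlieBracket_mem_range_gen (hf.mono inter_subset_right)
      (fun q hq v => γ.mfderiv_local_lift_gen hη hV hf hlift hq.2 v)
      (hX.mono hUV inter_subset_left) (hY.mono hUV inter_subset_left)
      (fun q hq => hXh q hq.1) (fun q hq => hYh q hq.1) ⟨hp, hpV⟩
    exact ⟨v, hv⟩

theorem exists_correspondsTo [FiniteDimensional ℝ ES] [IS.Boundaryless] [IsManifold IS ∞ S]
    (hS : IsGenusOneSurface IS S) :
    ∃ (L : PlaneLattice) (η : L.Torus ≃ₘ^∞⟮𝓘(ℝ, ℂ), IS⟯ S) (ν : FlatConnection Q),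
      γ.CorrespondsTo L η ν := by
  have := hS.t2Space
  have := hS.compactSpace
  have := hS.nonempty
  obtain ⟨L, η, hη⟩ := γ.baseAction.exists_lattice_diffeomorph hS.finrank_eq_two γ.transitive
  exact ⟨L, η, γ.connection hη, γ.correspondsTo_of_gen_mem hη fun p v => ⟨v, rfl⟩⟩

end Frame

end FrameConnection


/-! ### Orbits of commuting families of vector fields -/

section Orbits

open Set Metric Filter Function VectorField

variable {E H : Type*} [NormedAddCommGroup E] [NormedSpace ℝ E] [TopologicalSpace H]
  {I : ModelWithCorners ℝ E H} {M : Type*} [TopologicalSpace M] [ChartedSpace H M]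

/-- `s` is a parametrized piece of an orbit of the family `A` of vector fields. -/
def IsOrbitOn (A : ∀ p : M, ℂ →L[ℝ] TangentSpace I p) (s : ℂ → M) (O : Set ℂ) : Prop :=
  ∀ z ∈ O, HasMFDerivAt 𝓘(ℝ, ℂ) I s z (A (s z))

variable {A : ∀ p : M, ℂ →L[ℝ] TangentSpace I p} {s s' : ℂ → M} {O O' : Set ℂ}

theorem IsOrbitOn.mono (h : IsOrbitOn A s O) (hO : O' ⊆ O) : IsOrbitOn A s O' :=
  fun z hz => h z (hO hz)

theorem IsOrbitOn.comp_add (h : IsOrbitOn A s O) (w : ℂ) :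
    IsOrbitOn A (fun z => s (w + z)) ((fun z => w + z) ⁻¹' O) := by
  intro z hz
  have h1 : HasMFDerivAt 𝓘(ℝ, ℂ) 𝓘(ℝ, ℂ) (fun z : ℂ => w + z) z (ContinuousLinearMap.id ℝ ℂ) :=
    ((hasFDerivAt_id z).const_add w).hasMFDerivAt
  exact HasMFDerivAt.comp (f := fun z : ℂ => w + z) z (h (w + z) hz) h1

theorem IsOrbitOn.comp_add_ball {r : ℝ} (h : IsOrbitOn A s (ball 0 r)) (w : ℂ) :
    IsOrbitOn A (fun z => s (w + z)) (ball 0 (r - ‖w‖)) := by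
  refine (h.comp_add w).mono fun z hz => ?_
  rw [mem_ball_zero_iff] at hz
  rw [mem_preimage, mem_ball_zero_iff]
  linarith [norm_add_le w z]

variable [IsManifold I ∞ M] [I.Boundaryless]

/-- In a chart the orbit solves `ds = A ∘ s` with smooth `A`, and such solutions gain one order of
differentiability at a time. -/
theorem IsOrbitOn.contMDiffOn (h : IsOrbitOn A s O) (hO : IsOpen O)
    (hA : ∀ v, IsSmoothVectorFieldOn (fun p => A p v) univ) : ContMDiffOn 𝓘(ℝ, ℂ) I ∞ s O := by
  intro z hz
  refine ContMDiffAt.contMDiffWithinAt ?_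
  have hcont : ContinuousOn s O := fun z hz => (h z hz).continuousAt.continuousWithinAt
  set e := extChartAt I (s z) with he
  have hopen : IsOpen (O ∩ s ⁻¹' e.source) :=
    hcont.isOpen_inter_preimage hO (isOpen_extChartAt_source (s z))
  have hz' : z ∈ O ∩ s ⁻¹' e.source := ⟨hz, mem_extChartAt_source (s z)⟩
  have h1 : ContDiffOn ℝ ∞ (fun z => e (s z)) (O ∩ s ⁻¹' e.source) :=
    contDiffOn_of_hasFDerivAt_comp hopen (contDiffOn_chartFieldMap hA (s z)) fun w hw =>
      ⟨⟨e.map_source hw.2, trivial⟩, hasFDerivAt_extChartAt_comp (h w hw.1) hw.2⟩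
  have h2 : ContMDiffAt 𝓘(ℝ, ℂ) I ∞ (fun w => e.symm (e (s w))) z :=
    ContMDiffAt.comp z (contMDiffAt_extChartAt_symm_of_boundaryless
      (mem_extChartAt_target (s z))) (h1.contDiffAt (hopen.mem_nhds hz')).contMDiffAt
  refine h2.congr_of_eventuallyEq ?_
  filter_upwards [hopen.mem_nhds hz'] with w hw
  exact (e.left_inv hw.2).symm

/-- Along the ray through `z` both maps are integral curves of the single vector field `A · z`, so
uniqueness for ordinary differential equations applies. -/
theorem IsOrbitOn.eqOn_ball [T2Space M] [CompleteSpace E] {r : ℝ}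
    (hA : ∀ v, IsSmoothVectorFieldOn (fun p => A p v) univ) (h : IsOrbitOn A s (ball 0 r))
    (h' : IsOrbitOn A s' (ball 0 r)) (h0 : s 0 = s' 0) : EqOn s s' (ball 0 r) := by
  intro z hz
  have : IsManifold I 1 M := .of_le (n := ∞) (by norm_cast)
  rcases eq_or_ne z 0 with rfl | hz0
  · exact h0
  have hzpos : 0 < ‖z‖ := norm_pos_iff.2 hz0
  rw [mem_ball_zero_iff] at hz
  -- The curve `t ↦ t • z` stays in the ball for `|t| < r / ‖z‖`, an interval that contains the time
  -- `1` at which it reaches `z`.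
  have ha : 1 < r / ‖z‖ := (one_lt_div hzpos).2 hz
  have hcurve : ∀ {σ : ℂ → M}, IsOrbitOn A σ (ball 0 r) →
      IsMIntegralCurveOn (fun t : ℝ => σ (t • z)) (fun p => A p z)
        (Ioo (-(r / ‖z‖)) (r / ‖z‖)) := by
    intro σ hσ t ht
    have htz : t • z ∈ ball (0 : ℂ) r := by
      rw [mem_ball_zero_iff, norm_smul, Real.norm_eq_abs, ← lt_div_iff₀ hzpos]
      exact abs_lt.2 ht
    have h1 : HasMFDerivAt 𝓘(ℝ, ℝ) 𝓘(ℝ, ℂ) (fun t : ℝ => t • z) t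
        ((ContinuousLinearMap.id ℝ ℝ).smulRight z) :=
      ((hasFDerivAt_id t).smul_const z).hasMFDerivAt
    have h2 := HasMFDerivAt.comp (f := fun t : ℝ => t • z) t (hσ _ htz) h1
    refine (h2.congr_mfderiv ?_).hasMFDerivWithinAt
    refine ContinuousLinearMap.ext_ring ?_
    change A (σ (t • z)) ((1 : ℝ) • z) = (1 : ℝ) • A (σ (t • z)) z
    rw [one_smul, one_smul]
  have h1 := isMIntegralCurveOn_Ioo_eqOn_of_contMDiff_boundaryless (I := I) (t₀ := 0)
    (by constructor <;> linarith) ((contMDiffOn_univ.1 (hA z).2).of_le (by norm_cast))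
    (hcurve h) (hcurve h') (by simpa using h0)
  have h2 := h1 (show (1 : ℝ) ∈ Ioo (-(r / ‖z‖)) (r / ‖z‖) by constructor <;> linarith)
  simpa using h2

/-- Commuting vector fields have orbits through every point. -/
theorem exists_isOrbitOn_ball [CompleteSpace E]
    (hA : ∀ v, IsSmoothVectorFieldOn (fun p => A p v) univ)
    (hcomm : ∀ v w p, mlieBracket I (fun p => A p v) (fun p => A p w) p = 0) (p : M) :
    ∃ ε > 0, ∃ s : ℂ → M, s 0 = p ∧ IsOrbitOn A s (ball 0 ε) := by
  have hU := isOpen_extChartAt_target_inter_preimage (I := I) p isOpen_univ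
  have hAc := contDiffOn_chartFieldMap hA p
  obtain ⟨ε, hε, s, hs0, hs⟩ := exists_hasFDerivAt_eq_of_commuting hU
    ⟨mem_extChartAt_target p, trivial⟩ hAc (fun y hy v w => by
      have hAd : DifferentiableAt ℝ (chartFieldMap I p A) y :=
        (hAc.contDiffAt (hU.mem_nhds hy)).differentiableAt (by simp)
      have h1 := mfderiv_extChartAt_mlieBracket (hA v) (hA w) hy.1 trivial
      rw [lieBracket_chartFieldMap hAd] at h1
      rw [← sub_eq_zero, ← h1, chartField, hcomm]
      exact map_zero _)
  refine ⟨ε, hε, fun z => (extChartAt I p).symm (s z), ?_, fun z hz =>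
    hasMFDerivAt_extChartAt_symm_comp (hs z hz).2 (hs z hz).1.1⟩
  simp only [hs0]
  exact extChartAt_to_inv p

end Orbits


/-! ### Horizontal lifts of the constant vector fields -/

section HorizontalLifts

open Set Metric Filter Function VectorField

theorem contMDiffOn_mfderiv_apply {E H : Type*} [NormedAddCommGroup E] [NormedSpace ℝ E]
    [TopologicalSpace H] {I : ModelWithCorners ℝ E H} {M : Type*} [TopologicalSpace M]
    [ChartedSpace H M] [IsManifold I ∞ M] [I.Boundaryless] {V : Type*} [NormedAddCommGroup V]
    [NormedSpace ℝ V] {X : ∀ p : M, TangentSpace I p} {U : Set M}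
    (hX : IsSmoothVectorFieldOn X U) {f : M → V} (hf : ContMDiffOn I 𝓘(ℝ, V) ∞ f U) :
    ContMDiffOn I 𝓘(ℝ, V) ∞ (fun p => (mfderiv I 𝓘(ℝ, V) f p (X p) : V)) U := by
  intro p hp
  refine ContMDiffAt.contMDiffWithinAt ?_
  have hN := (isOpen_extChartAt_target_inter_preimage (I := I) p hX.1).mem_nhds
    ⟨mem_extChartAt_target p, by rw [mem_preimage, extChartAt_to_inv]; exact hp⟩
  have h1 : ContDiffAt ℝ ∞ (fun y => fderiv ℝ (f ∘ (extChartAt I p).symm) y (chartField I p X y))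
      (extChartAt I p p) :=
    (((hf.contDiffOn_comp_extChartAt_symm p).contDiffAt hN).fderiv_right (by simp)).clm_apply
      ((hX.contDiffOn_chartField p).contDiffAt hN)
  have h2 := ContMDiffAt.comp p h1.contMDiffAt (contMDiffAt_extChartAt (n := ∞))
  refine h2.congr_of_eventuallyEq ?_
  filter_upwards [hX.1.mem_nhds hp, (isOpen_extChartAt_source (I := I) p).mem_nhds
    (mem_extChartAt_source p)] with q hq hqs
  have hq' := (extChartAt I p).left_inv hqs
  have h3 := fderiv_comp_extChartAt_symm ((extChartAt I p).map_source hqs)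
    (f := f) (by rw [hq']; exact (hf.contMDiffAt (hX.1.mem_nhds hq)).mdifferentiableAt (by simp)) X
  rw [hq'] at h3
  exact h3.symm

variable {EG HG EP HP ES HS : Type*}
  [NormedAddCommGroup EG] [NormedSpace ℝ EG] [TopologicalSpace HG]
  [NormedAddCommGroup EP] [NormedSpace ℝ EP] [TopologicalSpace HP]
  [NormedAddCommGroup ES] [NormedSpace ℝ ES] [TopologicalSpace HS]
  {IG : ModelWithCorners ℝ EG HG} {IP : ModelWithCorners ℝ EP HP}
  {IS : ModelWithCorners ℝ ES HS}
  {G : Type*} [TopologicalSpace G] [ChartedSpace HG G] [Group G]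
  {P : Type*} [TopologicalSpace P] [ChartedSpace HP P] [IsManifold IP ∞ P]
  {S : Type*} [TopologicalSpace S] [ChartedSpace HS S]
  {Q : SmoothPrincipalBundle IG IP IS G P S} {L : PlaneLattice}

namespace PrincipalConnection

variable (ν : PrincipalConnection Q)

theorem exists_mem_hor_mfderiv_proj_eq (p : P) (b : ES) :
    ∃ u ∈ ν.hor p, (mfderiv IP IS Q.proj p u : ES) = b := by
  obtain ⟨u, hu⟩ := Q.surjective_mfderiv_proj p b
  have htop : u ∈ ν.hor p ⊔ LinearMap.ker (mfderiv IP IS Q.proj p).toLinearMap := by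
    rw [(ν.isCompl p).sup_eq_top]; trivial
  obtain ⟨u₁, h₁, u₂, h₂, rfl⟩ := Submodule.mem_sup.1 htop
  refine ⟨u₁, h₁, ?_⟩
  have h3 : mfderiv IP IS Q.proj p u₂ = 0 := h₂
  rw [map_add, h3, add_zero] at hu
  exact hu

variable (η : L.Torus ≃ₘ^∞⟮𝓘(ℝ, ℂ), IS⟯ S)

/-- Horizontal vectors over the images of `1` and `I` determine the lift by real linearity. The
constant fields are written as derivatives at `0` of translations of the torus, so no representative
in `ℂ` of the base point has to be chosen. -/
theorem exists_horizontalLift (p : P) : ∃ A : ℂ →L[ℝ] TangentSpace IP p, ∀ v, A v ∈ ν.hor p ∧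
    (mfderiv IP IS Q.proj p (A v) : ES) =
      mfderiv 𝓘(ℝ, ℂ) IS (fun z => η (η.symm (Q.proj p) + L.toTorus z)) 0 v := by
  obtain ⟨D, hD⟩ : ∃ D : ℂ →L[ℝ] ES,
    D = mfderiv 𝓘(ℝ, ℂ) IS (fun z => η (η.symm (Q.proj p) + L.toTorus z)) 0 := ⟨_, rfl⟩
  obtain ⟨u, hu, hu'⟩ := ν.exists_mem_hor_mfderiv_proj_eq p (D 1)
  obtain ⟨w, hw, hw'⟩ := ν.exists_mem_hor_mfderiv_proj_eq p (D Complex.I)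
  refine ⟨Complex.reCLM.smulRight u + Complex.imCLM.smulRight w, fun v => ⟨?_, ?_⟩⟩
  · exact add_mem (Submodule.smul_mem _ _ hu) (Submodule.smul_mem _ _ hw)
  · have h1 : D v = v.re • D 1 + v.im • D Complex.I := by
      rw [← map_smul, ← map_smul, ← map_add]
      congr 1
      simp [Complex.re_add_im]
    rw [← hD]
    change (mfderiv IP IS Q.proj p (v.re • u + v.im • w) : ES) = D v
    rw [h1, ← hu', ← hw', map_add, map_smul, map_smul]
    rfl

/-- The horizontal lifts of the constant vector fields on a marked torus. -/
noncomputable def horizontalLift (p : P) : ℂ →L[ℝ] TangentSpace IP p :=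
  (ν.exists_horizontalLift η p).choose

theorem horizontalLift_mem (p : P) (v : ℂ) : ν.horizontalLift η p v ∈ ν.hor p :=
  ((ν.exists_horizontalLift η p).choose_spec v).1

theorem mfderiv_proj_horizontalLift {p : P} {w : ℂ} (hp : η (L.toTorus w) = Q.proj p) (v : ℂ) :
    (mfderiv IP IS Q.proj p (ν.horizontalLift η p v) : ES) =
      mfderiv 𝓘(ℝ, ℂ) IS (fun z => η (L.toTorus z)) w v := by
  refine ((ν.exists_horizontalLift η p).choose_spec v).2.trans ?_
  have e : (fun z => η (η.symm (Q.proj p) + L.toTorus z)) =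
      (fun z => η (L.toTorus z)) ∘ fun z => w + z := by
    funext z
    rw [comp_apply, L.toTorus_add, ← hp, η.symm_apply_apply]
  have h4 : HasMFDerivAt 𝓘(ℝ, ℂ) 𝓘(ℝ, ℂ) (fun z : ℂ => w + z) 0 (ContinuousLinearMap.id ℝ ℂ) :=
    ((hasFDerivAt_id (0 : ℂ)).const_add w).hasMFDerivAt
  have h5 : HasMFDerivAt 𝓘(ℝ, ℂ) IS (fun z => η (L.toTorus z)) (w + 0)
      (mfderiv 𝓘(ℝ, ℂ) IS (fun z => η (L.toTorus z)) w) := by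
    rw [add_zero]
    exact ((Frame.contMDiff_marking_toTorus η).mdifferentiable (by simp) w).hasMFDerivAt
  have h6 := (HasMFDerivAt.comp (f := fun z : ℂ => w + z) 0 h5 h4).mfderiv
  rw [← e] at h6
  exact congrArg (fun A : ℂ →L[ℝ] ES => A v) h6

theorem eq_horizontalLift {p : P} {w : ℂ} (hp : η (L.toTorus w) = Q.proj p) {v : ℂ}
    {u : TangentSpace IP p} (hu : u ∈ ν.hor p) (huv : (mfderiv IP IS Q.proj p u : ES) =
      mfderiv 𝓘(ℝ, ℂ) IS (fun z => η (L.toTorus z)) w v) : u = ν.horizontalLift η p v :=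
  ν.eq_of_mfderiv_proj_eq hu (ν.horizontalLift_mem η p v)
    (huv.trans (ν.mfderiv_proj_horizontalLift η hp v).symm)

variable {η} in
theorem mfderiv_local_lift_horizontalLift {U : Set P} {f : P → ℂ} (hU : IsOpen U)
    (hf : ContMDiffOn IP 𝓘(ℝ, ℂ) ∞ f U) (h : ∀ q ∈ U, η (L.toTorus (f q)) = Q.proj q) {p : P}
    (hp : p ∈ U) (v : ℂ) : (mfderiv IP 𝓘(ℝ, ℂ) f p (ν.horizontalLift η p v) : ℂ) = v := by
  have h1 := mfderiv_proj_eq_of_local_lift hU hf h hp (ν.horizontalLift η p v)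
  have h2 := (ν.mfderiv_proj_horizontalLift η (h p hp) v).symm.trans h1
  exact ((bijective_mfderiv_marking η (f p)).injective h2).symm

/-- Right translation preserves horizontal spaces and projections, and a horizontal vector is
determined by its projection. -/
theorem mfderiv_act_horizontalLift (p : P) (g : G) (v : ℂ) :
    mfderiv IP IP (fun q => Q.act q g) p (ν.horizontalLift η p v) =
      ν.horizontalLift η (Q.act p g) v := by
  obtain ⟨w, hw⟩ := Q.exists_marking_eq η p
  have hw' : η (L.toTorus w) = Q.proj (Q.act p g) := by rw [Q.proj_act, hw]
  refine ν.eq_horizontalLift η hw' ?_ ?_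
  · rw [← ν.invariant p g]
    exact ⟨_, ν.horizontalLift_mem η p v, rfl⟩
  · rw [← ν.mfderiv_proj_horizontalLift η hw v]
    have h1 : HasMFDerivAt IP IP (fun q => Q.act q g) p (mfderiv IP IP (fun q => Q.act q g) p) :=
      ((Q.contMDiff_act_right g).mdifferentiable (by simp) p).hasMFDerivAt
    have h2 := HasMFDerivAt.comp (f := fun q => Q.act q g) p (Q.hasMFDerivAt_proj (Q.act p g)) h1
    have e : (Q.proj ∘ fun q => Q.act q g) = Q.proj := funext fun q => Q.proj_act q g
    rw [e] at h2
    exact congrArg (fun A : EP →L[ℝ] ES => A (ν.horizontalLift η p v))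
      (hasMFDerivAt_unique h2 (Q.hasMFDerivAt_proj p))

/-- Smoothness of the distribution only provides smooth horizontal fields `X₁`, `X₂` with the
prescribed values at `p`, which elsewhere need not be lifts of constant fields. In the local
coordinate `f` their projections form an operator `B q` with `B p = id`. It is invertible near `p`,
and `(B q).inverse v` gives smooth coefficients expressing the lift of `v` through `X₁` and `X₂`. -/
theorem isSmoothVectorFieldOn_horizontalLift [IP.Boundaryless] (v : ℂ) :
    IsSmoothVectorFieldOn (fun p => ν.horizontalLift η p v) univ := by
  refine ⟨isOpen_univ, fun p _ => ContMDiffAt.contMDiffWithinAt ?_⟩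
  obtain ⟨w, hw⟩ := Q.exists_marking_eq η p
  obtain ⟨U₀, f, hU₀, hp₀, hf₀, -, hlift⟩ := Q.exists_local_lift η hw
  obtain ⟨U₁, X₁, hp₁, hX₁, hh₁, he₁⟩ := ν.smooth p _ (ν.horizontalLift_mem η p 1)
  obtain ⟨U₂, X₂, hp₂, hX₂, hh₂, he₂⟩ := ν.smooth p _ (ν.horizontalLift_mem η p Complex.I)
  set U := U₀ ∩ U₁ ∩ U₂ with hUdef
  have hU : IsOpen U := (hU₀.inter hX₁.1).inter hX₂.1
  have hp : p ∈ U := ⟨⟨hp₀, hp₁⟩, hp₂⟩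
  replace hX₁ := hX₁.mono hU fun q hq => hq.1.2
  replace hX₂ := hX₂.mono hU fun q hq => hq.2
  have hf : ContMDiffOn IP 𝓘(ℝ, ℂ) ∞ f U := hf₀.mono fun q hq => hq.1.1
  have hg₁ := contMDiffOn_mfderiv_apply hX₁ hf
  have hg₂ := contMDiffOn_mfderiv_apply hX₂ hf
  set g₁ : P → ℂ := fun q => mfderiv IP 𝓘(ℝ, ℂ) f q (X₁ q) with hg₁'
  set g₂ : P → ℂ := fun q => mfderiv IP 𝓘(ℝ, ℂ) f q (X₂ q) with hg₂'
  set B : P → ℂ →L[ℝ] ℂ := fun q =>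
    Complex.reCLM.smulRight (g₁ q) + Complex.imCLM.smulRight (g₂ q) with hB
  have hBs : ContMDiffOn IP 𝓘(ℝ, ℂ →L[ℝ] ℂ) ∞ B U :=
    ((ContinuousLinearMap.smulRightL ℝ ℂ ℂ Complex.reCLM).contMDiff.comp_contMDiffOn hg₁).add
      ((ContinuousLinearMap.smulRightL ℝ ℂ ℂ Complex.imCLM).contMDiff.comp_contMDiffOn hg₂)
  have hBp : B p = ContinuousLinearMap.id ℝ ℂ := by
    have e₁ : g₁ p = 1 := by
      simp only [hg₁', he₁]
      exact ν.mfderiv_local_lift_horizontalLift hU₀ hf₀ hlift hp₀ 1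
    have e₂ : g₂ p = Complex.I := by
      simp only [hg₂', he₂]
      exact ν.mfderiv_local_lift_horizontalLift hU₀ hf₀ hlift hp₀ Complex.I
    ext v
    simp [hB, e₁, e₂, Complex.re_add_im]
  have hinv : ContDiffAt ℝ ∞ (ContinuousLinearMap.inverse : (ℂ →L[ℝ] ℂ) → ℂ →L[ℝ] ℂ) (B p) := by
    rw [hBp]
    exact contDiffAt_map_inverse (ContinuousLinearEquiv.refl ℝ ℂ)
  have hBat : ContMDiffAt IP 𝓘(ℝ, ℂ →L[ℝ] ℂ) ∞ B p := hBs.contMDiffAt (hU.mem_nhds hp)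
  set c : P → ℂ := fun q => (B q).inverse v with hc
  have hcs : ContMDiffAt IP 𝓘(ℝ, ℂ) ∞ c p := by
    have h1 : ContMDiffAt IP 𝓘(ℝ, ℂ →L[ℝ] ℂ) ∞ (fun q => (B q).inverse) p :=
      ContMDiffAt.comp p hinv.contMDiffAt hBat
    exact h1.clm_apply contMDiffAt_const
  have hre : ContMDiffAt IP 𝓘(ℝ, ℝ) ∞ (fun q => (c q).re) p :=
    Complex.reCLM.contMDiff.contMDiffAt.comp p hcs
  have him : ContMDiffAt IP 𝓘(ℝ, ℝ) ∞ (fun q => (c q).im) p :=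
    Complex.imCLM.contMDiff.contMDiffAt.comp p hcs
  have hsum := (hre.smul_section (hX₁.2.contMDiffAt (hU.mem_nhds hp))).add_section
    (him.smul_section (hX₂.2.contMDiffAt (hU.mem_nhds hp)))
  refine hsum.congr_of_eventuallyEq ?_
  have hunit : ∀ᶠ q in 𝓝 p, (B q).IsInvertible := by
    have h : range ((↑) : (ℂ ≃L[ℝ] ℂ) → ℂ →L[ℝ] ℂ) ∈ 𝓝 (B p) := by
      rw [hBp]
      exact ContinuousLinearEquiv.nhds (ContinuousLinearEquiv.refl ℝ ℂ)
    exact hBat.continuousAt.preimage_mem_nhds h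
  filter_upwards [hunit, hU.mem_nhds hp] with q hq hqU
  have hval : ν.horizontalLift η q v = (c q).re • X₁ q + (c q).im • X₂ q := by
    refine (ν.eq_horizontalLift η (hlift q hqU.1.1) ?_ ?_).symm
    · exact add_mem (Submodule.smul_mem _ _ (hh₁ q hqU.1.2)) (Submodule.smul_mem _ _ (hh₂ q hqU.2))
    · rw [mfderiv_proj_eq_of_local_lift hU₀ hf₀ hlift hqU.1.1]
      have h1 : (mfderiv IP 𝓘(ℝ, ℂ) f q ((c q).re • X₁ q + (c q).im • X₂ q) : ℂ) = v := by
        have h2 : B q (c q) = v := by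
          obtain ⟨e, he⟩ := hq
          simp only [hc, ← he, ContinuousLinearMap.inverse_equiv]
          exact e.apply_symm_apply v
        rw [map_add, map_smul, map_smul]
        exact h2
      exact congrArg (fun u : ℂ => (mfderiv 𝓘(ℝ, ℂ) IS (fun z => η (L.toTorus z)) (f q) :
        ℂ →L[ℝ] ES) u) h1
  rw [hval]
  rfl

end PrincipalConnection

/-- Flatness makes the bracket horizontal. Its projection is zero because the local lift `f` has
constant derivative along both fields. A horizontal vector with zero projection vanishes. -/
theorem FlatConnection.mlieBracket_horizontalLift [IP.Boundaryless] [CompleteSpace EP]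
    (ν : FlatConnection Q) (η : L.Torus ≃ₘ^∞⟮𝓘(ℝ, ℂ), IS⟯ S) (v w : ℂ) (p : P) :
    mlieBracket IP (fun p => ν.horizontalLift η p v) (fun p => ν.horizontalLift η p w) p = 0 := by
  have hv := ν.isSmoothVectorFieldOn_horizontalLift η v
  have hw := ν.isSmoothVectorFieldOn_horizontalLift η w
  obtain ⟨z, hz⟩ := Q.exists_marking_eq η p
  obtain ⟨U, f, hU, hp, hf, -, hlift⟩ := Q.exists_local_lift η hz
  have h1 := ν.flat univ _ _ hv hw (fun q _ => ν.horizontalLift_mem η q v)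
    (fun q _ => ν.horizontalLift_mem η q w) p trivial
  have h2 := mfderiv_mlieBracket_eq_zero (hv.mono hU (subset_univ U)) (hw.mono hU (subset_univ U))
    hf (fun q hq => ν.mfderiv_local_lift_horizontalLift hU hf hlift hq v)
    (fun q hq => ν.mfderiv_local_lift_horizontalLift hU hf hlift hq w) hp
  refine ν.eq_of_mfderiv_proj_eq h1 (zero_mem _) ?_
  rw [mfderiv_proj_eq_of_local_lift hU hf hlift hp, map_zero]
  exact (congrArg (fun u : ℂ => (mfderiv 𝓘(ℝ, ℂ) IS (fun z => η (L.toTorus z)) (f p) :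
        ℂ →L[ℝ] ES) u) h2).trans (map_zero _)

end HorizontalLifts


/-! ### The local flow of a flat connection -/

section LocalFlow

open Set Metric Filter Function VectorField

variable {EG HG EP HP ES HS : Type*}
  [NormedAddCommGroup EG] [NormedSpace ℝ EG] [TopologicalSpace HG]
  [NormedAddCommGroup EP] [NormedSpace ℝ EP] [TopologicalSpace HP]
  [NormedAddCommGroup ES] [NormedSpace ℝ ES] [TopologicalSpace HS]
  {IG : ModelWithCorners ℝ EG HG} {IP : ModelWithCorners ℝ EP HP}
  {IS : ModelWithCorners ℝ ES HS}
  {G : Type*} [TopologicalSpace G] [ChartedSpace HG G] [Group G]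
  {P : Type*} [TopologicalSpace P] [ChartedSpace HP P] [IsManifold IP ∞ P]
  {S : Type*} [TopologicalSpace S] [ChartedSpace HS S]
  {Q : SmoothPrincipalBundle IG IP IS G P S} {L : PlaneLattice}

namespace PrincipalConnection

variable {ν : PrincipalConnection Q} {η : L.Torus ≃ₘ^∞⟮𝓘(ℝ, ℂ), IS⟯ S} {s : ℂ → P} {O : Set ℂ}

theorem isOrbitOn_act (hs : IsOrbitOn (ν.horizontalLift η) s O) (g : G) :
    IsOrbitOn (ν.horizontalLift η) (fun z => Q.act (s z) g) O := by
  intro z hz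
  have h1 : HasMFDerivAt IP IP (fun q => Q.act q g) (s z)
      (mfderiv IP IP (fun q => Q.act q g) (s z)) :=
    ((Q.contMDiff_act_right g).mdifferentiable (by simp) (s z)).hasMFDerivAt
  refine (h1.comp z (hs z hz)).congr_mfderiv ?_
  ext v
  exact ν.mfderiv_act_horizontalLift η (s z) g v

/-- In the group `ℂ / Λ` the difference between the projected orbit and the translate `[w + z]` has
zero derivative, so it keeps its value at the centre of the ball, which is `0`. -/
theorem proj_eq_of_isOrbitOn {r : ℝ} (hs : IsOrbitOn (ν.horizontalLift η) s (ball 0 r)) {w : ℂ}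
    (hw : η (L.toTorus w) = Q.proj (s 0)) {z : ℂ} (hz : z ∈ ball (0 : ℂ) r) :
    Q.proj (s z) = η (L.toTorus (w + z)) := by
  have hder : ∀ z ∈ ball (0 : ℂ) r, HasMFDerivWithinAt 𝓘(ℝ, ℂ) 𝓘(ℝ, ℂ)
      (fun z => η.symm (Q.proj (s z)) - L.toTorus (w + z)) (ball 0 r) z 0 := by
    intro z hz
    obtain ⟨w', hw'⟩ := Q.exists_marking_eq η (s z)
    obtain ⟨U, f, hU, hp, hf, -, hlift⟩ := Q.exists_local_lift η hw'
    have h1 : HasMFDerivAt IP 𝓘(ℝ, ℂ) f (s z) (mfderiv IP 𝓘(ℝ, ℂ) f (s z)) :=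
      ((hf.contMDiffAt (hU.mem_nhds hp)).mdifferentiableAt (by simp)).hasMFDerivAt
    have h2 : HasFDerivAt (f ∘ s) (ContinuousLinearMap.id ℝ ℂ) z := by
      refine HasMFDerivAt.hasFDerivAt ((h1.comp z (hs z hz)).congr_mfderiv ?_)
      ext v
      exact ν.mfderiv_local_lift_horizontalLift hU hf hlift hp v
    have h3 : HasFDerivAt (fun z => (f ∘ s) z - (w + z)) (0 : ℂ →L[ℝ] ℂ) z := by
      have := h2.sub ((hasFDerivAt_id z).const_add w)
      rwa [sub_self] at this
    have h4 : HasMFDerivAt 𝓘(ℝ, ℂ) 𝓘(ℝ, ℂ) L.toTorus ((f ∘ s) z - (w + z))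
        (mfderiv 𝓘(ℝ, ℂ) 𝓘(ℝ, ℂ) L.toTorus ((f ∘ s) z - (w + z))) :=
      (L.contMDiff_toTorus.mdifferentiable (by simp) _).hasMFDerivAt
    have h5 := HasMFDerivAt.comp (f := fun z => (f ∘ s) z - (w + z)) z h4 h3.hasMFDerivAt
    have h6 : HasMFDerivAt 𝓘(ℝ, ℂ) 𝓘(ℝ, ℂ)
        (fun z => η.symm (Q.proj (s z)) - L.toTorus (w + z)) z 0 := by
      refine (h5.congr_mfderiv (ContinuousLinearMap.comp_zero _)).congr_of_eventuallyEq ?_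
      filter_upwards [(hs z hz).continuousAt.preimage_mem_nhds (hU.mem_nhds hp)] with z' hz'
      rw [← hlift _ hz', η.symm_apply_apply, comp_apply, L.toTorus_sub]
      rfl
    exact h6.hasMFDerivWithinAt
  have hr : 0 < r := lt_of_le_of_lt (norm_nonneg z) (mem_ball_zero_iff.1 hz)
  have h1 := eq_of_hasMFDerivWithinAt_zero (I := 𝓘(ℝ, ℂ)) (convex_ball (0 : ℂ) r) hder hz
    (mem_ball_self hr)
  simp only [add_zero] at h1
  rw [← hw, η.symm_apply_apply, sub_self, sub_eq_zero] at h1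
  rw [← h1, η.apply_symm_apply]

end PrincipalConnection

namespace FlatConnection

variable [IP.Boundaryless] [CompleteSpace EP] [CompactSpace S] (ν : FlatConnection Q)
  (η : L.Torus ≃ₘ^∞⟮𝓘(ℝ, ℂ), IS⟯ S)

/-- An orbit piece of radius `ε` through one point passes over a neighbourhood of its base point,
and its part based at a parameter of norm below `ε / 2` still has radius `ε / 2`. Right translation
moves this part to any point of the same fibre. The radius is thus locally uniform over the base,
and compactness of `S` makes it globally uniform. -/
theorem exists_uniform_isOrbitOn : ∃ ε > 0, ∀ p : P, ∃ s : ℂ → P, s 0 = p ∧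
    IsOrbitOn (ν.horizontalLift η) s (ball 0 ε) := by
  suffices h : ∃ ε > 0, ∀ p : P, Q.proj p ∈ (univ : Set S) → ∃ s : ℂ → P, s 0 = p ∧
      IsOrbitOn (ν.horizontalLift η) s (ball 0 ε) by simpa using h
  refine isCompact_univ.induction_on (p := fun K : Set S => ∃ ε > 0, ∀ p : P, Q.proj p ∈ K →
    ∃ s : ℂ → P, s 0 = p ∧ IsOrbitOn (ν.horizontalLift η) s (ball 0 ε)) ?_ ?_ ?_ ?_
  · exact ⟨1, one_pos, fun p hp => absurd hp (notMem_empty _)⟩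
  · rintro K K' hK ⟨ε, hε, h⟩
    exact ⟨ε, hε, fun p hp => h p (hK hp)⟩
  · rintro K K' ⟨ε, hε, h⟩ ⟨ε', hε', h'⟩
    refine ⟨min ε ε', lt_min hε hε', fun p hp => ?_⟩
    rcases hp with hp | hp
    · obtain ⟨s, hs0, hs⟩ := h p hp
      exact ⟨s, hs0, hs.mono (ball_subset_ball (min_le_left _ _))⟩
    · obtain ⟨s, hs0, hs⟩ := h' p hp
      exact ⟨s, hs0, hs.mono (ball_subset_ball (min_le_right _ _))⟩
  · intro x _
    obtain ⟨p, rfl⟩ := Q.proj_surjective x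
    obtain ⟨ε, hε, s, rfl, hs⟩ := exists_isOrbitOn_ball
      (ν.isSmoothVectorFieldOn_horizontalLift η) (ν.mlieBracket_horizontalLift η) p
    obtain ⟨w, hw⟩ := Q.exists_marking_eq η (s 0)
    have hopen := (isLocalDiffeomorph_marking η).isOpenMap (ball w (ε / 2)) isOpen_ball
    refine ⟨_, mem_nhdsWithin_of_mem_nhds (hopen.mem_nhds ⟨w, mem_ball_self (by positivity), hw⟩),
      ε / 2, by positivity, ?_⟩
    rintro q ⟨w', hw', hq⟩
    have hn : ‖w' - w‖ < ε / 2 := by rwa [← dist_eq_norm]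
    have hq' : Q.proj (s (w' - w)) = Q.proj q := by
      rw [ν.proj_eq_of_isOrbitOn hs hw (mem_ball_zero_iff.2 (by linarith)), add_sub_cancel]
      exact hq
    obtain ⟨g, hg⟩ := Q.exists_act_eq hq'
    refine ⟨fun z => Q.act (s (w' - w + z)) g, by simpa using hg, ?_⟩
    refine (PrincipalConnection.isOrbitOn_act (hs.comp_add_ball (w' - w)) g).mono ?_
    exact ball_subset_ball (by linarith)

/-- The local flow along the horizontal lifts of the constant vector fields. -/
theorem exists_local_flow [T2Space P] [LieGroup IG ∞ G] : ∃ ε > 0, ∃ F : ℂ → P → P,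
    (∀ p, F 0 p = p) ∧
    (∀ z ∈ ball (0 : ℂ) ε, ∀ w ∈ ball (0 : ℂ) ε, ∀ p, F (z + w) p = F z (F w p)) ∧
    (∀ z ∈ ball (0 : ℂ) ε, ∀ p g, F z (Q.act p g) = Q.act (F z p) g) ∧
    (∀ z ∈ ball (0 : ℂ) ε, ∀ p, Q.proj (F z p) = η (η.symm (Q.proj p) + L.toTorus z)) ∧
    ContMDiffOn (𝓘(ℝ, ℂ).prod IP) IP ∞ (fun q : ℂ × P => F q.1 q.2) (ball 0 ε ×ˢ univ) ∧
    ∀ p, HasMFDerivAt 𝓘(ℝ, ℂ) IP (fun z => F z p) 0 (ν.horizontalLift η (F 0 p)) := by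
  obtain ⟨ε, hε, h⟩ := ν.exists_uniform_isOrbitOn η
  choose s hs0 hs using h
  have hA := ν.isSmoothVectorFieldOn_horizontalLift η
  -- A point reached from `p` by the flow and a right translation has as its orbit the translate of
  -- the orbit of `p`. The group law is the case `g = 1`, equivariance the case `w = 0`. With `w`
  -- and `z` of norm below `ε / 2`, the sum `w + z` stays in the ball of radius `ε`.
  have huniq : ∀ {p q : P} {w : ℂ} {g : G}, ‖w‖ < ε / 2 → Q.act (s p w) g = q →
      ∀ z ∈ ball (0 : ℂ) (ε / 2), s q z = Q.act (s p (w + z)) g := by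
    intro p q w g hw hq
    have h1 := (PrincipalConnection.isOrbitOn_act ((hs p).comp_add_ball w) g).mono
      (ball_subset_ball (show ε / 2 ≤ ε - ‖w‖ by linarith))
    have h2 := (hs q).mono (ball_subset_ball (show ε / 2 ≤ ε by linarith))
    exact h2.eqOn_ball hA h1 (by rw [hs0, add_zero, hq])
  have hmem : ∀ {z : ℂ}, z ∈ ball (0 : ℂ) (ε / 2) → z ∈ ball (0 : ℂ) ε := fun hz =>
    ball_subset_ball (by linarith) hz
  refine ⟨ε / 2, by positivity, fun z p => s p z, hs0, fun z hz w hw p => ?_, fun z hz p g => ?_,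
    fun z hz p => ?_, ?_, fun p => ?_⟩
  · have h1 := huniq (p := p) (g := 1) (mem_ball_zero_iff.1 hw) (Q.act_one _) z hz
    rw [Q.act_one] at h1
    rw [add_comm w z] at h1
    exact h1.symm
  · have h1 := huniq (p := p) (w := 0) (g := g) (q := Q.act p g) (by simpa using hε)
      (by rw [hs0]) z hz
    rwa [zero_add] at h1
  · obtain ⟨w, hw⟩ := Q.exists_marking_eq η p
    rw [ν.proj_eq_of_isOrbitOn (hs p) (by rw [hs0, hw]) (hmem hz), ← hw, η.symm_apply_apply,
      L.toTorus_add]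
  -- Joint smoothness comes from the single orbit through `p₀`: a nearby `p` is `s p₀ (f p - w₀)`
  -- translated by a group element that depends smoothly on `p`, so `s p z` is `s p₀ (f p - w₀ + z)`
  -- translated by the same element.
  · rintro ⟨z₁, p₀⟩ ⟨hz₁, -⟩
    refine ContMDiffAt.contMDiffWithinAt ?_
    obtain ⟨w₀, hw₀⟩ := Q.exists_marking_eq η p₀
    obtain ⟨U, f, hU, hpU, hf, hfp, hlift⟩ := Q.exists_local_lift η hw₀
    obtain ⟨V, δ, hV, hpV, hδ, hact⟩ := Q.exists_equivariant_map (Q.proj p₀)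
    have hVo : IsOpen (Q.proj ⁻¹' V) := hV.preimage Q.contMDiff_proj.continuous
    have hss : ∀ z ∈ ball (0 : ℂ) ε, ContMDiffAt 𝓘(ℝ, ℂ) IP ∞ (s p₀) z := fun z hz =>
      ((hs p₀).contMDiffOn isOpen_ball hA).contMDiffAt (isOpen_ball.mem_nhds hz)
    have hfa : ContMDiffAt IP 𝓘(ℝ, ℂ) ∞ f p₀ := hf.contMDiffAt (hU.mem_nhds hpU)
    have hδa : ContMDiffAt IP IG ∞ δ p₀ := hδ.contMDiffAt (hVo.mem_nhds hpV)
    have hf' : ContMDiffAt (𝓘(ℝ, ℂ).prod IP) 𝓘(ℝ, ℂ) ∞ (fun q : ℂ × P => f q.2 - w₀) (z₁, p₀) :=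
      (ContMDiffAt.comp (z₁, p₀) hfa contMDiffAt_snd).sub contMDiffAt_const
    have h1 : ContMDiffAt (𝓘(ℝ, ℂ).prod IP) IP ∞
        (fun q : ℂ × P => s p₀ (f q.2 - w₀ + q.1)) (z₁, p₀) := by
      refine ContMDiffAt.comp (g := s p₀) (f := fun q : ℂ × P => f q.2 - w₀ + q.1) (z₁, p₀) ?_
        (hf'.add contMDiffAt_fst)
      simp only [hfp, sub_self, zero_add]
      exact hss z₁ (hmem hz₁)
    have h2 : ContMDiffAt (𝓘(ℝ, ℂ).prod IP) IP ∞ (fun q : ℂ × P => s p₀ (f q.2 - w₀)) (z₁, p₀) := by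
      refine ContMDiffAt.comp (g := s p₀) (f := fun q : ℂ × P => f q.2 - w₀) (z₁, p₀) ?_ hf'
      simp only [hfp, sub_self]
      exact hss 0 (mem_ball_self hε)
    have h3 : ContMDiffAt (𝓘(ℝ, ℂ).prod IP) IG ∞ (fun q : ℂ × P => δ (s p₀ (f q.2 - w₀)))
        (z₁, p₀) := by
      refine ContMDiffAt.comp (g := δ) (f := fun q : ℂ × P => s p₀ (f q.2 - w₀)) (z₁, p₀) ?_ h2
      simp only [hfp, sub_self, hs0]
      exact hδa
    have h4 : ContMDiffAt (𝓘(ℝ, ℂ).prod IP) IG ∞ (fun q : ℂ × P => δ q.2) (z₁, p₀) :=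
      ContMDiffAt.comp (z₁, p₀) hδa contMDiffAt_snd
    have h5 := ContMDiffAt.comp (z₁, p₀) (Q.contMDiff_act.contMDiffAt) (h1.prodMk (h3.inv.mul h4))
    refine h5.congr_of_eventuallyEq ?_
    have hev1 : ∀ᶠ q in 𝓝 p₀, q ∈ U ∧ Q.proj q ∈ V ∧ ‖f q - w₀‖ < ε / 2 := by
      refine (hU.mem_nhds hpU |> Filter.eventually_mem_set.2).and
        ((hVo.mem_nhds hpV |> Filter.eventually_mem_set.2).and ?_)
      have hc : ContinuousAt (fun q => ‖f q - w₀‖) p₀ :=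
        (hfa.continuousAt.sub continuousAt_const).norm
      exact hc.eventually_lt continuousAt_const (by simpa [hfp] using hε)
    have hev2 : ∀ᶠ z in 𝓝 z₁, z ∈ ball (0 : ℂ) (ε / 2) := isOpen_ball.mem_nhds hz₁
    filter_upwards [hev2.prod_nhds hev1]
    rintro ⟨z, p⟩ ⟨hz, hpU', hpV', hfp'⟩
    have hπ : Q.proj (s p₀ (f p - w₀)) = Q.proj p := by
      rw [ν.proj_eq_of_isOrbitOn (hs p₀) (by rw [hs0, hw₀]) (mem_ball_zero_iff.2 (by linarith)),
        add_sub_cancel, hlift p hpU']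
    exact huniq hfp' (hact _ p (by rw [hπ]; exact hpV') hπ) z hz
  · exact hs p 0 (mem_ball_self hε)

end FlatConnection

end LocalFlow


/-! ### The frame of a flat connection -/

section ConnectionFrame

open Set Metric Filter Function

/-- A local homomorphism from the plane to a group extends to a homomorphism. -/
theorem exists_monoidHom_of_local {A : Type*} [Group A] {f : ℂ → A} {ε : ℝ} (hε : 0 < ε)
    (hf : ∀ z ∈ ball (0 : ℂ) ε, ∀ w ∈ ball (0 : ℂ) ε, f (z + w) = f z * f w) :
    ∃ F : Multiplicative ℂ →* A, ∀ z ∈ ball (0 : ℂ) ε, F (Multiplicative.ofAdd z) = f z := by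
  have h0 : f 0 = 1 := by
    have := hf 0 (mem_ball_self hε) 0 (mem_ball_self hε)
    rwa [add_zero, eq_comm, mul_eq_left] at this
  have hpow : ∀ (u : ℂ) (m : ℕ), (m : ℂ) * u ∈ ball (0 : ℂ) ε → f (m * u) = f u ^ m := by
    intro u m
    induction m with
    | zero => intro _; simp [h0]
    | succ m ih =>
      intro hm
      rw [mem_ball_zero_iff, norm_mul, Complex.norm_natCast] at hm
      push_cast at hm
      have hu : 0 ≤ ‖u‖ := norm_nonneg u
      have hmu : 0 ≤ (m : ℝ) * ‖u‖ := by positivity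
      have h1 : (m : ℂ) * u ∈ ball (0 : ℂ) ε := by
        rw [mem_ball_zero_iff, norm_mul, Complex.norm_natCast]
        linarith
      have h2 : u ∈ ball (0 : ℂ) ε := by
        rw [mem_ball_zero_iff]
        linarith
      rw [pow_succ, ← ih h1, ← hf _ h1 _ h2]
      push_cast
      rw [add_mul, one_mul]
  have hdiv : ∀ (z : ℂ) (n m : ℕ), 0 < n → 0 < m → z / n ∈ ball (0 : ℂ) ε →
      f (z / n) ^ n = f (z / (n * m)) ^ (n * m) := by
    intro z n m hn hm hz
    have hm' : (m : ℂ) ≠ 0 := by exact_mod_cast hm.ne'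
    have e : (m : ℂ) * (z / (n * m)) = z / n := by
      field_simp
    rw [mul_comm n m, pow_mul, ← hpow _ m (by rw [e]; exact hz), e]
  have hwd : ∀ (z : ℂ) (n m : ℕ), 0 < n → 0 < m → z / n ∈ ball (0 : ℂ) ε →
      z / m ∈ ball (0 : ℂ) ε → f (z / n) ^ n = f (z / m) ^ m := by
    intro z n m hn hm hzn hzm
    rw [hdiv z n m hn hm hzn, hdiv z m n hm hn hzm, mul_comm n m, mul_comm (n : ℂ) m]
  have hex : ∀ r : ℝ, ∃ n : ℕ, 0 < n ∧ ∀ z : ℂ, ‖z‖ ≤ r → z / n ∈ ball (0 : ℂ) ε := by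
    intro r
    obtain ⟨n, hn⟩ := exists_nat_gt (r / ε)
    refine ⟨n + 1, n.succ_pos, fun z hz => ?_⟩
    rw [mem_ball_zero_iff, norm_div, Complex.norm_natCast]
    push_cast
    rw [div_lt_iff₀ (by positivity)]
    rw [div_lt_iff₀ hε] at hn
    nlinarith
  choose N hN hNb using hex
  -- Every `z` is a multiple of a small element. The power does not depend on the subdivision, by
  -- comparison of two subdivisions with their product.
  let F : ℂ → A := fun z => f (z / N ‖z‖) ^ N ‖z‖
  have hF : ∀ (z : ℂ) (n : ℕ), 0 < n → z / n ∈ ball (0 : ℂ) ε → F z = f (z / n) ^ n :=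
    fun z n hn hz => hwd z _ n (hN _) hn (hNb _ z le_rfl) hz
  refine ⟨MonoidHom.mk' (fun z => F z.toAdd) fun z w => ?_, fun z hz => ?_⟩
  · obtain ⟨z, rfl⟩ := Multiplicative.ofAdd.surjective z
    obtain ⟨w, rfl⟩ := Multiplicative.ofAdd.surjective w
    change F (z + w) = F z * F w
    have hz := hNb (‖z‖ + ‖w‖) z (by linarith [norm_nonneg w])
    have hw := hNb (‖z‖ + ‖w‖) w (by linarith [norm_nonneg z])
    have hzw := hNb (‖z‖ + ‖w‖) (z + w) (norm_add_le z w)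
    -- One subdivision serves `z`, `w` and `z + w` at once; the small pieces commute because
    -- addition in `ℂ` does.
    set n := N (‖z‖ + ‖w‖) with hn
    have hcomm : Commute (f (z / n)) (f (w / n)) := by
      rw [commute_iff_eq, ← hf _ hz _ hw, ← hf _ hw _ hz, add_comm]
    rw [hF _ n (hN _) hz, hF _ n (hN _) hw, hF _ n (hN _) hzw, ← hcomm.mul_pow, ← hf _ hz _ hw,
      add_div]
  · change F z = f z
    rw [hF z 1 one_pos (by simpa using hz)]
    simp

variable {EG HG EP HP ES HS : Type*}
  [NormedAddCommGroup EG] [NormedSpace ℝ EG] [TopologicalSpace HG]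
  [NormedAddCommGroup EP] [NormedSpace ℝ EP] [TopologicalSpace HP]
  [NormedAddCommGroup ES] [NormedSpace ℝ ES] [TopologicalSpace HS]
  {IG : ModelWithCorners ℝ EG HG} {IP : ModelWithCorners ℝ EP HP}
  {IS : ModelWithCorners ℝ ES HS}
  {G : Type*} [TopologicalSpace G] [ChartedSpace HG G] [Group G]
  {P : Type*} [TopologicalSpace P] [ChartedSpace HP P]
  {S : Type*} [TopologicalSpace S] [ChartedSpace HS S]
  {Q : SmoothPrincipalBundle IG IP IS G P S} {L : PlaneLattice}

theorem BundleAut.mul_total_apply (f g : BundleAut Q) (p : P) :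
    (f * g).total p = f.total (g.total p) := rfl

theorem BundleAut.mul_base_apply (f g : BundleAut Q) (x : S) :
    (f * g).base x = f.base (g.base x) := rfl

/-- The local flow consists of bundle automorphisms over translations of the torus, hence is a local
homomorphism into `BundleAut Q`, and it extends to all of `ℂ`. The extension agrees with the flow
near `0`, so its generators are the horizontal lifts of the constant fields. -/
theorem FlatConnection.exists_frame_correspondsTo [IsManifold IP ∞ P] [IP.Boundaryless]
    [FiniteDimensional ℝ EP] [CompactSpace S] [T2Space P] [LieGroup IG ∞ G] (ν : FlatConnection Q)
    (η : L.Torus ≃ₘ^∞⟮𝓘(ℝ, ℂ), IS⟯ S) : ∃ γ : Frame Q, γ.CorrespondsTo L η ν := by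
  have : CompleteSpace EP := FiniteDimensional.complete ℝ EP
  obtain ⟨ε, hε, F, hF0, hFadd, hFact, hFproj, hFs, hFd⟩ := ν.exists_local_flow η
  have hsmooth : ∀ z ∈ ball (0 : ℂ) ε, ContMDiff IP IP ∞ (F z) := by
    intro z hz p
    exact ContMDiffAt.comp (f := fun p : P => (z, p)) p (hFs.contMDiffAt
      ((isOpen_ball.prod isOpen_univ).mem_nhds (⟨hz, trivial⟩ : (z, p) ∈ ball (0 : ℂ) ε ×ˢ univ)))
      (contMDiffAt_const.prodMk contMDiffAt_id)
  have hneg : ∀ z ∈ ball (0 : ℂ) ε, -z ∈ ball (0 : ℂ) ε := fun z hz => by simpa using hz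
  have hinv : ∀ z ∈ ball (0 : ℂ) ε, ∀ p, F (-z) (F z p) = p := fun z hz p => by
    rw [← hFadd _ (hneg z hz) _ hz, neg_add_cancel, hF0]
  have haut : ∀ z : ℂ, ∃ f : BundleAut Q, z ∈ ball (0 : ℂ) ε →
      (∀ p, f.total p = F z p) ∧ ∀ c, f.base (η c) = η (c + L.toTorus z) := by
    intro z
    by_cases hz : z ∈ ball (0 : ℂ) ε
    · refine ⟨⟨⟨⟨F z, F (-z), hinv z hz, fun p => ?_⟩, hsmooth z hz, hsmooth (-z) (hneg z hz)⟩,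
        (η.symm.trans (L.translation (L.toTorus z))).trans η, fun p => ?_, fun p g => ?_⟩,
        fun _ => ⟨fun p => rfl, fun c => ?_⟩⟩
      · have := hinv (-z) (hneg z hz) p
        rwa [neg_neg] at this
      · exact hFproj z hz p
      · exact hFact z hz p g
      · change η (η.symm (η c) + L.toTorus z) = _
        rw [η.symm_apply_apply]
    -- An arbitrary value: only parameters in the ball are used.
    · exact ⟨1, fun h => absurd h hz⟩
  choose f hf using haut
  have hlocal : ∀ z ∈ ball (0 : ℂ) (ε / 2), ∀ w ∈ ball (0 : ℂ) (ε / 2), f (z + w) = f z * f w := by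
    intro z hz w hw
    have hz' : z ∈ ball (0 : ℂ) ε := ball_subset_ball (by linarith) hz
    have hw' : w ∈ ball (0 : ℂ) ε := ball_subset_ball (by linarith) hw
    have hzw : z + w ∈ ball (0 : ℂ) ε := by
      rw [mem_ball_zero_iff] at hz hw ⊢
      linarith [norm_add_le z w]
    refine BundleAut.ext (Diffeomorph.ext fun p => ?_) (Diffeomorph.ext fun x => ?_)
    · rw [BundleAut.mul_total_apply, (hf _ hzw).1, (hf _ hz').1, (hf _ hw').1, hFadd z hz' w hw']
    · obtain ⟨c, rfl⟩ : ∃ c, η c = x := ⟨η.symm x, η.apply_symm_apply x⟩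
      rw [BundleAut.mul_base_apply, (hf _ hzw).2, (hf _ hw').2, (hf _ hz').2, L.toTorus_add,
        add_assoc, add_comm (L.toTorus w)]
  have hε2 : 0 < ε / 2 := by positivity
  obtain ⟨Γ, hΓ⟩ := exists_monoidHom_of_local hε2 hlocal
  have hΓadd : ∀ z w : ℂ, Γ (Multiplicative.ofAdd (z + w)) =
      Γ (Multiplicative.ofAdd z) * Γ (Multiplicative.ofAdd w) := fun z w => by
    rw [ofAdd_add, map_mul]
  have hΓt : ∀ z ∈ ball (0 : ℂ) (ε / 2), ∀ p, (Γ (Multiplicative.ofAdd z)).total p = F z p := by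
    intro z hz p
    rw [hΓ z hz, (hf z (ball_subset_ball (by linarith) hz)).1]
  have hΓb : ∀ (z : ℂ) (c : L.Torus), (Γ (Multiplicative.ofAdd z)).base (η c) =
      η (c + L.toTorus z) := by
    -- The formula for the base action is known for small `u`, passes to multiples by induction, and
    -- reaches every `z` as `n * (z / n)`.
    have hmul : ∀ (u : ℂ), u ∈ ball (0 : ℂ) (ε / 2) → ∀ (n : ℕ) (c : L.Torus),
        (Γ (Multiplicative.ofAdd (n * u))).base (η c) = η (c + L.toTorus (n * u)) := by
      intro u hu n
      induction n with
      | zero =>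
        intro c
        rw [Nat.cast_zero, zero_mul, L.toTorus_zero, add_zero, ofAdd_zero, map_one]
        rfl
      | succ n ih =>
        intro c
        have e : ((n + 1 : ℕ) : ℂ) * u = n * u + u := by push_cast; ring
        rw [e, hΓadd, BundleAut.mul_base_apply, hΓ u hu,
          (hf u (ball_subset_ball (by linarith) hu)).2, ih, L.toTorus_add, add_assoc,
          add_comm (L.toTorus u)]
    intro z
    obtain ⟨n, hn⟩ := exists_nat_gt (‖z‖ / (ε / 2))
    have hn0 : (0 : ℝ) < n := lt_of_le_of_lt (by positivity) hn
    have hu : z / n ∈ ball (0 : ℂ) (ε / 2) := by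
      rw [mem_ball_zero_iff, norm_div, Complex.norm_natCast, div_lt_iff₀ hn0]
      rwa [div_lt_iff₀ hε2, mul_comm] at hn
    have e : (n : ℂ) * (z / n) = z := by
      have : (n : ℂ) ≠ 0 := by exact_mod_cast hn0.ne'
      field_simp
    have := hmul _ hu n
    rwa [e] at this
  have hΓc : Continuous fun q : ℂ × P => (Γ (Multiplicative.ofAdd q.1)).total q.2 := by
    rw [continuous_iff_continuousAt]
    rintro ⟨z₀, p₀⟩
    -- Near `z₀` the action is `Γ z₀` composed with the local flow at `z - z₀`, which is jointly
    -- continuous.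
    have h1 : ContinuousAt (fun q : ℂ × P => F (q.1 - z₀) q.2) (z₀, p₀) := by
      have h2 : ContinuousAt (fun q : ℂ × P => F q.1 q.2) (z₀ - z₀, p₀) := by
        refine (hFs.contMDiffAt ((isOpen_ball.prod isOpen_univ).mem_nhds ⟨?_, trivial⟩)).continuousAt
        rw [sub_self]
        exact mem_ball_self hε
      exact ContinuousAt.comp (f := fun q : ℂ × P => (q.1 - z₀, q.2)) (x := (z₀, p₀)) h2 (by fun_prop)
    have h3 : ContinuousAt (fun q : ℂ × P => (Γ (Multiplicative.ofAdd z₀)).total (F (q.1 - z₀) q.2))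
        (z₀, p₀) := ((Γ (Multiplicative.ofAdd z₀)).total.continuous.continuousAt).comp h1
    refine h3.congr ?_
    have hev : ∀ᶠ q : ℂ × P in 𝓝 (z₀, p₀), q.1 - z₀ ∈ ball (0 : ℂ) (ε / 2) := by
      have hc : ContinuousAt (fun q : ℂ × P => q.1 - z₀) (z₀, p₀) := by fun_prop
      exact hc.preimage_mem_nhds (isOpen_ball.mem_nhds (by simpa using hε2))
    filter_upwards [hev] with q hq
    rw [← hΓt _ hq, ← BundleAut.mul_total_apply, ← hΓadd, add_sub_cancel]
  have hcont : Continuous Γ := by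
    refine continuous_induced_rng.2 ?_
    refine ContinuousMap.continuous_of_continuous_uncurry _ ?_
    exact hΓc
  let γ : Frame Q := ⟨⟨Γ, hcont⟩, fun x y => by
    obtain ⟨c, rfl⟩ : ∃ c, η c = x := ⟨η.symm x, η.apply_symm_apply x⟩
    obtain ⟨d, rfl⟩ : ∃ c, η c = y := ⟨η.symm y, η.apply_symm_apply y⟩
    obtain ⟨z, hz⟩ := L.surjective_toTorus (d - c)
    refine ⟨z, (hΓb z c).trans ?_⟩
    rw [hz, add_sub_cancel]⟩
  refine ⟨γ, γ.correspondsTo_of_gen_mem (fun c z => hΓb z c) fun p v => ?_⟩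
  have h1 := γ.totalAction.hasMFDerivAt_flow 0 p
  have h2 : HasMFDerivAt 𝓘(ℝ, ℂ) IP (fun z => γ.totalAction.flow z p) 0
      (ν.horizontalLift η (F 0 p)) := by
    refine (hFd p).congr_of_eventuallyEq ?_
    filter_upwards [ball_mem_nhds (0 : ℂ) hε2] with z hz
    exact hΓt z hz p
  have h3 := congrArg (fun A : ℂ →L[ℝ] EP => A v) (hasMFDerivAt_unique h1 h2)
  change γ.totalAction.gen (γ.totalAction.flow 0 p) v = ν.horizontalLift η (F 0 p) v at h3
  rw [γ.totalAction.flow_zero, hF0] at h3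
  rw [h3]
  exact ν.horizontalLift_mem η p v

end ConnectionFrame


/-! ### Uniqueness -/

section Uniqueness

open Set Metric Filter Function

variable {EG HG EP HP ES HS : Type*}
  [NormedAddCommGroup EG] [NormedSpace ℝ EG] [TopologicalSpace HG]
  [NormedAddCommGroup EP] [NormedSpace ℝ EP] [TopologicalSpace HP]
  [NormedAddCommGroup ES] [NormedSpace ℝ ES] [TopologicalSpace HS]
  {IG : ModelWithCorners ℝ EG HG} {IP : ModelWithCorners ℝ EP HP}
  {IS : ModelWithCorners ℝ ES HS}
  {G : Type*} [TopologicalSpace G] [ChartedSpace HG G] [Group G]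
  {P : Type*} [TopologicalSpace P] [ChartedSpace HP P] [IsManifold IP ∞ P]
  {S : Type*} [TopologicalSpace S] [ChartedSpace HS S]
  {Q : SmoothPrincipalBundle IG IP IS G P S} {L : PlaneLattice}

/-- Transport only records end points. Slowing a lift down by the factor `r` makes `β r` an end
point, so statements about transport give information along the whole curve. -/
theorem PrincipalConnection.IsHorizontalLift.comp_mul {ν : PrincipalConnection Q} {α : ℝ → S}
    {β : ℝ → P} (h : ν.IsHorizontalLift α β) {r : ℝ} (hr : r ∈ Icc (0 : ℝ) 1) :
    ν.IsHorizontalLift (fun t => α (r * t)) fun t => β (r * t) := by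
  obtain ⟨hs, hp, hh⟩ := h
  have hmaps : MapsTo (fun t : ℝ => r * t) (Icc 0 1) (Icc 0 1) := fun t ht =>
    ⟨mul_nonneg hr.1 ht.1, mul_le_one₀ hr.2 ht.1 ht.2⟩
  refine ⟨?_, fun t ht => hp _ (hmaps ht), fun t ht => ?_⟩
  · exact hs.comp (contDiff_const.mul contDiff_id).contMDiff.contMDiffOn hmaps
  · have hu : UniqueMDiffWithinAt 𝓘(ℝ, ℝ) (Icc (0 : ℝ) 1) t :=
      (uniqueDiffOn_Icc zero_lt_one t ht).uniqueMDiffWithinAt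
    have d1 : HasMFDerivWithinAt 𝓘(ℝ, ℝ) IP β (Icc (0 : ℝ) 1) (r * t)
        (mfderivWithin 𝓘(ℝ, ℝ) IP β (Icc (0 : ℝ) 1) (r * t)) :=
      ((hs _ (hmaps ht)).mdifferentiableWithinAt (by simp)).hasMFDerivWithinAt
    have d2 : HasMFDerivWithinAt 𝓘(ℝ, ℝ) 𝓘(ℝ, ℝ) (fun t : ℝ => r * t) (Icc (0 : ℝ) 1) t
        (r • ContinuousLinearMap.id ℝ ℝ) :=
      ((hasFDerivAt_id t).const_mul r).hasFDerivWithinAt.hasMFDerivWithinAt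
    have d3 := (HasMFDerivWithinAt.comp (f := fun t : ℝ => r * t) t d1 d2 hmaps).mfderivWithin hu
    have d4 := congrArg (fun A : ℝ →L[ℝ] EP => A 1) d3
    have d5 : (mfderivWithin 𝓘(ℝ, ℝ) IP β (Icc (0 : ℝ) 1) (r * t) : ℝ →L[ℝ] EP) (r • (1 : ℝ)) =
        r • (mfderivWithin 𝓘(ℝ, ℝ) IP β (Icc (0 : ℝ) 1) (r * t) : ℝ →L[ℝ] EP) 1 := map_smul _ _ _
    have d6 := d4.trans d5
    have d7 : r • (mfderivWithin 𝓘(ℝ, ℝ) IP β (Icc (0 : ℝ) 1) (r * t) (1 : ℝ)) ∈ ν.hor (β (r * t)) :=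
      Submodule.smul_mem _ _ (hh _ (hmaps ht))
    exact d6.symm.subst (motive := fun u : EP => u ∈ (ν.hor (β (r * t)) : Submodule ℝ EP)) d7

namespace Frame.CorrespondsTo

variable {γ γ' : Frame Q} {η η' : L.Torus ≃ₘ^∞⟮𝓘(ℝ, ℂ), IS⟯ S} {ν ν' : FlatConnection Q}

theorem lattice_eq [Nonempty S] {L' : PlaneLattice} {η' : L'.Torus ≃ₘ^∞⟮𝓘(ℝ, ℂ), IS⟯ S}
    (h : γ.CorrespondsTo L η ν) (h' : γ.CorrespondsTo L' η' ν') : L = L' := by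
  obtain ⟨x⟩ := ‹Nonempty S›
  exact PlaneLattice.ext (SetLike.ext fun z => (h.isotropy x z).trans (h'.isotropy x z).symm)

theorem marking_eq (h : γ.CorrespondsTo L η ν) (h' : γ.CorrespondsTo L η' ν') :
    Quotient.mk (translationSetoid IS S L) η = Quotient.mk (translationSetoid IS S L) η' := by
  -- Both markings intertwine the same transitive action, so they differ by the translation that
  -- matches them at `0`.
  refine Quotient.sound ⟨η.symm (η' 0), fun c => ?_⟩
  obtain ⟨z, rfl⟩ := L.surjective_toTorus c
  have h1 := h'.base_eq 0 z
  have h2 := h.base_eq (η.symm (η' 0)) z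
  rw [η.apply_symm_apply] at h2
  rw [zero_add] at h1
  rw [← h1, h2, add_comm]

/-- The segment from `0` to `z` already determines `γ z` on `P` by horizontal lifting; the base
component is read off from the marking. -/
theorem frame_eq (h : γ.CorrespondsTo L η ν) (h' : γ'.CorrespondsTo L η ν) : γ = γ' := by
  have key : γ.toHom = γ'.toHom := by
    refine ContinuousMonoidHom.ext fun z => ?_
    obtain ⟨z, rfl⟩ := Multiplicative.ofAdd.surjective z
    refine BundleAut.ext (Diffeomorph.ext fun p => ?_) (Diffeomorph.ext fun x => ?_)
    · have ha : ContDiffOn ℝ ∞ (fun t : ℝ => t • z) (Icc 0 1) := ContDiff.contDiffOn (by fun_prop)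
      exact (h'.total_eq z p _ ha (by simp) (by simp) _).1
        ((h.total_eq z p _ ha (by simp) (by simp) _).2 rfl)
    · obtain ⟨c, rfl⟩ : ∃ c, η c = x := ⟨η.symm x, η.apply_symm_apply x⟩
      exact (h.base_eq c z).trans (h'.base_eq c z).symm
  cases γ
  cases γ'
  congr

variable [IP.Boundaryless] [FiniteDimensional ℝ EP]

/-- The converse of `correspondsTo_of_gen_mem`: the transport condition identifies the horizontal
lift of the ray in direction `v` with the orbit curve `t ↦ γ (t • v) p`, and its velocity at time
`0` is the generator. -/
theorem gen_mem (h : γ.CorrespondsTo L η ν) (p : P) (v : ℂ) :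
    γ.totalAction.gen p v ∈ ν.hor p := by
  obtain ⟨w, hw⟩ := Q.exists_marking_eq η p
  have ha : ∀ r : ℝ, ContDiffOn ℝ ∞ (fun t : ℝ => w + (r * t) • v) (Icc 0 1) := fun r =>
    ContDiff.contDiffOn (by fun_prop)
  have hlift : ∃ β : ℝ → P, ν.IsHorizontalLift (fun t => η (L.toTorus (w + t • v))) β ∧ β 0 = p := by
    obtain ⟨β, hβ, h0, -⟩ := (h.transport (fun t => η (L.toTorus (w + t • v))) (fun t => w + t • v)
      (by simpa using ha 1) (fun t _ => rfl) p _ (by simp [hw])).2 rfl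
    exact ⟨β, hβ, h0⟩
  obtain ⟨β, hβ, h0⟩ := hlift
  have hval : ∀ r ∈ Icc (0 : ℝ) 1, β r = γ.totalAction.flow (r • v) p := by
    intro r hr
    have h1 := (h.transport (fun t => η (L.toTorus (w + (r * t) • v))) (fun t => w + (r * t) • v)
      (ha r) (fun t _ => rfl) p (β r) (by simp [hw])).1
      ⟨fun t => β (r * t), hβ.comp_mul hr, by simpa using h0, by simp⟩
    simp only [mul_one, mul_zero, zero_smul, add_zero, add_sub_cancel_left] at h1
    exact h1
  have h01 : (0 : ℝ) ∈ Icc (0 : ℝ) 1 := by simp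
  have hu : UniqueMDiffWithinAt 𝓘(ℝ, ℝ) (Icc (0 : ℝ) 1) 0 :=
    (uniqueDiffOn_Icc zero_lt_one 0 h01).uniqueMDiffWithinAt
  have d1 : HasMFDerivAt 𝓘(ℝ, ℝ) 𝓘(ℝ, ℂ) (fun t : ℝ => t • v) 0
      ((ContinuousLinearMap.id ℝ ℝ).smulRight v) :=
    ((hasFDerivAt_id (0 : ℝ)).smul_const v).hasMFDerivAt
  have d2 : HasMFDerivAt 𝓘(ℝ, ℂ) IP (fun z => γ.totalAction.flow z p) ((0 : ℝ) • v)
      (γ.totalAction.gen p) := by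
    have := γ.totalAction.hasMFDerivAt_flow 0 p
    rw [γ.totalAction.flow_zero] at this
    rwa [zero_smul]
  have d3 := HasMFDerivAt.comp (f := fun t : ℝ => t • v) 0 d2 d1
  have d4 : HasMFDerivWithinAt 𝓘(ℝ, ℝ) IP β (Icc (0 : ℝ) 1) 0
      ((γ.totalAction.gen p).comp ((ContinuousLinearMap.id ℝ ℝ).smulRight v)) := by
    refine d3.hasMFDerivWithinAt.congr_of_eventuallyEq ?_ (hval 0 h01)
    filter_upwards [self_mem_nhdsWithin] with t ht using hval t ht
  have d5 := congrArg (fun A : ℝ →L[ℝ] EP => A 1) (d4.mfderivWithin hu)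
  change (mfderivWithin 𝓘(ℝ, ℝ) IP β (Icc (0 : ℝ) 1) 0 (1 : ℝ) : EP) =
    γ.totalAction.gen p ((1 : ℝ) • v) at d5
  rw [one_smul] at d5
  have d6 := hβ.2.2 0 h01
  rw [h0] at d6
  exact d5.subst (motive := fun u : EP => u ∈ (ν.hor p : Submodule ℝ EP)) d6

theorem of_marking_eq (h : γ.CorrespondsTo L η ν) {a : L.Torus} (ha : ∀ c, η' c = η (c + a)) :
    γ.CorrespondsTo L η' ν := by
  refine γ.correspondsTo_of_gen_mem (fun c z => ?_) h.gen_mem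
  rw [ha, ha, h.base_eq, add_right_comm]

/-- The generators are horizontal and already project onto the whole tangent space of the base, so
they exhaust the horizontal space. The frame thus determines its connection. -/
theorem hor_eq (h : γ.CorrespondsTo L η ν) (p : P) :
    ν.hor p = LinearMap.range (γ.totalAction.gen p).toLinearMap := by
  ext u
  constructor
  · intro hu
    obtain ⟨w, hw⟩ := Q.exists_marking_eq η p
    obtain ⟨v, hv⟩ : ∃ v : ℂ, mfderiv 𝓘(ℝ, ℂ) IS (fun z => η (L.toTorus z)) w v =
      mfderiv IP IS Q.proj p u := (bijective_mfderiv_marking η w).surjective _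
    refine ⟨v, ν.eq_of_mfderiv_proj_eq (h.gen_mem p v) hu ?_⟩
    exact (γ.mfderiv_proj_gen h.base_eq hw.symm v).trans hv
  · rintro ⟨v, rfl⟩
    exact h.gen_mem p v

theorem connection_eq {L' : PlaneLattice} {η' : L'.Torus ≃ₘ^∞⟮𝓘(ℝ, ℂ), IS⟯ S}
    (h : γ.CorrespondsTo L η ν) (h' : γ.CorrespondsTo L' η' ν') : ν = ν' :=
  FlatConnection.ext (funext fun p => (h.hor_eq p).trans (h'.hor_eq p).symm)

end Frame.CorrespondsTo

end Uniqueness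

/-! ### The bijection between frames and triples -/

theorem mainTheorem6
    {EG HG EP HP ES HS : Type*}
    [NormedAddCommGroup EG] [NormedSpace ℝ EG] [FiniteDimensional ℝ EG] [TopologicalSpace HG]
    [NormedAddCommGroup EP] [NormedSpace ℝ EP] [FiniteDimensional ℝ EP] [TopologicalSpace HP]
    [NormedAddCommGroup ES] [NormedSpace ℝ ES] [FiniteDimensional ℝ ES] [TopologicalSpace HS]
    (IG : ModelWithCorners ℝ EG HG) [IG.Boundaryless]
    (IP : ModelWithCorners ℝ EP HP) [IP.Boundaryless]
    (IS : ModelWithCorners ℝ ES HS) [IS.Boundaryless]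
    (G : Type*) [TopologicalSpace G] [ChartedSpace HG G] [Group G] [LieGroup IG ∞ G]
    [CompactSpace G] [T2Space G]
    (P : Type*) [TopologicalSpace P] [ChartedSpace HP P] [IsManifold IP ∞ P]
    (S : Type*) [TopologicalSpace S] [ChartedSpace HS S] [IsManifold IS ∞ S]
    (hS : IsGenusOneSurface IS S)
    (Q : SmoothPrincipalBundle IG IP IS G P S) :
    ∃ Φ : Frame Q ≃ FlatTriple Q,
      ∀ (γ : Frame Q) (η : (Φ γ).lattice.Torus ≃ₘ^∞⟮𝓘(ℝ, ℂ), IS⟯ S),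
        Quotient.mk (translationSetoid IS S (Φ γ).lattice) η = (Φ γ).marking →
        γ.CorrespondsTo (Φ γ).lattice η (Φ γ).connection := by
  have := hS.t2Space
  have := hS.compactSpace
  have := hS.nonempty
  have := Q.t2Space
  choose Λ μ ν hγ using fun γ : Frame Q => γ.exists_correspondsTo hS
  let φ : Frame Q → FlatTriple Q := fun γ =>
    ⟨Λ γ, Quotient.mk (translationSetoid IS S (Λ γ)) (μ γ), ν γ⟩
  have huniq : ∀ (γ : Frame Q) (L : PlaneLattice) (η : L.Torus ≃ₘ^∞⟮𝓘(ℝ, ℂ), IS⟯ S)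
      (κ : FlatConnection Q), γ.CorrespondsTo L η κ →
      φ γ = ⟨L, Quotient.mk (translationSetoid IS S L) η, κ⟩ := by
    intro γ L η κ h
    have h' := hγ γ
    change FlatTriple.mk (Λ γ) (Quotient.mk (translationSetoid IS S (Λ γ)) (μ γ)) (ν γ) = _
    -- The type of the marking depends on the lattice, so the two lattices have to be identified
    -- before the markings can be compared.
    generalize μ γ = η' at h' ⊢
    generalize ν γ = κ' at h' ⊢
    generalize Λ γ = L' at η' h' ⊢
    obtain rfl := h'.lattice_eq h
    rw [h'.connection_eq h, h'.marking_eq h]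
  have hcorr : ∀ (γ : Frame Q) (η : (φ γ).lattice.Torus ≃ₘ^∞⟮𝓘(ℝ, ℂ), IS⟯ S),
      Quotient.mk (translationSetoid IS S (φ γ).lattice) η = (φ γ).marking →
      γ.CorrespondsTo (φ γ).lattice η (φ γ).connection := by
    intro γ η hη
    -- Any other representative is the chosen marking precomposed with a translation, and the
    -- correspondence is insensitive to that.
    obtain ⟨a, ha⟩ := Quotient.exact hη.symm
    exact (hγ γ).of_marking_eq ha
  have hbij : Function.Bijective φ := by
    constructor
    · intro γ γ' h
      obtain ⟨η, hη⟩ := Quotient.exists_rep (φ γ).marking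
      have h1 := hcorr γ η hη
      have h2 := hcorr γ'
      rw [← h] at h2
      exact h1.frame_eq (h2 η hη)
    · rintro ⟨L, m, κ⟩
      obtain ⟨η, rfl⟩ := Quotient.exists_rep m
      obtain ⟨γ, h⟩ := κ.exists_frame_correspondsTo η
      exact ⟨γ, huniq γ L η κ h⟩
  exact ⟨Equiv.ofBijective φ hbij, hcorr⟩
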